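/- **Setting.** Fix $d\ge 1$. Let $E=\{0,\dots,n-1\}$ and let $\mathcal L\subseteq\{+,-,0\}^E$ be the set of covectors of an acyclic oriented matroid of rank $d+1$ without duplicate elements: $\mathcal L$ satisfies the covector axioms, $(+,\dots,+)\in\mathcal L$, and no two distinct elements have the same sign in every covector. Covectors are ordered by $X\le Y$ iff $X_e=Y_e$ whenever $X_e\ne 0$. Write $z(X)=\{e: X_e=0\}$, and let $\nabla:E^{d+1}\to\{+,-,0\}$ be the given chirotope of the oriented matroid, that is, one of the two chirotopes $\pm\nabla$ determined by $\mathcal L$. A *face-flag* is a sequence $\phi=(X^{(1)},\dots,X^{(d-1)})$ of covectors such that $(+,\dots,+)=X^{(0)}>X^{(1)}>\dots>X^{(d-1)}>X^{(d)}>\mathbf 0$ is a maximal chain of $\mathcal L$ for some $X^{(d)}$. **The order.** A listing of $E$ is produced from $\mathcal L,\nabla,\phi$ by recursion on the rank. In rank 1 there is only one element. In rank $d+1\ge 2$, put $F=z(X^{(d-1)})$ and choose $e_i\in z(X^{(i)})\setminus z(X^{(i-1)})$ for $1\le i\le d-1$. The contraction $\mathcal L/F$ has rank 2, so it is an arrangement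 on a circle. Let $Y,Z$ be the two vertices bounding its positive edge, choose $e_Y\in z(Y)\setminus F$ and $e_Z\in z(Z)\setminus F$, and name the vertices such that $\nabla(e_1,\dots,e_{d-1},e_Y,e_Z)=+$. Walking around the circle from the positive edge through $Y$, one meets the vertices $Y=Y^{(1)},\dots,Y^{(k)},-Y^{(1)},\dots,-Y^{(k)}$. Let $E_i=z(Y^{(i)})\supseteq F$. The deletion $\mathcal L^{(i)}=\mathcal L\setminus(E\setminus E_i)$ is acyclic of rank $d$; give it the chirotope $\nabla^{(i)}$ with $\nabla(x_1,\dots,x_d,f)=\nabla^{(i)}(x_1,\dots,x_d)\,Y^{(i)}_f$ for $x_1,\dots,x_d\in E_i$ and $f\in E\setminus E_i$, and list $E_i$ recursively using the restriction of the flag $(X^{(1)},\dots,X^{(d-2)})$ to $E_i$. List the elements of $E_1,\dots,E_k$ in this order, omitting those of $F$ for $i\ge 2$. **Theorem.** For every $d\ge1$ there are a program $P$ and a constant $C$ such that, for all $n,\mathcal L,\nabla,\phi$ as above: 1. All choices in the recursive construction lead to one and the same listing, and it contains each element of $E$ exactly once; thus it is an order $\pi_\phi:[n]\to E$ that depends only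 on the oriented matroid (given by $\mathcal L$ with its chirotope $\nabla$) and on $\phi$. 2. Given the precomputed arrangement of $\mathcal L$ in memory and the face-flag $\phi$, the program $P$ outputs $\pi_\phi$ after at most $C\,n$ steps. Here $P$ runs on a unit-cost random access machine (registers, work memory, read-only input memory, successor and predecessor, comparisons, one-step queries of $\nabla$). The arrangement is stored as its cell-tuple structure: one record per maximal chain $c_0>c_1>\dots>c_d>\mathbf 0$ of covectors, holding for each $0\le i\le d$ the address of the record of the maximal chain that differs from it exactly in $c_i$, and the label of the element $e$ with $z(c_1)=\{e\}$. The face-flag is given by the address of the record of any maximal chain $X^{(0)}>\dots>X^{(d-1)}>X^{(d)}>\mathbf 0$, and $n$ is given as well. The order does not depend on the choice of $X^{(d)}$ or on the memory layout. -/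

import Mathlib

/-! ### Sign vectors and oriented matroids (covector axioms) -/

/-- Sign vectors indexed by `E`, i.e. signed subsets of `E`. -/
abbrev SV (E : Type*) := E → SignType

section OrientedMatroids

variable {E : Type*}

/-- Composition `X ∘ Y` of sign vectors. -/
def SV.comp (X Y : SV E) : SV E := fun e => if X e = 0 then Y e else X e

/-- The covector order: `X ≤ Y` if `X_e = Y_e` whenever `X_e ≠ 0`.
(This is not the pointwise order on functions.) -/
def SV.Le (X Y : SV E) : Prop := ∀ e, X e ≠ 0 → X e = Y e

/-- The strict covector order. -/
def SV.Lt (X Y : SV E) : Prop := X.Le Y ∧ X ≠ Y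

/-- `{X_e, Y_e} = {+, -}`. -/
def SV.Sep (X Y : SV E) (e : E) : Prop := X e ≠ 0 ∧ X e = -Y e

/-- The covector axioms (CV0)-(CV3). -/
structure IsOrientedMatroid (L : Set (SV E)) : Prop where
  zero_mem : (0 : SV E) ∈ L
  neg_mem : ∀ X ∈ L, -X ∈ L
  comp_mem : ∀ X ∈ L, ∀ Y ∈ L, X.comp Y ∈ L
  elim : ∀ X ∈ L, ∀ Y ∈ L, ∀ e, X.Sep Y e →
    ∃ Z ∈ L, Z e = 0 ∧ ∀ f, ¬ X.Sep Y f → Z f = X.comp Y f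

/-- The rank: the number of elements of a longest chain of covectors, minus 1. -/
def HasRank (L : Set (SV E)) (r : ℕ) : Prop :=
  IsGreatest {k : ℕ | ∃ c : Fin (k + 1) → SV E,
    (∀ i, c i ∈ L) ∧ ∀ i j, i < j → (c i).Lt (c j)} r

/-- Acyclic: `(+, …, +)` is a covector. -/
def IsAcyclicOM (L : Set (SV E)) : Prop := (fun _ => 1) ∈ L

/-- No two distinct elements are copies of each other. -/
def NoDuplicates (L : Set (SV E)) : Prop := ∀ e f : E, e ≠ f → ∃ X ∈ L, X e ≠ X f

/-- Cocircuits (vertices): the minimal nonzero covectors. -/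
def IsCocircuit (L : Set (SV E)) (V : SV E) : Prop :=
  V ∈ L ∧ V ≠ 0 ∧ ∀ W ∈ L, W ≠ 0 → W.Le V → W = V

/-- Topes (full-dimensional faces): the maximal covectors. -/
def IsTope (L : Set (SV E)) (T : SV E) : Prop :=
  T ∈ L ∧ ∀ W ∈ L, T.Le W → W = T

/-- `χ` is one of the two chirotopes (of rank `d + 1`) of the oriented matroid with covectors `L`:
a nonzero alternating map satisfying (B2') whose nonzero vectors `± χ(λ, ·)` are exactly the
cocircuits. -/
structure IsChirotopeOf {d : ℕ} (χ : (Fin (d + 1) → E) → SignType) (L : Set (SV E)) : Prop where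
  ne_zero : ∃ x, χ x ≠ 0
  alternating : ∀ (x : Fin (d + 1) → E) (i j : Fin (d + 1)), i ≠ j →
    χ (x ∘ Equiv.swap i j) = -χ x
  exchange : ∀ x y : Fin (d + 1) → E, χ x * χ y ≠ 0 →
    ∃ i, χ (Function.update x 0 (y i)) * χ (Function.update y i (x 0)) = χ x * χ y
  cocircuits : ∀ V : SV E, IsCocircuit L V ↔
    V ≠ 0 ∧ ∃ l : Fin d → E, V = (fun e => χ (Fin.snoc l e)) ∨ V = -(fun e => χ (Fin.snoc l e))

/-! ### Maximal chains and face-flags -/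

/-- `τ 0 > τ 1 > ⋯ > τ (d + 1) = 0` is a maximal chain of covectors. -/
structure IsMaxCovChain {d : ℕ} (L : Set (SV E)) (τ : Fin (d + 2) → SV E) : Prop where
  mem : ∀ i, τ i ∈ L
  lt : ∀ i j, i < j → (τ j).Lt (τ i)
  last : τ (Fin.last (d + 1)) = 0
  maximal : ∀ W ∈ L, (∀ i, W.Le (τ i) ∨ (τ i).Le W) → ∃ i, W = τ i

/-- The sequence `X⁽⁰⁾ = (+, …, +), X⁽¹⁾, …, X⁽ᵈ⁻¹⁾` of `φ = (X⁽¹⁾, …, X⁽ᵈ⁻¹⁾)`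
(continued by irrelevant zeros). -/
def flagSeq {d : ℕ} (φ : Fin (d - 1) → SV E) : ℕ → SV E
  | 0 => fun _ => 1
  | i + 1 => if h : i < d - 1 then φ ⟨i, h⟩ else 0

/-- The chain `τ` is `(+, …, +) = X⁽⁰⁾ > X⁽¹⁾ > ⋯ > X⁽ᵈ⁻¹⁾ > X⁽ᵈ⁾ > 0` for some `X⁽ᵈ⁾`. -/
def ChainExtends {d : ℕ} (τ : Fin (d + 2) → SV E) (φ : Fin (d - 1) → SV E) : Prop :=
  ∀ i : Fin (d + 2), (i : ℕ) < d → τ i = flagSeq φ i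

/-- Face-flags. -/
def IsFaceFlag {d : ℕ} (L : Set (SV E)) (φ : Fin (d - 1) → SV E) : Prop :=
  ∃ τ : Fin (d + 2) → SV E, IsMaxCovChain L τ ∧ ChainExtends τ φ

/-! ### Minors

A minor has as ground set a finite subset `S` of `E`; its covectors are written as sign vectors on
`E` that vanish outside `S`. -/

/-- Restriction of a sign vector to `S`. -/
def SV.restrict [DecidableEq E] (S : Finset E) (X : SV E) : SV E :=
  fun e => if e ∈ S then X e else 0

/-- The zero set `z(X)` in the ground set `S`. -/
def SV.zeros (S : Finset E) (X : SV E) : Finset E := S.filter (fun e => X e = 0)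

/-- The deletion of everything outside `S`. -/
def deletionTo [DecidableEq E] (L : Set (SV E)) (S : Finset E) : Set (SV E) :=
  {X | ∃ W ∈ L, X = W.restrict S}

/-- The contraction `L / A`. -/
def contraction (L : Set (SV E)) (A : Finset E) : Set (SV E) :=
  {X | X ∈ L ∧ ∀ e ∈ A, X e = 0}

/-! ### The order of a face-flag -/

/-- In an oriented matroid `L'` of rank 2 (a circle), `Ys = [Y⁽¹⁾, …, Y⁽ᵏ⁾]` are the vertices
met in a walk that starts in the edge `T₀`, up to the antipode of the first vertex. The walk
passes alternately through edges `T 0, T 1, …` and vertices `V 0, V 1, …` and never turns back. -/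
def IsHalfWalk (L' : Set (SV E)) (T₀ : SV E) (Ys : List (SV E)) : Prop :=
  ∃ T V : ℕ → SV E,
    T 0 = T₀ ∧ (∀ i, IsTope L' (T i)) ∧ (∀ i, IsCocircuit L' (V i)) ∧
    (∀ i, (V i).Lt (T i) ∧ (V i).Lt (T (i + 1))) ∧
    (∀ i, T (i + 1) ≠ T i) ∧ (∀ i, V (i + 1) ≠ V i) ∧
    V Ys.length = -V 0 ∧ (∀ i, i < Ys.length → V i ≠ -V 0) ∧
    ∀ (i : ℕ) (h : i < Ys.length), Ys[i] = V i

/-- Concatenate the lists of `blocks`, omitting the elements of `F` from all but the first. -/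
def concatBlocks [DecidableEq E] (F : Finset E) : List (List E) → List E
  | [] => []
  | B :: Bs => B ++ (Bs.map (fun B' => B'.filter (fun e => e ∉ F))).flatten

/-- `IsFlagOrder d S L χ X π`: the list `π` is an order produced by the recursive construction for
the oriented matroid with ground set `S`, covectors `L`, rank `d + 1` and chirotope `χ`, from the
face-flag `X 1, …, X (d - 1)`, where `X 0` is `+` on all of `S` (other values of `X` are not used).

In rank 1 there is only one element. In rank `d + 1 = k + 2`, let `F = z(X⁽ᵈ⁻¹⁾)`, let `Y`, `Z` be
the two vertices of the positive edge of the rank-2 contraction `L / F`, named such that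
`χ(e₁, …, e_{d-1}, e_Y, e_Z) = +`. Walk along the circle from the positive edge through
`Y = Y⁽¹⁾, …, Y⁽ᵏ⁾`. With `Eᵢ = z(Y⁽ⁱ⁾)`, which contains `F`, the order of the deletion to `Eᵢ`
is found recursively, for the restricted flag and the induced chirotope `χᵢ`, the one
with `χ(x₁, …, x_d, f) = χᵢ(x₁, …, x_d) · Y⁽ⁱ⁾_f` for `f ∉ Eᵢ`. -/
def IsFlagOrder [DecidableEq E] : (d : ℕ) → (S : Finset E) → (L : Set (SV E)) →
    (χ : (Fin (d + 1) → E) → SignType) → (X : ℕ → SV E) → (π : List E) → Prop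
  | 0, S, _, _, _, π => ∃ e, S = {e} ∧ π = [e]
  | k + 1, S, L, χ, X, π =>
    ∃ (e : Fin k → E) (Y Z : SV E) (eY eZ : E) (Ys : List (SV E)) (blocks : List (List E)),
      (∀ i : Fin k, e i ∈ (X (i + 1)).zeros S ∧ e i ∉ (X i).zeros S) ∧
      IsCocircuit (contraction L ((X k).zeros S)) Y ∧ Y.Lt (X k) ∧
      IsCocircuit (contraction L ((X k).zeros S)) Z ∧ Z.Lt (X k) ∧ Y ≠ Z ∧
      (eY ∈ Y.zeros S ∧ eY ∉ (X k).zeros S) ∧ (eZ ∈ Z.zeros S ∧ eZ ∉ (X k).zeros S) ∧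
      χ (Fin.snoc (Fin.snoc e eY : Fin (k + 1) → E) eZ) = 1 ∧
      Ys.head? = some Y ∧ IsHalfWalk (contraction L ((X k).zeros S)) (X k) Ys ∧
      List.Forall₂ (fun V B => ∃ f ∈ S, f ∉ V.zeros S ∧
        IsFlagOrder k (V.zeros S) (deletionTo L (V.zeros S))
          (fun x => χ (Fin.snoc x f) * V f) (fun j => (X j).restrict (V.zeros S)) B) Ys blocks ∧
      π = concatBlocks ((X k).zeros S) blocks

/-! ### The precomputed arrangement

The cell complex is stored by its cell-tuples: one record for every maximal chain
`c₀ > c₁ > ⋯ > c_d > 0` of faces (`c₀` a full-dimensional cell, `c_d` a vertex). It holds, for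
every `i ≤ d`, the address of the record of the chain that differs from it exactly in the `i`-th
face, and the label of the pseudosphere that carries the facet `c₁`. -/

/-- The memory `inp` holds the arrangement of `L`, the record of the chain `τ` being at
address `addr τ`. -/
structure StoresArrangement {n : ℕ} (d : ℕ) (L : Set (SV (Fin n))) (inp : ℕ → ℕ)
    (addr : (Fin (d + 2) → SV (Fin n)) → ℕ) : Prop where
  inj : Set.InjOn addr {τ | IsMaxCovChain L τ}
  switch : ∀ τ, IsMaxCovChain L τ → ∀ i : Fin (d + 1), ∃ τ', IsMaxCovChain L τ' ∧
    τ' i.castSucc ≠ τ i.castSucc ∧ (∀ j, j ≠ i.castSucc → τ' j = τ j) ∧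
    inp (addr τ + i) = addr τ'
  label : ∀ τ, IsMaxCovChain L τ → ∀ e : Fin n, τ 1 e = 0 → inp (addr τ + (d + 1)) = e

end OrientedMatroids

/-! ### A random access machine

Unit-cost structured programs with registers, a work memory, a read-only input memory and
an orientation oracle. Arithmetic is restricted to successor and predecessor, so that numbers
stay small. -/

/-- Instructions; register numbers and constants are fixed in the program. -/
inductive Instr (r : ℕ) where
  | const (x c : ℕ)
  | copy (x y : ℕ)
  | succ (x y : ℕ)
  | pred (x y : ℕ)
  /-- read the cell of the input memory whose address is in register `y` -/
  | input (x y : ℕ)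
  /-- read the cell of the work memory whose address is in register `y` -/
  | load (x y : ℕ)
  /-- write register `y` into the cell of the work memory whose address is in register `x` -/
  | store (x y : ℕ)
  /-- query the orientation of the `r` elements whose labels are in the registers `ys` -/
  | orient (x : ℕ) (ys : Fin r → ℕ)

/-- Comparisons of two registers. -/
inductive Test where
  | eq (x y : ℕ)
  | lt (x y : ℕ)

inductive Prog (r : ℕ) where
  | instr (a : Instr r)
  | seq (p q : Prog r)
  | ite (b : Test) (p q : Prog r)
  | loop (b : Test) (p : Prog r)

structure MState where
  reg : ℕ → ℕ
  mem : ℕ → ℕ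

def MState.setReg (s : MState) (x v : ℕ) : MState := { s with reg := Function.update s.reg x v }

/-- The answer of the orientation oracle: `0`, `1`, `2` for `0`, `+`, `-`. -/
def signCode (σ : SignType) : ℕ := if σ = 0 then 0 else if σ = 1 then 1 else 2

def oracle {r n : ℕ} (χ : (Fin r → Fin n) → SignType) (v : Fin r → ℕ) : ℕ :=
  if h : ∀ i, v i < n then signCode (χ fun i => ⟨v i, h i⟩) else 0

def Instr.apply {r n : ℕ} (χ : (Fin r → Fin n) → SignType) (inp : ℕ → ℕ) :
    Instr r → MState → MState
  | .const x c, s => s.setReg x c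
  | .copy x y, s => s.setReg x (s.reg y)
  | .succ x y, s => s.setReg x (s.reg y + 1)
  | .pred x y, s => s.setReg x (s.reg y - 1)
  | .input x y, s => s.setReg x (inp (s.reg y))
  | .load x y, s => s.setReg x (s.mem (s.reg y))
  | .store x y, s => { s with mem := Function.update s.mem (s.reg x) (s.reg y) }
  | .orient x ys, s => s.setReg x (oracle χ fun i => s.reg (ys i))

def Test.Holds (s : MState) : Test → Prop
  | .eq x y => s.reg x = s.reg y
  | .lt x y => s.reg x < s.reg y

/-- `Exec χ inp p s t s'`: started in state `s`, the program `p` halts in state `s'` after exactly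
`t` steps, where every instruction and every evaluation of a test is one step. -/
inductive Exec {r n : ℕ} (χ : (Fin r → Fin n) → SignType) (inp : ℕ → ℕ) :
    Prog r → MState → ℕ → MState → Prop where
  | instr (a : Instr r) (s : MState) : Exec χ inp (.instr a) s 1 (a.apply χ inp s)
  | seq {p q : Prog r} {s s' s'' : MState} {t t' : ℕ} :
      Exec χ inp p s t s' → Exec χ inp q s' t' s'' → Exec χ inp (.seq p q) s (t + t') s''
  | ite_true {b : Test} {p q : Prog r} {s s' : MState} {t : ℕ} :
      b.Holds s → Exec χ inp p s t s' → Exec χ inp (.ite b p q) s (t + 1) s'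
  | ite_false {b : Test} {p q : Prog r} {s s' : MState} {t : ℕ} :
      ¬ b.Holds s → Exec χ inp q s t s' → Exec χ inp (.ite b p q) s (t + 1) s'
  | loop_stop {b : Test} {p : Prog r} {s : MState} :
      ¬ b.Holds s → Exec χ inp (.loop b p) s 1 s
  | loop_step {b : Test} {p : Prog r} {s s' s'' : MState} {t t' : ℕ} :
      b.Holds s → Exec χ inp p s t s' → Exec χ inp (.loop b p) s' t' s'' →
      Exec χ inp (.loop b p) s (t + t' + 1) s''

/-- The initial state: `n` in register 0, an address in register 1, everything else zero. -/
def initState (n a : ℕ) : MState where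
  reg := fun x => if x = 0 then n else if x = 1 then a else 0
  mem := fun _ => 0

/-! ### Sign vectors, elimination, and maximal chains. -/

section SignVectors

variable {E : Type*}

/-! Well-definedness. Every flat `S` met in the recursion is treated inside the original oriented
matroid: its covectors are restrictions of members of `L`, and its circle is `flagCircle L X k S`.
On a circle every edge has exactly two vertices, and crossing a vertex reverses exactly its zeros.
So a walk that never turns back is determined by its start, and until it reaches the antipode of its
first edge it crosses every non-loop exactly once (`IsWalk.half`). Hence the blocks exhaust `S` and
meet only in `F`. The choice of `Y` does not depend on the chosen elements: as a function of one
entry the chirotope is, up to sign, a covector vanishing at the other entries, and this covector is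
constant on the set from which the entry is taken (`IsLocalChirotope.eq_of_transversal`,
`IsLevel.orientation_eq`). Likewise the induced chirotope does not depend on `f`, at least on
independent families, and the order sees no others (`IsLevel.induced_eq`). Induction on the rank
gives `isLevelOrder_existsUnique`.

Linear time. Let `c 0 > c 1 > ⋯` be the current chain. If `c j = c (k+1) ∘ X j` for `j < k`, then
`Prog.sweep d k` lists the zeros of `c (k+1)` that are not zeros of `c k`, in the order of the flat
of `c (k+1)`, and ends at a chain in which `c k` is reflected at `c (k+1)`. For `k = 0` this is one
element and one switch of `c 0`. At level `k+1` the chain stands at a vertex `A` of the positive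
edge of the circle of `c (k+2)`. A switch of `c (k+1)` leads to the other vertex of the current
edge; a sweep of level `k` lists what is new at this vertex and crosses it to the next edge. This is
repeated up to `-A`, when everything outside the zeros of `A` has been listed.

If the walk of the construction starts at the other vertex `B`, its blocks are met in the right
order. If it starts at `A`, it visits the antipodes of the same vertices in reverse order, with the
same flats and opposite induced chirotopes. So one sign decides both whether blocks are appended or
prepended and which sign is handed down (`IsLevelOrder.decompose`). It is read off from a single
query, with one entry a zero of `A` and one entry on the current vertex; the query vanishes exactly
at `-A` and thus also serves as stopping test (`IsSweepCircle.query_eq`). Apart from the recursive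
sweep, a visit of a vertex costs constant time and yields at least one element, so the time is
proportional to the length of the list (`Runs.sweep`).

The whole order consists of the order of the first block followed by the elements outside it
(`IsLevelOrder.eq_append`). The program finds `Y`, sweeps the outside of its flat, puts the result
in front of the output, returns to `Y` and goes on inside; after `d` sweeps one element is left
(`Runs.list`). Linked lists are joined in constant time, and the final one is copied to an array. -/

theorem SignType.eq_or_eq_neg_of_ne_zero {s t : SignType} (hs : s ≠ 0) (ht : t ≠ 0) :
    s = t ∨ s = -t := by
  revert hs ht; revert s t; decide

theorem SignType.ne_neg_of_ne_zero {s : SignType} (hs : s ≠ 0) : s ≠ -s := by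
  revert hs; revert s; decide

theorem SignType.neg_ne_zero_iff {s : SignType} : -s ≠ 0 ↔ s ≠ 0 := by
  revert s; decide

theorem SV.neg_ne_zero {X : SV E} (h : X ≠ 0) : -X ≠ 0 := by
  obtain ⟨e, he⟩ := Function.ne_iff.1 h
  exact Function.ne_iff.2 ⟨e, SignType.neg_ne_zero_iff.2 he⟩

theorem SV.comp_apply_of_eq_zero {X : SV E} (Y : SV E) {e : E} (h : X e = 0) :
    X.comp Y e = Y e := if_pos h

theorem SV.comp_apply_of_ne_zero {X : SV E} (Y : SV E) {e : E} (h : X e ≠ 0) :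
    X.comp Y e = X e := if_neg h

theorem SV.comp_apply_eq_zero {X Y : SV E} {e : E} : X.comp Y e = 0 ↔ X e = 0 ∧ Y e = 0 := by
  by_cases h : X e = 0 <;> simp [SV.comp, h]

theorem SV.Le.refl (X : SV E) : X.Le X := fun _ _ => rfl

theorem SV.Le.trans {X Y Z : SV E} (h : X.Le Y) (h' : Y.Le Z) : X.Le Z := fun e he =>
  (h e he).trans (h' e (h e he ▸ he))

theorem SV.Le.antisymm {X Y : SV E} (h : X.Le Y) (h' : Y.Le X) : X = Y := by
  funext e
  by_cases he : X e = 0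
  · by_contra hne
    exact hne (h' e fun h0 => hne (he.trans h0.symm)).symm
  · exact h e he

theorem SV.Le.eq_zero {X Y : SV E} (h : X.Le Y) {e : E} (he : Y e = 0) : X e = 0 := by
  by_contra h0
  exact h0 ((h e h0).trans he)

theorem SV.le_comp (X Y : SV E) : X.Le (X.comp Y) := fun _ he =>
  (SV.comp_apply_of_ne_zero Y he).symm

theorem SV.Le.neg {X Y : SV E} (h : X.Le Y) : (-X).Le (-Y) := fun e he => by
  have := h e (by simpa using he)
  simp [this]

theorem SV.Lt.neg {X Y : SV E} (h : X.Lt Y) : (-X).Lt (-Y) :=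
  ⟨h.1.neg, fun h' => h.2 (neg_injective h')⟩

theorem SV.Le.comp_eq {X Y : SV E} (h : X.Le Y) : X.comp Y = Y := by
  funext e
  by_cases he : X e = 0
  · exact SV.comp_apply_of_eq_zero Y he
  · rw [SV.comp_apply_of_ne_zero Y he, h e he]

theorem SV.comp_assoc (X Y Z : SV E) : (X.comp Y).comp Z = X.comp (Y.comp Z) := by
  funext e
  by_cases h : X e = 0 <;> simp [SV.comp, h]

theorem SV.Lt.exists_ne_zero {X Y : SV E} (h : X.Lt Y) : ∃ e, X e = 0 ∧ Y e ≠ 0 := by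
  by_contra! hc
  apply h.2
  funext e
  by_cases he : X e = 0
  · rw [he, hc e he]
  · exact h.1 e he

theorem SV.sep_neg_iff {X Y : SV E} {e : E} : X.Sep (-Y) e ↔ X e ≠ 0 ∧ X e = Y e := by
  simp [SV.Sep]

theorem SV.not_sep_iff {X Y : SV E} {e : E} (h : X e ≠ 0) (h' : Y e ≠ 0) :
    ¬ X.Sep Y e ↔ X e = Y e := by
  unfold SV.Sep
  revert h h'
  generalize X e = s
  generalize Y e = t
  revert s t
  decide

/-- Elimination that stays conformal to the first covector. -/
theorem IsOrientedMatroid.exists_conformal [Finite E] {L : Set (SV E)} (hL : IsOrientedMatroid L)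
    {X : SV E} (hX : X ∈ L) (Y : SV E) (hY : Y ∈ L) (hs : ∃ e, X.Sep Y e) :
    ∃ Z ∈ L, (∃ e, X.Sep Y e ∧ Z e = 0) ∧ (∀ f, ¬ X.Sep Y f → Z f = X.comp Y f) ∧
      ∀ f, X.Sep Y f → Z f = 0 ∨ Z f = X f := by
  induction hN : {e | X.Sep Y e}.ncard using Nat.strong_induction_on generalizing Y with
  | _ N ih =>
  subst hN
  obtain ⟨e, he⟩ := hs
  obtain ⟨W, hW, hWe, hWf⟩ := hL.elim X hX Y hY e he
  -- If `W` still opposes `X` somewhere, it does so only where `Y` did, and no longer at `e`; so the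
  -- induction applies to `X` and `W`.
  by_cases h : ∃ f, X.Sep W f
  · have hsub : ∀ f, X.Sep W f → X.Sep Y f := by
      intro f hf
      by_contra hn
      have h1 := hWf f hn
      rw [SV.comp_apply_of_ne_zero Y hf.1] at h1
      have h2 := hf.2
      rw [h1] at h2
      exact SignType.ne_neg_of_ne_zero hf.1 h2
    have hlt : {e | X.Sep W e}.ncard < {e | X.Sep Y e}.ncard := by
      apply Set.ncard_lt_ncard _ (Set.toFinite _)
      refine ⟨hsub, fun hc => ?_⟩
      have := hc he
      have h2 := this.2
      rw [hWe] at h2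
      exact this.1 (by simpa using h2)
    obtain ⟨Z, hZ, ⟨e', he', hZe'⟩, hZ1, hZ2⟩ := ih _ hlt W hW h rfl
    refine ⟨Z, hZ, ⟨e', hsub _ he', hZe'⟩, ?_, ?_⟩
    · intro f hf
      rw [hZ1 f (fun hc => hf (hsub f hc))]
      by_cases h0 : X f = 0
      · rw [SV.comp_apply_of_eq_zero _ h0, hWf f hf]
      · rw [SV.comp_apply_of_ne_zero _ h0, SV.comp_apply_of_ne_zero _ h0]
    · intro f hf
      by_cases hc : X.Sep W f
      · exact hZ2 f hc
      · right
        rw [hZ1 f hc, SV.comp_apply_of_ne_zero _ hf.1]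
  · push Not at h
    refine ⟨W, hW, ⟨e, he, hWe⟩, hWf, ?_⟩
    intro f hf
    by_cases h0 : W f = 0
    · exact .inl h0
    · exact .inr ((SV.not_sep_iff hf.1 h0).1 (h f)).symm

/-- A covector that vanishes where `X` does is constant, relative to `X`, on the zero set of any
covector that `X` covers. -/
theorem IsOrientedMatroid.constant_of_covers [Finite E] {L : Set (SV E)}
    (hL : IsOrientedMatroid L) {X X' W : SV E} (hX : X ∈ L) (hX' : X' ∈ L) (hlt : X'.Lt X)
    (hcov : ∀ Z ∈ L, X'.Le Z → Z.Le X → Z = X' ∨ Z = X) (hW : W ∈ L)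
    (h0 : ∀ e, X e = 0 → W e = 0) :
    (∀ e, X' e = 0 → W e = 0) ∨ (∀ e, X' e = 0 → W e = X e) ∨ ∀ e, X' e = 0 → W e = -X e := by
  have hYL := hL.comp_mem X' hX' W hW
  -- Conformal elimination gives `Z` between `X'` and `X` with a zero where `X` has none, so `Z =
  -- X'`, and this forces every zero of `X'` outside those of `X` to separate. Without separation
  -- `X' ∘ W` itself lies between `X'` and `X`.
  by_cases hs : ∃ e, X.Sep (X'.comp W) e
  · obtain ⟨Z, hZ, ⟨e, he, hZe⟩, hZ1, hZ2⟩ := hL.exists_conformal hX _ hYL hs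
    have hZX : Z.Le X := by
      intro f hf
      by_cases hsf : X.Sep (X'.comp W) f
      · exact (hZ2 f hsf).resolve_left hf
      · rw [hZ1 f hsf] at hf ⊢
        by_cases hXf : X f = 0
        · exact absurd (SV.comp_apply_eq_zero.2 ⟨hXf,
            SV.comp_apply_eq_zero.2 ⟨hlt.1.eq_zero hXf, h0 f hXf⟩⟩) hf
        · exact SV.comp_apply_of_ne_zero _ hXf
    have hXZ : X'.Le Z := by
      intro f hf
      have h1 := hlt.1 f hf
      have hXf : X f ≠ 0 := h1 ▸ hf
      have hsf : ¬ X.Sep (X'.comp W) f := by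
        rintro ⟨-, h2⟩
        rw [SV.comp_apply_of_ne_zero _ hf, h1] at h2
        exact SignType.ne_neg_of_ne_zero hXf h2
      rw [hZ1 f hsf, SV.comp_apply_of_ne_zero _ hXf, h1]
    rcases hcov Z hZ hXZ hZX with rfl | rfl
    · right; right
      intro f hf
      by_cases hXf : X f = 0
      · rw [hXf, h0 f hXf]; rfl
      · by_cases hsf : X.Sep (Z.comp W) f
        · have h2 := hsf.2
          rw [SV.comp_apply_of_eq_zero _ hf] at h2
          rw [h2, neg_neg]
        · have h2 := hZ1 f hsf
          rw [SV.comp_apply_of_ne_zero _ hXf, hf] at h2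
          exact absurd h2.symm hXf
    · exact absurd hZe he.1
  · push Not at hs
    have hle : (X'.comp W).Le X := by
      intro f hf
      by_cases h1 : X f = 0
      · exact absurd (SV.comp_apply_eq_zero.2 ⟨hlt.1.eq_zero h1, h0 f h1⟩) hf
      · exact ((SV.not_sep_iff h1 hf).1 (hs f)).symm
    rcases hcov _ hYL (SV.le_comp _ _) hle with h | h
    · left
      intro e he
      have := congrFun h e
      rwa [SV.comp_apply_of_eq_zero _ he, he] at this
    · right; left
      intro e he
      have := congrFun h e
      rwa [SV.comp_apply_of_eq_zero _ he] at this

theorem IsMaxCovChain.le {d : ℕ} {L : Set (SV E)} {τ : Fin (d + 2) → SV E}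
    (h : IsMaxCovChain L τ) {i j : Fin (d + 2)} (hij : i ≤ j) : (τ j).Le (τ i) := by
  rcases hij.eq_or_lt with rfl | h'
  · exact SV.Le.refl _
  · exact (h.lt _ _ h').1

/-- A covector between consecutive members is comparable to the whole chain, so maximality applies.
-/
theorem IsMaxCovChain.covers {d : ℕ} {L : Set (SV E)} {τ : Fin (d + 2) → SV E}
    (h : IsMaxCovChain L τ) {i j : Fin (d + 2)} (hij : (j : ℕ) = i + 1) {Z : SV E} (hZ : Z ∈ L)
    (h1 : (τ j).Le Z) (h2 : Z.Le (τ i)) : Z = τ j ∨ Z = τ i := by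
  obtain ⟨l, rfl⟩ := h.maximal Z hZ fun l => by
    rcases le_or_gt l i with hl | hl
    · exact .inl (h2.trans (h.le hl))
    · exact .inr ((h.le (show j ≤ l by rw [Fin.le_def]; rw [Fin.lt_def] at hl; omega)).trans h1)
  rcases le_or_gt l i with hl | hl
  · exact .inr (h2.antisymm (h.le hl))
  · exact .inl ((h.le (show j ≤ l by rw [Fin.le_def]; rw [Fin.lt_def] at hl; omega)).antisymm h1)

/-- Constancy of covectors along the steps of a maximal chain. -/
theorem IsMaxCovChain.constant [Finite E] {d : ℕ} {L : Set (SV E)} (hL : IsOrientedMatroid L)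
    {τ : Fin (d + 2) → SV E} (h : IsMaxCovChain L τ) {i j : Fin (d + 2)} (hij : (j : ℕ) = i + 1)
    {W : SV E} (hW : W ∈ L) (h0 : ∀ e, τ i e = 0 → W e = 0) :
    (∀ e, τ j e = 0 → W e = 0) ∨ (∀ e, τ j e = 0 → W e = τ i e) ∨
      ∀ e, τ j e = 0 → W e = -τ i e :=
  hL.constant_of_covers (h.mem i) (h.mem j) (h.lt i j (by rw [Fin.lt_def]; omega))
    (fun _ hZ h1 h2 => h.covers hij hZ h1 h2) hW h0

end SignVectors

/-! ### Rank 2: vertices, edges and walks on a circle. -/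

section Circle

variable {E : Type*}

/-- An oriented matroid of rank 2 with set of non-loops `D`. -/
structure IsCircle (L : Set (SV E)) (D : Set E) : Prop where
  om : IsOrientedMatroid L
  supp : ∀ V ∈ L, ∀ e, e ∉ D → V e = 0
  exists_vertex : ∀ g ∈ D, ∃ V ∈ L, V ≠ 0 ∧ V g = 0
  unique : ∀ g ∈ D, ∀ V ∈ L, ∀ V' ∈ L, V ≠ 0 → V' ≠ 0 → V g = 0 → V' g = 0 → V' = V ∨ V' = -V
  exists_tope : ∃ T ∈ L, ∀ e ∈ D, T e ≠ 0
  nonempty : D.Nonempty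

namespace IsCircle

variable {L : Set (SV E)} {D : Set E}

theorem mem_of_ne_zero (h : IsCircle L D) {V : SV E} (hV : V ∈ L) {e : E} (he : V e ≠ 0) :
    e ∈ D := by
  by_contra hc
  exact he (h.supp V hV e hc)

theorem isTope_iff (h : IsCircle L D) {T : SV E} : IsTope L T ↔ T ∈ L ∧ ∀ e ∈ D, T e ≠ 0 := by
  constructor
  · rintro ⟨hT, hmax⟩
    refine ⟨hT, fun e he h0 => ?_⟩
    obtain ⟨T₀, hT₀, h1⟩ := h.exists_tope
    have := congrFun (hmax _ (h.om.comp_mem T hT T₀ hT₀) (SV.le_comp _ _)) e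
    rw [SV.comp_apply_of_eq_zero _ h0, h0] at this
    exact h1 e he this
  · rintro ⟨hT, h1⟩
    refine ⟨hT, fun W hW hle => ?_⟩
    funext e
    by_cases he : e ∈ D
    · exact (hle e (h1 e he)).symm
    · rw [h.supp T hT e he, h.supp W hW e he]

theorem isCocircuit_of (h : IsCircle L D) {V : SV E} (hV : V ∈ L) (h0 : V ≠ 0) {g : E}
    (hg : g ∈ D) (hVg : V g = 0) : IsCocircuit L V := by
  refine ⟨hV, h0, fun W hW hW0 hle => ?_⟩
  rcases h.unique g hg V hV W hW h0 hW0 hVg (hle.eq_zero hVg) with h1 | h1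
  · exact h1
  · exfalso
    obtain ⟨e, he⟩ := Function.ne_iff.1 hW0
    have h2 := hle e he
    rw [h1] at h2 he
    simp only [Pi.neg_apply, Pi.zero_apply, ne_eq] at h2 he
    exact SignType.ne_neg_of_ne_zero (s := V e) (by simpa using he) h2.symm

/-- A cocircuit without zeros could be eliminated conformally against a vertex at `g` or its
negative. The result keeps the sign at `g` and is properly smaller, contradicting minimality. -/
theorem exists_zero_of_isCocircuit [Finite E] (h : IsCircle L D) {V : SV E}
    (hV : IsCocircuit L V) : ∃ g ∈ D, V g = 0 := by
  by_contra! hc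
  obtain ⟨g, hg⟩ := h.nonempty
  obtain ⟨U, hU, hU0, hUg⟩ := h.exists_vertex g hg
  obtain ⟨e, he⟩ := Function.ne_iff.1 hU0
  have heD := h.mem_of_ne_zero hU he
  have key : ∀ U ∈ L, U g = 0 → V.Sep U e → False := by
    intro U hU hUg hsep
    obtain ⟨Z, hZ, ⟨f, hf, hZf⟩, h1, h2⟩ := h.om.exists_conformal hV.1 U hU ⟨e, hsep⟩
    have hng : ¬ V.Sep U g := fun hs => hs.1 (by rw [hs.2, hUg]; rfl)
    have hZg : Z g = V g := by
      rw [h1 g hng, SV.comp_apply_of_ne_zero _ (hc g hg)]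
    have hle : Z.Le V := by
      intro a ha
      have haD := h.mem_of_ne_zero hZ ha
      by_cases hs : V.Sep U a
      · exact (h2 a hs).resolve_left ha
      · rw [h1 a hs, SV.comp_apply_of_ne_zero _ (hc a haD)]
    have hZ0 : Z ≠ 0 := fun h0 => hc g hg (by rw [← hZg, h0]; rfl)
    have := hV.2.2 Z hZ hZ0 hle
    rw [this] at hZf
    exact hf.1 hZf
  rcases SignType.eq_or_eq_neg_of_ne_zero (hc e heD) he with h1 | h1
  · refine key (-U) (h.om.neg_mem U hU) (by simp [hUg]) ⟨hc e heD, by simp [h1]⟩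
  · exact key U hU hUg ⟨hc e heD, h1⟩

theorem isCocircuit_neg (h : IsCircle L D) {V : SV E} (hV : IsCocircuit L V) :
    IsCocircuit L (-V) := by
  refine ⟨h.om.neg_mem V hV.1, SV.neg_ne_zero hV.2.1, fun W hW hW0 hle => ?_⟩
  have h1 := hV.2.2 (-W) (h.om.neg_mem W hW) (SV.neg_ne_zero hW0) (by simpa using hle.neg)
  rw [← h1, neg_neg]

theorem isTope_neg (h : IsCircle L D) {T : SV E} (hT : IsTope L T) : IsTope L (-T) := by
  rw [h.isTope_iff] at hT ⊢
  exact ⟨h.om.neg_mem T hT.1, fun e he => by simpa using hT.2 e he⟩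

theorem ne_neg_of_lt {V A T : SV E} (hV0 : V ≠ 0) (hV : V.Lt T) (hA : A.Lt T) :
    A ≠ -V := by
  rintro rfl
  obtain ⟨e, he⟩ := Function.ne_iff.1 hV0
  have h1 := hV.1 e he
  have h2 := hA.1 e (by simpa using he)
  rw [← h1] at h2
  exact SignType.ne_neg_of_ne_zero he h2.symm

/-- Nonzero covectors with a common zero among the non-loops are equal or opposite, and opposite
ones cannot lie below the same edge. -/
theorem no_common_zero (h : IsCircle L D) {A B T : SV E} (hA : IsCocircuit L A)
    (hB : IsCocircuit L B) (hAT : A.Lt T) (hBT : B.Lt T) (hne : A ≠ B) {g : E} (hg : g ∈ D)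
    (hAg : A g = 0) : B g ≠ 0 := by
  intro hBg
  rcases h.unique g hg A hA.1 B hB.1 hA.2.1 hB.2.1 hAg hBg with h1 | h1
  · exact hne h1.symm
  · exact ne_neg_of_lt hA.2.1 hAT hBT h1

theorem lt_of_le (h : IsCircle L D) {V T : SV E} {g : E} (hg : g ∈ D) (hT : IsTope L T)
    (hVg : V g = 0) (hle : V.Le T) : V.Lt T := by
  refine ⟨hle, ?_⟩
  rintro rfl
  exact (h.isTope_iff.1 hT).2 g hg hVg

/-- Conformal elimination between the two edges gives a covector above `V` with a zero; being a
cocircuit, it is `V`. It vanishes only where the edges have opposite signs, so crossing `V` reverses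
every zero of `V` and nothing else. -/
theorem tope_apply_eq [Finite E] (h : IsCircle L D) {V T T' : SV E} (hV : IsCocircuit L V)
    (hT : IsTope L T) (hT' : IsTope L T') (hVT : V.Lt T) (hVT' : V.Lt T') (hne : T' ≠ T) :
    T' = V.comp (-T) := by
  have hT1 := h.isTope_iff.1 hT
  have hT2 := h.isTope_iff.1 hT'
  have hs : ∃ e, T.Sep T' e := by
    by_contra! hc
    apply hne
    funext e
    by_cases he : e ∈ D
    · exact ((SV.not_sep_iff (hT1.2 e he) (hT2.2 e he)).1 (hc e)).symm
    · rw [h.supp _ hT1.1 e he, h.supp _ hT2.1 e he]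
  obtain ⟨Z, hZ, ⟨f, hf, hZf⟩, h1, h2⟩ := h.om.exists_conformal hT1.1 T' hT2.1 hs
  have hVZ : V.Le Z := by
    intro e he
    have e1 := hVT.1 e he
    have e2 := hVT'.1 e he
    have hTe : T e ≠ 0 := e1 ▸ he
    rw [h1 e, SV.comp_apply_of_ne_zero _ hTe, e1]
    rintro ⟨-, h3⟩
    rw [← e1, ← e2] at h3
    exact SignType.ne_neg_of_ne_zero he h3
  have hfD : f ∈ D := h.mem_of_ne_zero hT1.1 hf.1
  have hVf : V f = 0 := by
    by_contra hc
    exact hc ((hVZ f hc).trans hZf)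
  have hZ0 : Z ≠ 0 := by
    rintro rfl
    obtain ⟨e, he⟩ := Function.ne_iff.1 hV.2.1
    exact he (hVZ e he)
  have hZV : V = Z := (h.isCocircuit_of hZ hZ0 hfD hZf).2.2 V hV.1 hV.2.1 hVZ
  subst hZV
  funext e
  by_cases he : V e = 0
  · rw [SV.comp_apply_of_eq_zero _ he, Pi.neg_apply]
    by_cases heD : e ∈ D
    · by_cases hse : T.Sep T' e
      · rw [hse.2, neg_neg]
      · have := h1 e hse
        rw [SV.comp_apply_of_ne_zero _ (hT1.2 e heD), he] at this
        exact absurd this.symm (hT1.2 e heD)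
    · rw [h.supp _ hT1.1 e heD, h.supp _ hT2.1 e heD]; rfl
  · rw [SV.comp_apply_of_ne_zero _ he, hVT'.1 e he]

theorem isTope_opposite [Finite E] (h : IsCircle L D) {V T : SV E} (hV : IsCocircuit L V)
    (hT : IsTope L T) :
    IsTope L (V.comp (-T)) ∧ V.Lt (V.comp (-T)) ∧ V.comp (-T) ≠ T := by
  have hT1 := h.isTope_iff.1 hT
  obtain ⟨g, hg, hVg⟩ := h.exists_zero_of_isCocircuit hV
  have h1 : IsTope L (V.comp (-T)) := by
    rw [h.isTope_iff]
    refine ⟨h.om.comp_mem _ hV.1 _ (h.om.neg_mem _ hT1.1), fun e he => ?_⟩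
    rw [Ne, SV.comp_apply_eq_zero]
    rintro ⟨-, h0⟩
    exact hT1.2 e he (by simpa using h0)
  refine ⟨h1, h.lt_of_le hg h1 hVg (SV.le_comp _ _), fun hc => ?_⟩
  have := congrFun hc g
  rw [SV.comp_apply_of_eq_zero _ hVg, Pi.neg_apply] at this
  exact SignType.ne_neg_of_ne_zero (hT1.2 g hg) this.symm

/-- Conformal elimination between the edges produces a vertex of `T` that keeps the sign of `T`
wherever the edges agree. It is nonzero because `T' ≠ -T` provides such a place. -/
theorem exists_vertex_separated [Finite E] (h : IsCircle L D) {T T' : SV E} (hT : IsTope L T)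
    (hT' : IsTope L T') (hne : T' ≠ T) (hne' : T' ≠ -T) :
    ∃ Z, IsCocircuit L Z ∧ Z.Lt T ∧ ∀ g ∈ D, Z g = 0 → T' g ≠ T g := by
  have hT1 := h.isTope_iff.1 hT
  have hT2 := h.isTope_iff.1 hT'
  have hs : ∃ e, T.Sep T' e := by
    by_contra! hc
    apply hne
    funext e
    by_cases he : e ∈ D
    · exact ((SV.not_sep_iff (hT1.2 e he) (hT2.2 e he)).1 (hc e)).symm
    · rw [h.supp _ hT1.1 e he, h.supp _ hT2.1 e he]
  obtain ⟨a, ha, haD⟩ : ∃ a, ¬ T.Sep T' a ∧ a ∈ D := by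
    by_contra! hc
    apply hne'
    funext e
    by_cases he : e ∈ D
    · have h3 : T.Sep T' e := by
        by_contra h4
        exact hc e h4 he
      rw [Pi.neg_apply, h3.2, neg_neg]
    · rw [Pi.neg_apply, h.supp _ hT1.1 e he, h.supp _ hT2.1 e he]; rfl
  obtain ⟨Z, hZ, ⟨f, hf, hZf⟩, h1, h2⟩ := h.om.exists_conformal hT1.1 T' hT2.1 hs
  have hfD : f ∈ D := h.mem_of_ne_zero hT1.1 hf.1
  have hle : Z.Le T := by
    intro e he
    have heD := h.mem_of_ne_zero hZ he
    by_cases hse : T.Sep T' e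
    · exact (h2 e hse).resolve_left he
    · rw [h1 e hse, SV.comp_apply_of_ne_zero _ (hT1.2 e heD)]
  have hZ0 : Z ≠ 0 := by
    rintro rfl
    have := h1 a ha
    rw [SV.comp_apply_of_ne_zero _ (hT1.2 a haD)] at this
    exact hT1.2 a haD this.symm
  refine ⟨Z, h.isCocircuit_of hZ hZ0 hfD hZf, h.lt_of_le hfD hT hZf hle, fun g hg hZg heq => ?_⟩
  have hns : ¬ T.Sep T' g := (SV.not_sep_iff (hT1.2 g hg) (hT2.2 g hg)).2 heq.symm
  rw [h1 g hns, SV.comp_apply_of_ne_zero _ (hT1.2 g hg)] at hZg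
  exact hT1.2 g hg hZg

/-- The negative of the edge beyond `A` agrees with `T` on the zeros of `A`. So a vertex of `T`
whose zeros separate these two edges is not `A`. -/
theorem exists_other_vertex [Finite E] (h : IsCircle L D) {A T : SV E} (hA : IsCocircuit L A)
    (hT : IsTope L T) (hAT : A.Lt T) : ∃ B, IsCocircuit L B ∧ B.Lt T ∧ B ≠ A := by
  obtain ⟨h1, h2, h3⟩ := h.isTope_opposite hA hT
  obtain ⟨e, he⟩ := Function.ne_iff.1 hA.2.1
  obtain ⟨Z, hZ, hZT, hZ0⟩ := h.exists_vertex_separated hT (h.isTope_neg h1)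
    (fun hc => by
      have := congrFun hc e
      rw [Pi.neg_apply, SV.comp_apply_of_ne_zero _ he, ← hAT.1 e he] at this
      exact SignType.ne_neg_of_ne_zero he this.symm)
    (fun hc => h3 (neg_injective hc))
  refine ⟨Z, hZ, hZT, ?_⟩
  rintro rfl
  obtain ⟨g, hg, hAg⟩ := h.exists_zero_of_isCocircuit hZ
  apply hZ0 g hg hAg
  rw [Pi.neg_apply, SV.comp_apply_of_eq_zero _ hAg, Pi.neg_apply, neg_neg]

/-- Given three vertices, eliminating a zero of `A` from `B` and `-C` yields `A` or `-A` by
uniqueness. But the result agrees with `-T` at a zero of `B` and with `T` at a zero of `C`, whereas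
`A` agrees with `T` at both. -/
theorem eq_or_eq_of_lt [Finite E] (h : IsCircle L D) {A B C T : SV E} (hA : IsCocircuit L A)
    (hB : IsCocircuit L B) (hC : IsCocircuit L C) (hAT : A.Lt T) (hBT : B.Lt T)
    (hCT : C.Lt T) (hne : A ≠ B) : C = A ∨ C = B := by
  by_contra! hc
  obtain ⟨a, ha, hAa⟩ := h.exists_zero_of_isCocircuit hA
  obtain ⟨b, hb, hBb⟩ := h.exists_zero_of_isCocircuit hB
  obtain ⟨c, hcD, hCc⟩ := h.exists_zero_of_isCocircuit hC
  have hBa := h.no_common_zero hA hB hAT hBT hne ha hAa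
  have hCa := h.no_common_zero hA hC hAT hCT hc.1.symm ha hAa
  have hAb := h.no_common_zero hB hA hBT hAT hne.symm hb hBb
  have hCb := h.no_common_zero hB hC hBT hCT hc.2.symm hb hBb
  have hAc := h.no_common_zero hC hA hCT hAT hc.1 hcD hCc
  have hBc := h.no_common_zero hC hB hCT hBT hc.2 hcD hCc
  have sep : B.Sep (-C) a := by
    rw [SV.sep_neg_iff]
    exact ⟨hBa, (hBT.1 a hBa).trans (hCT.1 a hCa).symm⟩
  obtain ⟨U, hU, hUa, hUf⟩ := h.om.elim B hB.1 (-C) (h.om.neg_mem C hC.1) a sep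
  have hUb : U b = -T b := by
    rw [hUf b (fun hs => hs.1 hBb), SV.comp_apply_of_eq_zero _ hBb, Pi.neg_apply, hCT.1 b hCb]
  have hUc : U c = T c := by
    rw [hUf c (fun hs => (SV.sep_neg_iff.1 hs).1 ((SV.sep_neg_iff.1 hs).2.trans hCc)),
      SV.comp_apply_of_ne_zero _ hBc, hBT.1 c hBc]
  have hTc : T c ≠ 0 := (hBT.1 c hBc) ▸ hBc
  have hTb : T b ≠ 0 := (hCT.1 b hCb) ▸ hCb
  have hU0 : U ≠ 0 := by
    rintro rfl
    exact hTc hUc.symm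
  have e1 := hAT.1 b hAb
  have e2 := hAT.1 c hAc
  rcases h.unique a ha A hA.1 U hU hA.2.1 hU0 hAa hUa with rfl | rfl
  · rw [hUb] at e1
    exact SignType.ne_neg_of_ne_zero hTb e1.symm
  · rw [Pi.neg_apply, e2] at hUc
    exact SignType.ne_neg_of_ne_zero hTc hUc.symm

end IsCircle

/-- An infinite walk along edges `T i` and vertices `V i` that never turns back. -/
structure IsWalk (L : Set (SV E)) (T V : ℕ → SV E) : Prop where
  tope : ∀ i, IsTope L (T i)
  cocircuit : ∀ i, IsCocircuit L (V i)
  lt : ∀ i, (V i).Lt (T i)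
  lt_succ : ∀ i, (V i).Lt (T (i + 1))
  tope_ne : ∀ i, T (i + 1) ≠ T i
  vertex_ne : ∀ i, V (i + 1) ≠ V i

theorem IsCircle.exists_walk [Finite E] {L : Set (SV E)} {D : Set E} (h : IsCircle L D)
    {T₀ V₀ : SV E} (hT : IsTope L T₀) (hV : IsCocircuit L V₀) (hlt : V₀.Lt T₀) :
    ∃ T V, IsWalk L T V ∧ T 0 = T₀ ∧ V 0 = V₀ := by
  let P := {p : SV E × SV E // IsTope L p.1 ∧ IsCocircuit L p.2 ∧ p.2.Lt p.1}
  have step : ∀ p : P, ∃ q : P, p.1.2.Lt q.1.1 ∧ q.1.1 ≠ p.1.1 ∧ q.1.2 ≠ p.1.2 := by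
    rintro ⟨⟨T, V⟩, h1, h2, h3⟩
    obtain ⟨g1, g2, g3⟩ := h.isTope_opposite h2 h1
    obtain ⟨B, k1, k2, k3⟩ := h.exists_other_vertex h2 g1 g2
    exact ⟨⟨⟨_, B⟩, g1, k1, k2⟩, g2, g3, k3⟩
  choose f hf using step
  let s : ℕ → P := fun n => f^[n] ⟨⟨T₀, V₀⟩, hT, hV, hlt⟩
  have hs : ∀ n, s (n + 1) = f (s n) := fun n => Function.iterate_succ_apply' _ _ _
  refine ⟨fun n => (s n).1.1, fun n => (s n).1.2, ⟨fun i => (s i).2.1, fun i => (s i).2.2.1,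
    fun i => (s i).2.2.2, fun i => ?_, fun i => ?_, fun i => ?_⟩, rfl, rfl⟩
  · rw [hs]; exact (hf _).1
  · rw [hs]; exact (hf _).2.1
  · rw [hs]; exact (hf _).2.2

theorem IsWalk.tope_succ [Finite E] {L : Set (SV E)} {D : Set E} (h : IsCircle L D)
    {T V : ℕ → SV E} (w : IsWalk L T V) (i : ℕ) : T (i + 1) = (V i).comp (-T i) :=
  h.tope_apply_eq (w.cocircuit i) (w.tope i) (w.tope (i + 1)) (w.lt i) (w.lt_succ i) (w.tope_ne i)

theorem IsWalk.eq [Finite E] {L : Set (SV E)} {D : Set E} (h : IsCircle L D)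
    {T V T' V' : ℕ → SV E} (w : IsWalk L T V) (w' : IsWalk L T' V') (hT : T 0 = T' 0)
    (hV : V 0 = V' 0) (i : ℕ) : T i = T' i ∧ V i = V' i := by
  induction i with
  | zero => exact ⟨hT, hV⟩
  | succ i ih =>
    have h1 : T (i + 1) = T' (i + 1) := by
      rw [w.tope_succ h, w'.tope_succ h, ih.1, ih.2]
    refine ⟨h1, ?_⟩
    have h2 := w'.lt_succ i
    have h3 := w'.lt (i + 1)
    rw [← h1] at h2 h3
    rcases h.eq_or_eq_of_lt (w'.cocircuit i) (w'.cocircuit (i + 1)) (w.cocircuit (i + 1))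
      h2 h3 (w.lt (i + 1)) (w'.vertex_ne i).symm with h4 | h4
    · rw [← ih.2] at h4
      exact absurd h4 (w.vertex_ne i)
    · exact h4

/-- A walk passes half of the circle before it comes to the antipode of its first vertex. -/
theorem IsWalk.half [Finite E] {L : Set (SV E)} {D : Set E} (h : IsCircle L D)
    {T V : ℕ → SV E} (w : IsWalk L T V) {A : SV E} (hA : IsCocircuit L A) (hAT : A.Lt (T 0))
    (hAB : A ≠ V 0) :
    ∃ m, 1 ≤ m ∧ V m = -A ∧ V (m + 1) = -V 0 ∧ T (m + 1) = -T 0 ∧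
      (∀ i ≤ m, ∀ g ∈ D, V i g = 0 → T i g = T 0 g) ∧
      (∀ i j, i < j → j ≤ m → ∀ g ∈ D, V i g = 0 → V j g ≠ 0) ∧
      (∀ g ∈ D, ∃ i ≤ m, V i g = 0) ∧ ∀ i ≤ m, V i ≠ -V 0 := by
  have hTD : ∀ i, ∀ g ∈ D, T i g ≠ 0 := fun i => (h.isTope_iff.1 (w.tope i)).2
  have hTL : ∀ i, T i ∈ L := fun i => (h.isTope_iff.1 (w.tope i)).1
  -- Up to the antipode of the first edge, each new vertex consists of elements not yet crossed:
  -- some vertex of the current edge has this property, and it is not the one just passed.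
  have pos : ∀ i, (∀ j ≤ i, T j ≠ -T 0) → ∀ g ∈ D, V i g = 0 → T i g = T 0 g := by
    intro i
    induction i with
    | zero => intro _ _ _ _; rfl
    | succ i ih =>
      intro hj g hg hVg
      have hp := ih fun j hji => hj j (by omega)
      by_cases hT0 : T (i + 1) = T 0
      · rw [hT0]
      obtain ⟨Z, hZ, hZT, hZ0⟩ := h.exists_vertex_separated (w.tope (i + 1))
        (h.isTope_neg (w.tope 0)) (fun hc => hj (i + 1) le_rfl hc.symm)
        (fun hc => hT0 (neg_injective hc).symm)
      rcases h.eq_or_eq_of_lt (w.cocircuit i) (w.cocircuit (i + 1)) hZ (w.lt_succ i)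
        (w.lt (i + 1)) hZT (w.vertex_ne i).symm with rfl | rfl
      · obtain ⟨a, ha, hVa⟩ := h.exists_zero_of_isCocircuit (w.cocircuit i)
        exfalso
        apply hZ0 a ha hVa
        rw [w.tope_succ h, SV.comp_apply_of_eq_zero _ hVa, Pi.neg_apply, Pi.neg_apply, hp a ha hVa]
      · rcases SignType.eq_or_eq_neg_of_ne_zero (hTD (i + 1) g hg) (hTD 0 g hg) with h1 | h1
        · exact h1
        · exact absurd h1.symm (hZ0 g hg hVg)
  -- The elements whose sign has changed are exactly the zeros of the vertices passed so far.
  have crossed : ∀ i, (∀ j < i, T j ≠ -T 0) → ∀ g ∈ D, (T i g ≠ T 0 g ↔ ∃ j < i, V j g = 0) := by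
    intro i
    induction i with
    | zero => simp
    | succ i ih =>
      intro hj g hg
      have hp := pos i fun j hji => hj j (by omega)
      have hi := ih (fun j hji => hj j (by omega)) g hg
      rw [w.tope_succ h]
      by_cases hVg : V i g = 0
      · rw [SV.comp_apply_of_eq_zero _ hVg, Pi.neg_apply, hp g hg hVg]
        exact ⟨fun _ => ⟨i, by omega, hVg⟩,
          fun _ => (SignType.ne_neg_of_ne_zero (hTD 0 g hg)).symm⟩
      · rw [SV.comp_apply_of_ne_zero _ hVg, (w.lt i).1 g hVg, hi]
        constructor
        · rintro ⟨j, hj1, hj2⟩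
          exact ⟨j, by omega, hj2⟩
        · rintro ⟨j, hj1, hj2⟩
          refine ⟨j, ?_, hj2⟩
          have : j ≠ i := by rintro rfl; exact hVg hj2
          omega
  -- Otherwise the set of crossed elements would grow forever.
  have ex : ∃ K, T K = -T 0 := by
    by_contra! hc
    have grow : ∀ i, i ≤ {g ∈ D | T i g ≠ T 0 g}.ncard := by
      intro i
      induction i with
      | zero => omega
      | succ i ih =>
        refine lt_of_le_of_lt ih (Set.ncard_lt_ncard ⟨?_, ?_⟩ (Set.toFinite _))
        · rintro g ⟨hg, hg'⟩
          refine ⟨hg, (crossed (i + 1) (fun j _ => hc j) g hg).2 ?_⟩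
          obtain ⟨j, hj, hj'⟩ := (crossed i (fun j _ => hc j) g hg).1 hg'
          exact ⟨j, by omega, hj'⟩
        · intro hsub
          obtain ⟨a, ha, hVa⟩ := h.exists_zero_of_isCocircuit (w.cocircuit i)
          have := hsub ⟨ha, (crossed (i + 1) (fun j _ => hc j) a ha).2 ⟨i, by omega, hVa⟩⟩
          exact this.2 (pos i (fun j _ => hc j) a ha hVa)
    have h1 := grow (D.ncard + 1)
    have h2 : {g ∈ D | T (D.ncard + 1) g ≠ T 0 g}.ncard ≤ D.ncard :=
      Set.ncard_le_ncard (fun g hg => hg.1) (Set.toFinite _)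
    omega
  classical
  obtain ⟨K, hK, hmin⟩ : ∃ K, T K = -T 0 ∧ ∀ j < K, T j ≠ -T 0 :=
    ⟨Nat.find ex, Nat.find_spec ex, fun j hj => Nat.find_min ex hj⟩
  obtain ⟨a₀, ha₀⟩ := h.nonempty
  obtain ⟨m, rfl⟩ : ∃ m, K = m + 1 := by
    refine ⟨K - 1, ?_⟩
    rcases Nat.eq_zero_or_pos K with rfl | h0
    · exact absurd (congrFun hK a₀) (SignType.ne_neg_of_ne_zero (hTD 0 a₀ ha₀))
    · omega
  have hpos : ∀ i ≤ m, ∀ g ∈ D, V i g = 0 → T i g = T 0 g := fun i hi =>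
    pos i fun j hj => hmin j (by omega)
  have hdis : ∀ i j, i < j → j ≤ m → ∀ g ∈ D, V i g = 0 → V j g ≠ 0 := by
    intro i j hij hj g hg hVi hVj
    exact (crossed j (fun l hl => hmin l (by omega)) g hg).2 ⟨i, hij, hVi⟩ (hpos j hj g hg hVj)
  have hcov : ∀ g ∈ D, ∃ i ≤ m, V i g = 0 := by
    intro g hg
    obtain ⟨j, hj, hj'⟩ := (crossed (m + 1) hmin g hg).1 (by
      rw [hK]; exact (SignType.ne_neg_of_ne_zero (hTD 0 g hg)).symm)
    exact ⟨j, by omega, hj'⟩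
  have hne : ∀ i ≤ m, V i ≠ -V 0 := by
    intro i hi hc
    rcases Nat.eq_zero_or_pos i with rfl | h0
    · obtain ⟨e, he⟩ := Function.ne_iff.1 (w.cocircuit 0).2.1
      exact SignType.ne_neg_of_ne_zero he (congrFun hc e)
    · obtain ⟨a, ha, hVa⟩ := h.exists_zero_of_isCocircuit (w.cocircuit 0)
      exact hdis 0 i h0 hi a ha hVa (by rw [hc, Pi.neg_apply, hVa]; rfl)
  have lt1 := w.lt_succ m
  have lt2 := w.lt (m + 1)
  rw [hK] at lt1 lt2
  have hAB' : -A ≠ -V 0 := fun hc => hAB (neg_injective hc)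
  -- The edge `-T 0` has the vertices `-A` and `-V 0`. It cannot be entered through `-V 0`, whose
  -- zeros were crossed at the start.
  have hVm : V m = -A := (h.eq_or_eq_of_lt (h.isCocircuit_neg hA)
    (h.isCocircuit_neg (w.cocircuit 0)) (w.cocircuit m) hAT.neg (w.lt 0).neg lt1
    hAB').resolve_right (hne m le_rfl)
  have hVm1 : V (m + 1) = -V 0 := by
    refine (h.eq_or_eq_of_lt (h.isCocircuit_neg hA)
      (h.isCocircuit_neg (w.cocircuit 0)) (w.cocircuit (m + 1)) hAT.neg (w.lt 0).neg lt2
      hAB').resolve_left ?_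
    rw [← hVm]
    exact w.vertex_ne m
  refine ⟨m, ?_, hVm, hVm1, hK, hpos, hdis, hcov, hne⟩
  rcases Nat.eq_zero_or_pos m with rfl | h0
  · exact absurd hVm (IsCircle.ne_neg_of_lt hA.2.1 hAT (w.lt 0))
  · exact h0

/-- The walk `w` ends by entering the edge `-T 0` through `-V' 0`, and the antipodal map carries
this end to the start of `w'`. Hence `w'` is the antipodal image of `w` run backwards. -/
theorem IsWalk.reverse [Finite E] {L : Set (SV E)} {D : Set E} (h : IsCircle L D)
    {T V T' V' : ℕ → SV E} (w : IsWalk L T V) (w' : IsWalk L T' V') (hT : T' 0 = T 0) {m : ℕ}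
    (hVm : V m = -V' 0) (hTm : T (m + 1) = -T 0) (i : ℕ) (hi : i ≤ m) :
    V' i = -V (m - i) ∧ T' (i + 1) = -T (m - i) := by
  have key : ∀ j, V' j = -V (m - j) → T' j = -T (m - j + 1) → T' (j + 1) = -T (m - j) := by
    intro j h1 h2
    refine (h.tope_apply_eq (w'.cocircuit j) (w'.tope j) (h.isTope_neg (w.tope (m - j)))
      (w'.lt j) ?_ ?_ ).symm ▸ w'.tope_succ h j
    · rw [h1]; exact (w.lt (m - j)).neg
    · rw [h2]
      intro hc
      exact w.tope_ne (m - j) (neg_injective hc).symm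
  induction i with
  | zero =>
    have h1 : V' 0 = -V (m - 0) := by rw [Nat.sub_zero, hVm, neg_neg]
    exact ⟨h1, key 0 h1 (by rw [hT, Nat.sub_zero, hTm, neg_neg])⟩
  | succ i ih =>
    obtain ⟨h1, h2⟩ := ih (by omega)
    have e : m - i = m - (i + 1) + 1 := by omega
    have h3 : V' (i + 1) = -V (m - (i + 1)) := by
      have l1 := w'.lt_succ i
      have l2 := w'.lt (i + 1)
      rw [h2] at l1 l2
      have l3 := w.lt_succ (m - (i + 1))
      rw [← e] at l3
      rcases h.eq_or_eq_of_lt (w'.cocircuit i) (w'.cocircuit (i + 1))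
        (h.isCocircuit_neg (w.cocircuit (m - (i + 1)))) l1 l2 l3.neg
        (w'.vertex_ne i).symm with h4 | h4
      · rw [h1, e] at h4
        exact absurd (neg_injective h4).symm (w.vertex_ne _)
      · exact h4.symm
    refine ⟨h3, key (i + 1) h3 ?_⟩
    rw [h2, e]

theorem IsHalfWalk.eq_map [Finite E] {L : Set (SV E)} {D : Set E} (h : IsCircle L D)
    {T V : ℕ → SV E} (w : IsWalk L T V) {m : ℕ} (hm : V (m + 1) = -V 0)
    (hne : ∀ i ≤ m, V i ≠ -V 0) {Ys : List (SV E)} (hY : IsHalfWalk L (T 0) Ys)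
    (hd : Ys.head? = some (V 0)) : Ys = (List.range (m + 1)).map V := by
  obtain ⟨T', V', h0, h1, h2, h3, h4, h5, h6, h7, h8⟩ := hY
  have w' : IsWalk L T' V' := ⟨h1, h2, fun i => (h3 i).1, fun i => (h3 i).2, h4, h5⟩
  have hV0 : V' 0 = V 0 := by
    cases Ys with
    | nil => simp at hd
    | cons a l =>
      have := h8 0 (by simp)
      simp only [List.getElem_cons_zero] at this
      simp only [List.head?_cons, Option.some.injEq] at hd
      rw [← this, hd]
  have heq := fun i => (w'.eq h w h0 hV0 i).2
  have hlen : Ys.length = m + 1 := by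
    rcases lt_trichotomy Ys.length (m + 1) with hl | hl | hl
    · rw [heq, heq] at h6
      exact absurd h6 (hne _ (by omega))
    · exact hl
    · have := h7 (m + 1) hl
      rw [heq, heq] at this
      exact absurd hm this
  apply List.ext_getElem
  · simp [hlen]
  · intro i hi hi'
    rw [h8 i hi, heq]
    simp

theorem IsWalk.isHalfWalk {L : Set (SV E)} {T V : ℕ → SV E} (w : IsWalk L T V) {m : ℕ}
    (hm : V (m + 1) = -V 0) (hne : ∀ i ≤ m, V i ≠ -V 0) :
    IsHalfWalk L (T 0) ((List.range (m + 1)).map V) := by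
  refine ⟨T, V, rfl, w.tope, w.cocircuit, fun i => ⟨w.lt i, w.lt_succ i⟩, w.tope_ne, w.vertex_ne,
    by simpa using hm, fun i hi => hne i (by simp at hi; omega), fun i hi => by simp⟩

/-- The vertices met by the half-walks from an edge `T₀` with vertices `A` and `B`. -/
structure IsHalfCircle (L : Set (SV E)) (D : Set E) (T₀ A B : SV E) (T V : ℕ → SV E) (m : ℕ) :
    Prop where
  walk : IsWalk L T V
  tope_zero : T 0 = T₀
  zero : V 0 = B
  one_le : 1 ≤ m
  last : V m = -A
  pos : ∀ i ≤ m, ∀ g ∈ D, V i g = 0 → T i g = T₀ g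
  disjoint : ∀ i j, i < j → j ≤ m → ∀ g ∈ D, V i g = 0 → V j g ≠ 0
  cover : ∀ g ∈ D, ∃ i ≤ m, V i g = 0
  halfWalk : IsHalfWalk L T₀ ((List.range (m + 1)).map V)
  eq_of_head : ∀ Ys, IsHalfWalk L T₀ Ys → Ys.head? = some B → Ys = (List.range (m + 1)).map V
  eq_of_head_reverse : ∀ Ys, IsHalfWalk L T₀ Ys → Ys.head? = some A →
    Ys = (List.range (m + 1)).map fun i => -V (m - i)

theorem IsCircle.exists_halfCircle [Finite E] {L : Set (SV E)} {D : Set E} (h : IsCircle L D)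
    {T₀ A B : SV E} (hT : IsTope L T₀) (hA : IsCocircuit L A) (hB : IsCocircuit L B)
    (hAT : A.Lt T₀) (hBT : B.Lt T₀) (hAB : A ≠ B) : ∃ T V m, IsHalfCircle L D T₀ A B T V m := by
  obtain ⟨T, V, w, rfl, rfl⟩ := h.exists_walk hT hB hBT
  obtain ⟨T', V', w', hT', rfl⟩ := h.exists_walk hT hA hAT
  obtain ⟨m, hm1, hVm, hVm1, hTm, hpos, hdis, hcov, hne⟩ := w.half h hA hAT hAB
  obtain ⟨m', -, hVm', hVm1', hTm', -, hdis', -, hne'⟩ := w'.half h hB (by rwa [hT']) hAB.symm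
  have rev := w.reverse h w' hT' hVm hTm
  -- Each half-walk meets a zero of `B` only once. If the lengths differed, reversal would produce a
  -- second occurrence of `B` or `-B`.
  have hmm : m' = m := by
    obtain ⟨b, hb, hBb⟩ := h.exists_zero_of_isCocircuit hB
    rcases lt_trichotomy m m' with hl | hl | hl
    · have h1 := (rev m le_rfl).1
      rw [Nat.sub_self] at h1
      exact absurd (by rw [hVm', Pi.neg_apply, hBb]; rfl) (hdis' m m' hl le_rfl b hb (by
        rw [h1, Pi.neg_apply, hBb]; rfl))
    · exact hl.symm
    · have h1 := (rev m' hl.le).1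
      rw [hVm'] at h1
      exact absurd (by rw [← neg_injective h1, hBb]) (hdis 0 (m - m') (by omega) (by omega) b hb hBb)
  subst hmm
  have hmap : (List.range (m' + 1)).map V' = (List.range (m' + 1)).map fun i => -V (m' - i) := by
    apply List.map_congr_left
    intro i hi
    exact (rev i (by simp at hi; omega)).1
  refine ⟨T, V, m', w, rfl, rfl, hm1, hVm, hpos, hdis, hcov, w.isHalfWalk hVm1 hne,
    fun Ys hY hd => IsHalfWalk.eq_map h w hVm1 hne hY hd, fun Ys hY hd => ?_⟩
  rw [← hmap]
  rw [← hT'] at hY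
  exact IsHalfWalk.eq_map h w' hVm1' hne' hY hd

end Circle

/-! ### Independent families and chirotopes. -/

section Chirotopes

variable {E : Type*}

theorem Fin.snoc_comp_swap_castSucc {k : ℕ} (x : Fin k → E) (f : E) (i j : Fin k) :
    (Fin.snoc x f : Fin (k + 1) → E) ∘ Equiv.swap i.castSucc j.castSucc =
      Fin.snoc (x ∘ Equiv.swap i j) f := by
  funext a
  refine Fin.lastCases ?_ (fun a => ?_) a
  · rw [Function.comp_apply, Equiv.swap_apply_of_ne_of_ne (Fin.castSucc_lt_last _).ne'
      (Fin.castSucc_lt_last _).ne']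
    simp
  · rw [Function.comp_apply, ← Function.Injective.map_swap (Fin.castSucc_injective k)]
    simp

theorem Fin.snoc_snoc_comp_swap {k : ℕ} (x : Fin k → E) (e f : E) :
    (Fin.snoc (Fin.snoc x f : Fin (k + 1) → E) e : Fin (k + 2) → E) ∘
      Equiv.swap (Fin.last k).castSucc (Fin.last (k + 1)) =
      Fin.snoc (Fin.snoc x e : Fin (k + 1) → E) f := by
  funext a
  refine Fin.lastCases ?_ (fun a => Fin.lastCases ?_ (fun a => ?_) a) a
  · simp
  · simp
  · rw [Function.comp_apply, Equiv.swap_apply_of_ne_of_ne]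
    · simp
    · exact fun hc => (Fin.castSucc_lt_last a).ne (Fin.castSucc_injective _ hc)
    · exact (Fin.castSucc_lt_last _).ne

/-- A family of elements is independent if it has a dual family of covectors. -/
def CovIndep (L : Set (SV E)) {m : ℕ} (l : Fin m → E) : Prop :=
  ∀ i, ∃ U ∈ L, U (l i) ≠ 0 ∧ ∀ j, j ≠ i → U (l j) = 0

theorem CovIndep.comp {L : Set (SV E)} {m m' : ℕ} {l : Fin m → E} (h : CovIndep L l)
    {f : Fin m' → Fin m} (hf : Function.Injective f) : CovIndep L (l ∘ f) := fun i => by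
  obtain ⟨U, hU, h1, h2⟩ := h (f i)
  exact ⟨U, hU, h1, fun j hj => h2 _ (fun hc => hj (hf hc))⟩

/-- A dual covector that is nonzero at `g` is corrected by eliminating `g` against `W` or `-W`; this
changes nothing on the old family, where `W` vanishes. -/
theorem CovIndep.snoc {L : Set (SV E)} (hL : IsOrientedMatroid L) {m : ℕ} {l : Fin m → E}
    (h : CovIndep L l) {W : SV E} (hW : W ∈ L) (h0 : ∀ i, W (l i) = 0) {g : E} (hg : W g ≠ 0) :
    CovIndep L (Fin.snoc l g : Fin (m + 1) → E) := by
  intro i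
  refine Fin.lastCases ?_ (fun i => ?_) i
  · refine ⟨W, hW, by simpa using hg, fun j hj => ?_⟩
    obtain ⟨j, rfl⟩ := Fin.exists_castSucc_eq.2 hj
    simpa using h0 j
  · obtain ⟨U, hU, h1, h2⟩ := h i
    have key : ∀ W ∈ L, (∀ i, W (l i) = 0) → U.Sep W g →
        ∃ Z ∈ L, Z ((Fin.snoc l g : Fin (m + 1) → E) i.castSucc) ≠ 0 ∧
          ∀ j, j ≠ i.castSucc → Z ((Fin.snoc l g : Fin (m + 1) → E) j) = 0 := by
      intro W hW h0 hs
      obtain ⟨Z, hZ, hZg, hZf⟩ := hL.elim U hU W hW g hs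
      have hZl : ∀ j, Z (l j) = U (l j) := by
        intro j
        rw [hZf]
        · by_cases hUj : U (l j) = 0
          · rw [SV.comp_apply_of_eq_zero _ hUj, h0, hUj]
          · rw [SV.comp_apply_of_ne_zero _ hUj]
        · rintro ⟨h3, h4⟩
          rw [h0] at h4
          exact h3 (by simpa using h4)
      refine ⟨Z, hZ, by simpa [hZl] using h1, fun j hj => ?_⟩
      revert hj
      refine Fin.lastCases ?_ (fun j => ?_) j
      · intro _; simpa using hZg
      · intro hj
        simpa [hZl] using h2 j (fun hc => hj (by rw [hc]))
    by_cases hUg : U g = 0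
    · refine ⟨U, hU, by simpa using h1, fun j hj => ?_⟩
      revert hj
      refine Fin.lastCases ?_ (fun j => ?_) j
      · intro _; simpa using hUg
      · intro hj
        simpa using h2 j (fun hc => hj (by rw [hc]))
    · rcases SignType.eq_or_eq_neg_of_ne_zero hUg hg with h3 | h3
      · exact key (-W) (hL.neg_mem W hW) (fun i => by simp [h0]) ⟨hUg, by simp [h3]⟩
      · exact key W hW h0 ⟨hUg, h3⟩

/-- If a smaller covector `U` misses `e`, conformal elimination of `W` with `-U` keeps the sign at
`e` and creates a new zero. So the support can be shrunk around `e` until it is minimal. -/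
theorem IsOrientedMatroid.exists_isCocircuit_le [Finite E] {L : Set (SV E)}
    (hL : IsOrientedMatroid L) {W : SV E} (hW : W ∈ L) {e : E} (he : W e ≠ 0) :
    ∃ V, IsCocircuit L V ∧ V.Le W ∧ V e ≠ 0 := by
  induction hN : {f | W f ≠ 0}.ncard using Nat.strong_induction_on generalizing W with
  | _ N ih =>
  subst hN
  have reduce : ∀ Z ∈ L, Z.Le W → Z e ≠ 0 → (∃ f, W f ≠ 0 ∧ Z f = 0) →
      ∃ V, IsCocircuit L V ∧ V.Le W ∧ V e ≠ 0 := by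
    rintro Z hZ hle hZe ⟨f, hf1, hf2⟩
    obtain ⟨V, hV, hVZ, hVe⟩ := ih _ (Set.ncard_lt_ncard
      ⟨fun a (ha : Z a ≠ 0) => fun hWa => ha (hle.eq_zero hWa), fun hc => hc hf1 hf2⟩ (Set.toFinite _)) hZ hZe rfl
    exact ⟨V, hV, hVZ.trans hle, hVe⟩
  by_cases hc : IsCocircuit L W
  · exact ⟨W, hc, SV.Le.refl W, he⟩
  · have hW0 : W ≠ 0 := by rintro rfl; exact he rfl
    simp only [IsCocircuit, not_and, not_forall] at hc
    obtain ⟨U, hU, hU0, hUW, hne⟩ := hc hW hW0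
    by_cases hUe : U e = 0
    · obtain ⟨a, ha⟩ := Function.ne_iff.1 hU0
      have hs : W.Sep (-U) a := SV.sep_neg_iff.2 ⟨hUW a ha ▸ ha, (hUW a ha).symm⟩
      obtain ⟨Z, hZ, ⟨f, hf, hZf⟩, h1, h2⟩ := hL.exists_conformal hW (-U) (hL.neg_mem U hU) ⟨a, hs⟩
      refine reduce Z hZ ?_ ?_ ⟨f, hf.1, hZf⟩
      · intro b hb
        by_cases hsb : W.Sep (-U) b
        · exact (h2 b hsb).resolve_left hb
        · rw [h1 b hsb] at hb ⊢
          by_cases hWb : W b = 0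
          · exact absurd (SV.comp_apply_eq_zero.2 ⟨hWb, by simp [hUW.eq_zero hWb]⟩) hb
          · exact SV.comp_apply_of_ne_zero _ hWb
      · rw [h1 e (fun hs => (SV.sep_neg_iff.1 hs).1 ((SV.sep_neg_iff.1 hs).2.trans hUe)),
          SV.comp_apply_of_ne_zero _ he]
        exact he
    · refine reduce U hU hUW hUe ?_
      by_contra! hcon
      apply hne
      refine hUW.antisymm fun b hb => ?_
      exact (hUW b (hcon b hb)).symm

/-- Basis exchange turns a tuple of nonzero sign into `t`, one entry at a time. For the entry `k`
take a cocircuit below the dual covector: it is nonzero at `t k` and vanishes at the entries already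
replaced, so the exchange axiom has to remove a later one. -/
theorem IsChirotopeOf.ne_zero_of_indep [Finite E] {d : ℕ} (hd : 1 ≤ d) {L : Set (SV E)}
    (hL : IsOrientedMatroid L) {χ : (Fin (d + 1) → E) → SignType} (hχ : IsChirotopeOf χ L)
    {t : Fin (d + 1) → E} (ht : CovIndep L t) : χ t ≠ 0 := by
  have claim : ∀ k ≤ d + 1, ∃ y, χ y ≠ 0 ∧ ∀ i : Fin (d + 1), (i : ℕ) < k → y i = t i := by
    intro k
    induction k with
    | zero =>
      intro _
      obtain ⟨y, hy⟩ := hχ.ne_zero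
      exact ⟨y, hy, by simp⟩
    | succ k ih =>
      intro hk
      obtain ⟨y, hy, hyt⟩ := ih (by omega)
      obtain ⟨U, hU, hU1, hU2⟩ := ht ⟨k, by omega⟩
      set j : Fin (d + 1) := ⟨k, by omega⟩ with hj
      obtain ⟨V, hV, hVU, hVj⟩ := hL.exists_isCocircuit_le hU hU1
      obtain ⟨-, l, hl⟩ := (hχ.cocircuits V).1 hV
      have hl' : ∀ e, V e ≠ 0 ↔ χ (Fin.snoc l e) ≠ 0 := by
        intro e
        rcases hl with h | h
        · rw [h]
        · rw [h, Pi.neg_apply, SignType.neg_ne_zero_iff]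
      -- The exchange axiom acts on the entry `0`, while cocircuits are read off from the last
      -- entry. The two are swapped, which is a proper transposition because `1 ≤ d`.
      have h0l : (0 : Fin (d + 1)) ≠ Fin.last d := by
        intro hc
        have := congrArg Fin.val hc
        simp at this
        omega
      have hupd : ∀ e, Function.update ((Fin.snoc l (t j) : Fin (d + 1) → E) ∘
          Equiv.swap 0 (Fin.last d)) 0 e =
          (Fin.snoc l e : Fin (d + 1) → E) ∘ Equiv.swap 0 (Fin.last d) := by
        intro e
        funext a
        by_cases ha : a = 0
        · subst ha; simp
        · rw [Function.update_of_ne ha]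
          simp only [Function.comp_apply]
          have : Equiv.swap 0 (Fin.last d) a ≠ Fin.last d := fun hc =>
            ha ((Equiv.swap 0 (Fin.last d)).injective
              (hc.trans (Equiv.swap_apply_left 0 (Fin.last d)).symm))
          obtain ⟨b, hb⟩ := Fin.exists_castSucc_eq.2 this
          rw [← hb]
          simp
      have hx : χ ((Fin.snoc l (t j) : Fin (d + 1) → E) ∘ Equiv.swap 0 (Fin.last d)) ≠ 0 := by
        rw [hχ.alternating _ _ _ h0l, SignType.neg_ne_zero_iff, ← hl']
        exact hVj
      obtain ⟨i, hi⟩ := hχ.exchange _ _ (mul_ne_zero hx hy)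
      have hi' := mul_ne_zero hx hy
      rw [← hi, hupd, hχ.alternating _ _ _ h0l] at hi'
      have hVi : V (y i) ≠ 0 := by
        rw [hl']
        exact SignType.neg_ne_zero_iff.1 (left_ne_zero_of_mul hi')
      have hyi := right_ne_zero_of_mul hi'
      simp only [Function.comp_apply, Equiv.swap_apply_left, Fin.snoc_last] at hyi
      have hik : k ≤ i := by
        by_contra hc
        rw [hyt i (by omega)] at hVi
        exact hVi (hVU.eq_zero (hU2 i (fun h => hc (by rw [h]))))
      by_cases hij : i = j
      · subst hij
        refine ⟨_, hyi, fun a ha => ?_⟩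
        by_cases haj : a = j
        · rw [haj, Function.update_self]
        · rw [Function.update_of_ne haj]
          refine hyt a ?_
          have : (a : ℕ) ≠ k := fun h => haj (Fin.ext h)
          omega
      · refine ⟨Function.update y i (t j) ∘ Equiv.swap i j, ?_, fun a ha => ?_⟩
        · rw [hχ.alternating _ _ _ hij, SignType.neg_ne_zero_iff]
          exact hyi
        · by_cases haj : a = j
          · subst haj; simp
          · have hak : (a : ℕ) ≠ k := fun h => haj (Fin.ext h)
            have hai : a ≠ i := by
              rintro rfl
              omega
            rw [Function.comp_apply, Equiv.swap_apply_of_ne_of_ne hai haj,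
              Function.update_of_ne hai]
            exact hyt a (by omega)
  obtain ⟨y, hy, hyt⟩ := claim (d + 1) le_rfl
  rwa [show y = t from funext fun i => hyt i i.2] at hy

/-- If `U` and `V` had opposite signs somewhere, elimination conformal to `U` would give a covector
properly below `U`, nonzero at `f` because the two agree there. -/
theorem IsOrientedMatroid.eq_of_support_subset [Finite E] {L : Set (SV E)}
    (hL : IsOrientedMatroid L) {U V : SV E} (hU : IsCocircuit L U) (hV : V ∈ L)
    (hsub : ∀ e, U e = 0 → V e = 0) {f : E} (hf : V f ≠ 0) (hfU : V f = U f) : V = U := by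
  have hV0 : V ≠ 0 := by rintro rfl; exact hf rfl
  refine hU.2.2 V hV hV0 ?_
  have hs : ∀ e, ¬ U.Sep V e := by
    by_contra! hc
    obtain ⟨Z, hZ, ⟨a, ha, hZa⟩, h1, h2⟩ := hL.exists_conformal hU.1 V hV hc
    have hZf : Z f = U f := by
      rw [h1 f, SV.comp_apply_of_ne_zero _ (hfU ▸ hf)]
      rintro ⟨h3, h4⟩
      rw [hfU] at h4
      exact SignType.ne_neg_of_ne_zero h3 h4
    have hZ0 : Z ≠ 0 := by
      rintro rfl
      exact hf (hfU.trans hZf.symm)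
    have : Z = U := hU.2.2 Z hZ hZ0 fun b hb => by
      by_cases hsb : U.Sep V b
      · exact (h2 b hsb).resolve_left hb
      · rw [h1 b hsb] at hb ⊢
        by_cases hUb : U b = 0
        · exact absurd (SV.comp_apply_eq_zero.2 ⟨hUb, hsub b hUb⟩) hb
        · exact SV.comp_apply_of_ne_zero _ hUb
    rw [this] at hZa
    exact ha.1 hZa
  intro e he
  have hUe : U e ≠ 0 := fun h => he (hsub e h)
  exact ((SV.not_sep_iff hUe he).1 (hs e)).symm

/-- An alternating map whose vectors at independent families in `S` are, on `S`, the covectors that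
vanish on the family. -/
structure IsLocalChirotope (L : Set (SV E)) (k : ℕ) (S : Set E)
    (χ : (Fin (k + 1) → E) → SignType) : Prop where
  alternating : ∀ (x : Fin (k + 1) → E) (i j : Fin (k + 1)), i ≠ j →
    χ (x ∘ Equiv.swap i j) = -χ x
  vector : ∀ l : Fin k → E, CovIndep L l → (∀ i, l i ∈ S) → ∀ V ∈ L, (∀ i, V (l i) = 0) →
    (∃ e ∈ S, V e ≠ 0) → ∃ s : SignType, s ≠ 0 ∧ ∀ e ∈ S, χ (Fin.snoc l e) = s * V e

theorem IsChirotopeOf.isLocalChirotope [Finite E] {d : ℕ} (hd : 1 ≤ d) {L : Set (SV E)}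
    (hL : IsOrientedMatroid L) {χ : (Fin (d + 1) → E) → SignType} (hχ : IsChirotopeOf χ L) :
    IsLocalChirotope L d Set.univ χ := by
  refine ⟨hχ.alternating, ?_⟩
  rintro l hl - V hV hVl ⟨f, -, hf⟩
  have hne : ∀ g, V g ≠ 0 → χ (Fin.snoc l g) ≠ 0 := fun g hg =>
    hχ.ne_zero_of_indep hd hL (hl.snoc hL hV hVl hg)
  set U : SV E := fun e => χ (Fin.snoc l e) with hUdef
  have hU : IsCocircuit L U := by
    rw [hχ.cocircuits]
    refine ⟨fun hc => hne f hf (congrFun hc f), l, .inl rfl⟩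
  have hsub : ∀ e, U e = 0 → V e = 0 := by
    intro e he
    by_contra hc
    exact hne e hc he
  rcases SignType.eq_or_eq_neg_of_ne_zero hf (hne f hf) with h | h
  · have := hL.eq_of_support_subset hU hV hsub hf h
    refine ⟨1, one_ne_zero, fun e _ => ?_⟩
    rw [this, one_mul]
  · have := hL.eq_of_support_subset hU (hL.neg_mem V hV)
      (fun e he => by rw [Pi.neg_apply, hsub e he]; rfl) (f := f) (by simpa using hf)
      (by rw [Pi.neg_apply, h, neg_neg])
    refine ⟨-1, by decide, fun e _ => ?_⟩
    have h2 := congrFun this e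
    rw [Pi.neg_apply] at h2
    rw [show χ (Fin.snoc l e) = U e from rfl, ← h2]
    generalize V e = s
    revert s; decide

/-- The induced chirotope of a deletion to the zero set of a covector. -/
theorem IsLocalChirotope.induced {L : Set (SV E)} (hL : IsOrientedMatroid L) {k : ℕ} {S : Set E}
    {χ : (Fin (k + 2) → E) → SignType} (hχ : IsLocalChirotope L (k + 1) S χ) {V : SV E}
    (hV : V ∈ L) {f : E} (hf : f ∈ S) (hVf : V f ≠ 0) :
    IsLocalChirotope L k {e | e ∈ S ∧ V e = 0} fun x => χ (Fin.snoc x f) * V f := by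
  constructor
  · intro x i j hij
    rw [← Fin.snoc_comp_swap_castSucc, hχ.alternating _ _ _
      (fun hc => hij (Fin.castSucc_injective _ hc))]
    generalize χ _ = s, V f = t
    revert s t; decide
  · rintro l hl hlS V' hV' hl0 ⟨e₀, he₀, hVe₀⟩
    -- The covectors `V ∘ V'` and `(-V) ∘ V'` agree on the zeros of `V` and are opposite at `f`.
    -- Eliminating `f` gives `U` that vanishes at `f` and equals `V'` on the zeros of `V`.
    obtain ⟨U, hU, hUf, hUg⟩ := hL.elim _ (hL.comp_mem V hV V' hV') _
      (hL.comp_mem _ (hL.neg_mem V hV) V' hV') f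
      ⟨fun hc => hVf (SV.comp_apply_eq_zero.1 hc).1, by
        rw [SV.comp_apply_of_ne_zero _ hVf, SV.comp_apply_of_ne_zero _ (by simpa using hVf),
          Pi.neg_apply, neg_neg]⟩
    have hUV : ∀ e, V e = 0 → U e = V' e := by
      intro e he
      have h1 : V.comp V' e = V' e := SV.comp_apply_of_eq_zero _ he
      have h2 : (-V).comp V' e = V' e := SV.comp_apply_of_eq_zero _ (by simp [he])
      rw [hUg e]
      · by_cases h3 : V' e = 0
        · rw [SV.comp_apply_of_eq_zero _ (by rw [h1, h3]), h2]
        · rw [SV.comp_apply_of_ne_zero _ (by rwa [h1]), h1]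
      · rintro ⟨h3, h4⟩
        rw [h1] at h3
        rw [h1, h2] at h4
        exact SignType.ne_neg_of_ne_zero h3 h4
    obtain ⟨s, hs, hsU⟩ := hχ.vector (Fin.snoc l f) (hl.snoc hL hV (fun i => (hlS i).2) hVf)
      (fun i => by
        refine Fin.lastCases ?_ (fun i => ?_) i
        · simpa using hf
        · simpa using (hlS i).1) U hU (fun i => by
        refine Fin.lastCases ?_ (fun i => ?_) i
        · simpa using hUf
        · simpa [hUV _ (hlS i).2] using hl0 i) ⟨e₀, he₀.1, by rwa [hUV _ he₀.2]⟩
    -- The minus sign comes from exchanging the last two entries.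
    refine ⟨-s * V f, mul_ne_zero (SignType.neg_ne_zero_iff.2 hs) hVf, fun e he => ?_⟩
    have h1 := hsU e he.1
    rw [hUV e he.2] at h1
    rw [← Fin.snoc_snoc_comp_swap, hχ.alternating _ _ _ (Fin.castSucc_lt_last _).ne, h1]
    generalize V' e = a, V f = b
    clear h1 hsU
    revert s a b; decide

theorem IsLocalChirotope.ne_zero {L : Set (SV E)} {k : ℕ} {S : Set E}
    {χ : (Fin (k + 1) → E) → SignType} (hχ : IsLocalChirotope L k S χ) {t : Fin (k + 1) → E}
    (ht : CovIndep L t) (htS : ∀ i, t i ∈ S) : χ t ≠ 0 := by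
  obtain ⟨U, hU, h1, h2⟩ := ht (Fin.last k)
  obtain ⟨s, hs, h⟩ := hχ.vector (Fin.init t) (ht.comp (Fin.castSucc_injective k))
    (fun i => htS _) U hU (fun i => h2 _ (Fin.castSucc_lt_last i).ne) ⟨_, htS _, h1⟩
  have := h _ (htS (Fin.last k))
  rw [Fin.snoc_init_self] at this
  rw [this]
  exact mul_ne_zero hs h1

/-- The sign of a chirotope is the same for all transversals of a family of sets on which the
covectors dual to transversals are constant. -/
theorem IsLocalChirotope.eq_of_transversal {L : Set (SV E)} {k : ℕ} {S : Set E}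
    {χ : (Fin (k + 1) → E) → SignType} (hχ : IsLocalChirotope L k S χ) (D : Fin (k + 1) → Set E)
    (hDS : ∀ i, D i ⊆ S) (hind : ∀ t : Fin (k + 1) → E, (∀ i, t i ∈ D i) → CovIndep L t)
    (hconst : ∀ t : Fin (k + 1) → E, (∀ i, t i ∈ D i) → ∀ i, ∀ U ∈ L, (∀ j, j ≠ i → U (t j) = 0) →
      ∀ e ∈ D i, ∀ f ∈ D i, U e = U f)
    {t t' : Fin (k + 1) → E} (ht : ∀ i, t i ∈ D i) (ht' : ∀ i, t' i ∈ D i) : χ t = χ t' := by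
  -- As a function of its `i`-th entry the sign is, up to a nonzero factor, a covector dual to the
  -- other entries, hence constant on `D i`.
  have step : ∀ t : Fin (k + 1) → E, (∀ i, t i ∈ D i) → ∀ i, ∀ e ∈ D i,
      χ (Function.update t i e) = χ t := by
    intro t ht i e he
    have hti := hind t ht
    obtain ⟨U, hU, h1, h2⟩ := hti i
    set σ := Equiv.swap i (Fin.last k) with hσ
    have hsw : ∀ y, χ (y ∘ σ) = if i = Fin.last k then χ y else -χ y := by
      intro y
      split_ifs with h
      · rw [hσ, h, Equiv.swap_self]; rfl
      · exact hχ.alternating y _ _ h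
    have hσne : ∀ j : Fin k, σ j.castSucc ≠ i := by
      intro j hc
      have : σ j.castSucc = σ (Fin.last k) := by rw [hc, hσ, Equiv.swap_apply_right]
      exact (Fin.castSucc_lt_last j).ne (σ.injective this)
    obtain ⟨s, hs, h⟩ := hχ.vector (fun j => t (σ j.castSucc))
      (hti.comp (f := fun j => σ j.castSucc) fun a b hab =>
        Fin.castSucc_injective k (σ.injective hab))
      (fun j => hDS _ (ht _)) U hU (fun j => h2 _ (hσne j)) ⟨_, hDS _ (ht i), h1⟩
    have e1 : ∀ e, (Fin.snoc (fun j : Fin k => t (σ j.castSucc)) e : Fin (k + 1) → E) =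
        Function.update t i e ∘ σ := by
      intro e
      funext a
      refine Fin.lastCases ?_ (fun a => ?_) a
      · simp [hσ]
      · simp [Function.update_of_ne (hσne a)]
    have e2 := h e (hDS _ he)
    have e3 := h (t i) (hDS _ (ht i))
    rw [e1, hsw] at e2 e3
    rw [hconst t ht i U hU h2 e he (t i) (ht i), ← e3, Function.update_eq_self] at e2
    split_ifs at e2
    · exact e2
    · exact neg_injective e2
  have main : ∀ s : Finset (Fin (k + 1)), χ (fun j => if j ∈ s then t' j else t j) = χ t := by
    intro s
    induction s using Finset.induction_on with
    | empty => simp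
    | insert i s hi ih =>
      have e : (fun j => if j ∈ insert i s then t' j else t j) =
          Function.update (fun j => if j ∈ s then t' j else t j) i (t' i) := by
        funext j
        by_cases hj : j = i
        · subst hj; simp
        · simp [hj]
      rw [e, step _ (fun j => ?_) i (t' i) (ht' i), ih]
      split_ifs
      · exact ht' j
      · exact ht j
  have := main Finset.univ
  simpa using this.symm

end Chirotopes

/-! ### Flags, flats, and their circles. -/

section FlagOrders

variable {E : Type*}

/-- The part `X 0 > X 1 > ⋯ > X (d - 1)` of a maximal chain that starts in the positive tope. -/
structure IsPosFlag (L : Set (SV E)) (d : ℕ) (X : ℕ → SV E) : Prop where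
  zero : X 0 = fun _ => 1
  mem : ∀ j < d, X j ∈ L
  nonneg : ∀ j < d, ∀ e, X j e ≠ 0 → X j e = 1
  mono : ∀ j, j + 1 < d → ∀ e, X j e = 0 → X (j + 1) e = 0
  strict : ∀ j, j + 1 < d → ∃ e, X (j + 1) e = 0 ∧ X j e ≠ 0
  constant : ∀ j, j + 1 < d → ∀ W ∈ L, (∀ e, X j e = 0 → W e = 0) → ∀ e f,
    X (j + 1) e = 0 → X j e ≠ 0 → X (j + 1) f = 0 → X j f ≠ 0 → W e = W f

theorem IsPosFlag.mono' {L : Set (SV E)} {d : ℕ} {X : ℕ → SV E} (hX : IsPosFlag L d X) {i j : ℕ}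
    (hij : i ≤ j) (hj : j < d) {e : E} (he : X i e = 0) : X j e = 0 := by
  induction j, hij using Nat.le_induction with
  | base => exact he
  | succ j _ ih => exact hX.mono j hj e (ih (by omega))

/-- One element from each step of the flag. -/
def IsFlagTransversal (X : ℕ → SV E) {k : ℕ} (e : Fin k → E) : Prop :=
  ∀ i : Fin k, X (i + 1) (e i) = 0 ∧ X i (e i) ≠ 0

theorem IsPosFlag.indep {L : Set (SV E)} (hL : IsOrientedMatroid L) {d : ℕ} {X : ℕ → SV E}
    (hX : IsPosFlag L d X) {k : ℕ} (hk : k < d) {e : Fin k → E} (he : IsFlagTransversal X e) :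
    CovIndep L e := by
  induction k with
  | zero => exact fun i => i.elim0
  | succ k ih =>
    rw [← Fin.snoc_init_self e]
    refine (ih (by omega) (e := Fin.init e) fun i => he i.castSucc).snoc hL (hX.mem k (by omega))
      (fun i => ?_) (he (Fin.last k)).2
    exact hX.mono' (by have := i.2; simp) (by omega) (he i.castSucc).1

theorem IsPosFlag.exists_transversal {L : Set (SV E)} {d : ℕ} {X : ℕ → SV E}
    (hX : IsPosFlag L d X) {k : ℕ} (hk : k < d) : ∃ e : Fin k → E, IsFlagTransversal X e := by
  have : ∀ i : Fin k, ∃ e, X (i + 1) e = 0 ∧ X i e ≠ 0 := fun i =>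
    hX.strict i (by have := i.2; omega)
  choose e he using this
  exact ⟨e, he⟩

/-- A covector that vanishes on a transversal of the flag vanishes where the flag does. -/
theorem IsPosFlag.eq_zero {L : Set (SV E)} {d : ℕ} {X : ℕ → SV E}
    (hX : IsPosFlag L d X) {W : SV E} (hW : W ∈ L) {k : ℕ} (hk : k < d)
    (h : ∀ i < k, ∃ g, X (i + 1) g = 0 ∧ X i g ≠ 0 ∧ W g = 0) {e : E} (he : X k e = 0) :
    W e = 0 := by
  induction k generalizing e with
  | zero => rw [hX.zero] at he; exact absurd he one_ne_zero
  | succ k ih =>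
    have hk' : ∀ e, X k e = 0 → W e = 0 := fun e he =>
      ih (by omega) (fun i hi => h i (by omega)) he
    by_cases h0 : X k e = 0
    · exact hk' e h0
    · obtain ⟨g, h1, h2, h3⟩ := h k (by omega)
      rw [hX.constant k hk W hW hk' e g he h0 h1 h2, h3]

theorem SV.mem_zeros {S : Finset E} {X : SV E} {e : E} : e ∈ X.zeros S ↔ e ∈ S ∧ X e = 0 :=
  Finset.mem_filter

theorem SV.zeros_subset (S : Finset E) (X : SV E) : X.zeros S ⊆ S := Finset.filter_subset _ _

theorem IsOrientedMatroid.contraction {L : Set (SV E)} (hL : IsOrientedMatroid L)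
    (A : Finset E) : IsOrientedMatroid (contraction L A) := by
  constructor
  · exact ⟨hL.zero_mem, fun _ _ => rfl⟩
  · rintro X ⟨hX, h0⟩
    exact ⟨hL.neg_mem X hX, fun e he => by rw [Pi.neg_apply, h0 e he]; rfl⟩
  · rintro X ⟨hX, h0⟩ Y ⟨hY, h1⟩
    exact ⟨hL.comp_mem X hX Y hY, fun e he => SV.comp_apply_eq_zero.2 ⟨h0 e he, h1 e he⟩⟩
  · rintro X ⟨hX, h0⟩ Y ⟨hY, h1⟩ e he
    obtain ⟨Z, hZ, hZe, hZf⟩ := hL.elim X hX Y hY e he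
    refine ⟨Z, ⟨hZ, fun f hf => ?_⟩, hZe, hZf⟩
    rw [hZf f (fun hs => hs.1 (h0 f hf))]
    exact SV.comp_apply_eq_zero.2 ⟨h0 f hf, h1 f hf⟩

theorem IsPosFlag.indep_snoc {L : Set (SV E)} (hL : IsOrientedMatroid L) {d : ℕ} {X : ℕ → SV E}
    (hX : IsPosFlag L d X) {k : ℕ} (hk : k < d)
    {e : Fin k → E} (he : IsFlagTransversal X e) {g : E} (hg : X k g ≠ 0) :
    CovIndep L (Fin.snoc e g : Fin (k + 1) → E) :=
  (hX.indep hL hk he).snoc hL (hX.mem k hk) (fun i => hX.mono' (by omega) hk (he i).1) hg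

theorem SV.neg_zeros (S : Finset E) (X : SV E) : (-X).zeros S = X.zeros S := by
  ext e
  simp [SV.mem_zeros]

variable [DecidableEq E]

theorem SV.restrict_apply_of_mem {S : Finset E} (X : SV E) {e : E} (h : e ∈ S) :
    X.restrict S e = X e := if_pos h

theorem SV.restrict_apply_of_notMem {S : Finset E} (X : SV E) {e : E} (h : e ∉ S) :
    X.restrict S e = 0 := if_neg h

theorem SV.restrict_restrict {S S' : Finset E} (h : S' ⊆ S) (X : SV E) :
    (X.restrict S).restrict S' = X.restrict S' := by
  funext e
  by_cases he : e ∈ S'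
  · simp [SV.restrict, he, h he]
  · simp [SV.restrict, he]

theorem SV.restrict_zeros (S : Finset E) (X : SV E) : (X.restrict S).zeros S = X.zeros S := by
  ext e
  simp only [SV.mem_zeros]
  exact and_congr_right fun h => by rw [SV.restrict_apply_of_mem X h]

/-- This allows the nested minors of the recursion to be replaced by a single restriction of `L`. -/
theorem deletionTo_deletionTo (L : Set (SV E)) {S S' : Finset E} (h : S' ⊆ S) :
    deletionTo (deletionTo L S) S' = deletionTo L S' := by
  ext X
  constructor
  · rintro ⟨_, ⟨W, hW, rfl⟩, rfl⟩
    exact ⟨W, hW, SV.restrict_restrict h W⟩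
  · rintro ⟨W, hW, rfl⟩
    exact ⟨_, ⟨W, hW, rfl⟩, (SV.restrict_restrict h W).symm⟩

theorem SV.restrict_comp (S : Finset E) (X Y : SV E) :
    (X.comp Y).restrict S = (X.restrict S).comp (Y.restrict S) := by
  funext e
  by_cases h : e ∈ S <;> simp [SV.comp, SV.restrict, h]

theorem SV.restrict_neg (S : Finset E) (X : SV E) : (-X).restrict S = -(X.restrict S) := by
  funext e
  by_cases h : e ∈ S <;> simp [SV.restrict, h]

theorem IsOrientedMatroid.deletionTo {L : Set (SV E)} (hL : IsOrientedMatroid L) (S : Finset E) :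
    IsOrientedMatroid (deletionTo L S) := by
  constructor
  · refine ⟨0, hL.zero_mem, ?_⟩
    funext e
    simp [SV.restrict]
  · rintro _ ⟨W, hW, rfl⟩
    exact ⟨-W, hL.neg_mem W hW, (SV.restrict_neg S W).symm⟩
  · rintro _ ⟨W, hW, rfl⟩ _ ⟨W', hW', rfl⟩
    exact ⟨_, hL.comp_mem W hW W' hW', (SV.restrict_comp S W W').symm⟩
  · rintro _ ⟨W, hW, rfl⟩ _ ⟨W', hW', rfl⟩ e he
    have heS : e ∈ S := by
      by_contra hc
      exact he.1 (SV.restrict_apply_of_notMem W hc)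
    obtain ⟨Z, hZ, hZe, hZf⟩ := hL.elim W hW W' hW' e (by
      simpa only [SV.Sep, SV.restrict_apply_of_mem _ heS] using he)
    refine ⟨_, ⟨Z, hZ, rfl⟩, by rw [SV.restrict_apply_of_mem _ heS, hZe], fun f hf => ?_⟩
    rw [← SV.restrict_comp]
    by_cases hfS : f ∈ S
    · rw [SV.restrict_apply_of_mem _ hfS, SV.restrict_apply_of_mem _ hfS]
      exact hZf f (by simpa only [SV.Sep, SV.restrict_apply_of_mem _ hfS] using hf)
    · rw [SV.restrict_apply_of_notMem _ hfS, SV.restrict_apply_of_notMem _ hfS]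

/-- The circle of the flat `S` through the `k`-th flat of the flag. -/
def flagCircle (L : Set (SV E)) (X : ℕ → SV E) (k : ℕ) (S : Finset E) : Set (SV E) :=
  contraction (deletionTo L S) ((X k).zeros S)

/-- The elements of the circle. -/
def flagCircleSupport (X : ℕ → SV E) (k : ℕ) (S : Finset E) : Set E := {e | e ∈ S ∧ X k e ≠ 0}

/-- Flats and chirotopes to which the recursive construction of the order descends. -/
structure IsLevel (L : Set (SV E)) (X : ℕ → SV E) (k : ℕ) (S : Finset E)
    (χ : (Fin (k + 1) → E) → SignType) : Prop where
  chirotope : IsLocalChirotope L k S χ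
  nonempty : S.Nonempty
  subset : ∀ j, j + 1 = k → ∀ e, X j e = 0 → e ∈ S
  -- The restriction of `a` to `S` is a vertex of the circle, so the circle is not degenerate.
  -- Writing `k` as `j + 1` leaves rank 1 without a condition.
  exists_mem : ∀ j, j + 1 = k → ∃ a ∈ L, (∀ e, X j e = 0 → a e = 0) ∧ (∃ e ∈ S, a e ≠ 0) ∧
    ∃ e ∈ S, a e = 0 ∧ X j e ≠ 0

theorem mem_flagCircle {L : Set (SV E)} {X : ℕ → SV E} {k : ℕ} {S : Finset E} {V : SV E} :
    V ∈ flagCircle L X k S ↔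
      ∃ W ∈ L, V = W.restrict S ∧ ∀ e ∈ S, X k e = 0 → W e = 0 := by
  constructor
  · rintro ⟨⟨W, hW, rfl⟩, h⟩
    refine ⟨W, hW, rfl, fun e he h0 => ?_⟩
    rw [← h e (SV.mem_zeros.2 ⟨he, h0⟩), SV.restrict_apply_of_mem _ he]
  · rintro ⟨W, hW, rfl, h⟩
    refine ⟨⟨W, hW, rfl⟩, fun e he => ?_⟩
    rw [SV.mem_zeros] at he
    rw [SV.restrict_apply_of_mem _ he.1, h e he.1 he.2]

theorem eq_one_of_lt_restrict {L : Set (SV E)} {d : ℕ} {X : ℕ → SV E} {k : ℕ} {S : Finset E}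
    (hX : IsPosFlag L d X) (hk : k < d) {V : SV E}
    (hV : V.Lt ((X k).restrict S)) {e : E} (he : V e ≠ 0) : V e = 1 := by
  have h1 := hV.1 e he
  by_cases heS : e ∈ S
  · rw [SV.restrict_apply_of_mem _ heS] at h1
    rw [h1]
    exact hX.nonneg k hk e (h1 ▸ he)
  · rw [SV.restrict_apply_of_notMem _ heS] at h1
    exact absurd h1 he

variable {L : Set (SV E)} {d : ℕ} {X : ℕ → SV E} {k : ℕ} {S : Finset E}
  {χ : (Fin (k + 2) → E) → SignType}

/-- Rank 2 comes from the chirotope: after a transversal of the flag and `g`, the sign as a function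
of the last entry is proportional to every nonzero covector of the circle that vanishes at `g`. A
vertex at `g` is `a` itself, or arises by eliminating `g` from `X k` and `a` or `-a`. -/
theorem IsLevel.isCircle (hL : IsOrientedMatroid L) (hX : IsPosFlag L d X) (hk : k < d)
    (h : IsLevel L X (k + 1) S χ) : IsCircle (flagCircle L X k S) (flagCircleSupport X k S) where
  om := (hL.deletionTo S).contraction _
  supp := by
    intro V hV e he
    obtain ⟨W, hW, rfl, h0⟩ := mem_flagCircle.1 hV
    by_cases heS : e ∈ S
    · rw [SV.restrict_apply_of_mem _ heS]
      refine h0 e heS ?_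
      by_contra hc
      exact he ⟨heS, hc⟩
    · exact SV.restrict_apply_of_notMem _ heS
  exists_vertex := by
    rintro g ⟨hgS, hg⟩
    obtain ⟨a, ha, ha0, ⟨b, hbS, hb⟩, c, hcS, hac, hXc⟩ := h.exists_mem k rfl
    by_cases hag : a g = 0
    · refine ⟨a.restrict S, mem_flagCircle.2 ⟨a, ha, rfl, fun e _ he => ha0 e he⟩, ?_, ?_⟩
      · exact Function.ne_iff.2 ⟨b, by rwa [SV.restrict_apply_of_mem _ hbS]⟩
      · rw [SV.restrict_apply_of_mem _ hgS, hag]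
    · have key : ∀ a ∈ L, (∀ e, X k e = 0 → a e = 0) → a c = 0 → (X k).Sep a g →
          ∃ V ∈ flagCircle L X k S, V ≠ 0 ∧ V g = 0 := by
        intro a ha ha0 hac hs
        obtain ⟨Z, hZ, hZg, hZf⟩ := hL.elim _ (hX.mem k hk) a ha g hs
        refine ⟨Z.restrict S, mem_flagCircle.2 ⟨Z, hZ, rfl, fun e _ he => ?_⟩, ?_, ?_⟩
        · rw [hZf e (fun hc => hc.1 he)]
          exact SV.comp_apply_eq_zero.2 ⟨he, ha0 e he⟩
        · refine Function.ne_iff.2 ⟨c, ?_⟩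
          rw [SV.restrict_apply_of_mem _ hcS, hZf c (fun hs => hs.1 (by rw [hs.2, hac]; rfl)),
            SV.comp_apply_of_ne_zero _ hXc]
          exact hXc
        · rw [SV.restrict_apply_of_mem _ hgS, hZg]
      rcases SignType.eq_or_eq_neg_of_ne_zero hg hag with h1 | h1
      · exact key (-a) (hL.neg_mem a ha) (fun e he => by rw [Pi.neg_apply, ha0 e he]; rfl)
          (by rw [Pi.neg_apply, hac]; rfl) ⟨hg, by rw [Pi.neg_apply, neg_neg, h1]⟩
      · exact key a ha ha0 hac ⟨hg, h1⟩
  unique := by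
    rintro g ⟨hgS, hg⟩ V hV V' hV' hV0 hV0' hVg hVg'
    obtain ⟨W, hW, rfl, hW0⟩ := mem_flagCircle.1 hV
    obtain ⟨W', hW', rfl, hW0'⟩ := mem_flagCircle.1 hV'
    obtain ⟨e, he⟩ := hX.exists_transversal hk
    have hXe : ∀ i, X k (e i) = 0 := fun i => hX.mono' (by omega) hk (he i).1
    have heS : ∀ i, e i ∈ S := fun i => h.subset k rfl _ (hXe i)
    have hS : ∀ i, (Fin.snoc e g : Fin (k + 1) → E) i ∈ S := by
      intro i
      refine Fin.lastCases ?_ (fun i => ?_) i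
      · simpa using hgS
      · simpa using heS i
    have ex : ∀ W ∈ L, (∀ e ∈ S, X k e = 0 → W e = 0) → W.restrict S ≠ 0 →
        W.restrict S g = 0 → ∃ s : SignType, s ≠ 0 ∧
          ∀ a ∈ S, χ (Fin.snoc (Fin.snoc e g : Fin (k + 1) → E) a) = s * W a := by
      intro W hW h0 hne hWg
      refine h.chirotope.vector _ (hX.indep_snoc hL hk he hg) hS W hW (fun i => ?_) ?_
      · refine Fin.lastCases ?_ (fun i => ?_) i
        · rw [Fin.snoc_last, ← hWg, SV.restrict_apply_of_mem _ hgS]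
        · rw [Fin.snoc_castSucc]
          exact h0 _ (heS i) (hXe i)
      · obtain ⟨a, ha⟩ := Function.ne_iff.1 hne
        by_cases haS : a ∈ S
        · exact ⟨a, haS, by rwa [SV.restrict_apply_of_mem _ haS] at ha⟩
        · exact absurd (SV.restrict_apply_of_notMem _ haS) ha
    obtain ⟨s, hs, hsW⟩ := ex W hW hW0 hV0 hVg
    obtain ⟨s', hs', hsW'⟩ := ex W' hW' hW0' hV0' hVg'
    rcases SignType.eq_or_eq_neg_of_ne_zero hs' hs with rfl | rfl
    · left
      funext a
      by_cases haS : a ∈ S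
      · rw [SV.restrict_apply_of_mem _ haS, SV.restrict_apply_of_mem _ haS]
        exact mul_left_cancel₀ hs ((hsW' a haS).symm.trans (hsW a haS))
      · rw [SV.restrict_apply_of_notMem _ haS, SV.restrict_apply_of_notMem _ haS]
    · right
      funext a
      rw [Pi.neg_apply]
      by_cases haS : a ∈ S
      · rw [SV.restrict_apply_of_mem _ haS, SV.restrict_apply_of_mem _ haS]
        have h1 := (hsW' a haS).symm.trans (hsW a haS)
        revert h1 hs
        generalize W a = x, W' a = y
        clear * -
        revert s x y
        decide
      · rw [SV.restrict_apply_of_notMem _ haS, SV.restrict_apply_of_notMem _ haS]; rfl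
  exists_tope := by
    refine ⟨(X k).restrict S, mem_flagCircle.2 ⟨X k, hX.mem k hk, rfl, fun _ _ h => h⟩, ?_⟩
    rintro e ⟨heS, he⟩
    rwa [SV.restrict_apply_of_mem _ heS]
  nonempty := by
    obtain ⟨a, ha, ha0, ⟨b, hbS, hb⟩, c, hcS, hac, hXc⟩ := h.exists_mem k rfl
    exact ⟨c, hcS, hXc⟩

theorem IsLevel.isTope (hL : IsOrientedMatroid L) (hX : IsPosFlag L d X) (hk : k < d)
    (h : IsLevel L X (k + 1) S χ) : IsTope (flagCircle L X k S) ((X k).restrict S) := by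
  rw [(h.isCircle hL hX hk).isTope_iff]
  refine ⟨mem_flagCircle.2 ⟨X k, hX.mem k hk, rfl, fun _ _ h => h⟩, ?_⟩
  rintro e ⟨heS, he⟩
  rwa [SV.restrict_apply_of_mem _ heS]

/-- The sets from which the elements that orient the circle at the vertex `Y` are chosen. -/
structure IsOrientingTuple (X : ℕ → SV E) (k : ℕ) (S : Finset E) (Y : SV E) (e : Fin k → E)
    (eY eZ : E) : Prop where
  flag : IsFlagTransversal X e
  mem : eY ∈ S
  eq_zero : Y eY = 0
  ne_zero : X k eY ≠ 0
  mem' : eZ ∈ S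
  ne_zero' : Y eZ ≠ 0

theorem IsLevel.indep_orienting (hL : IsOrientedMatroid L) (hX : IsPosFlag L d X) (hk : k < d)
    (h : IsLevel L X (k + 1) S χ) {Y : SV E} (hY : Y ∈ flagCircle L X k S) {e : Fin k → E}
    {eY eZ : E} (ht : IsOrientingTuple X k S Y e eY eZ) :
    CovIndep L (Fin.snoc (Fin.snoc e eY : Fin (k + 1) → E) eZ : Fin (k + 2) → E) ∧
      ∀ i, (Fin.snoc (Fin.snoc e eY : Fin (k + 1) → E) eZ : Fin (k + 2) → E) i ∈ S := by
  obtain ⟨W, hW, rfl, hW0⟩ := mem_flagCircle.1 hY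
  have hXe : ∀ i, X k (e i) = 0 := fun i => hX.mono' (by omega) hk (ht.flag i).1
  have heS : ∀ i, e i ∈ S := fun i => h.subset k rfl _ (hXe i)
  have h1 := ht.eq_zero
  have h2 := ht.ne_zero'
  rw [SV.restrict_apply_of_mem _ ht.mem] at h1
  rw [SV.restrict_apply_of_mem _ ht.mem'] at h2
  constructor
  · refine (hX.indep_snoc hL hk ht.flag ht.ne_zero).snoc hL hW (fun i => ?_) h2
    refine Fin.lastCases ?_ (fun i => ?_) i
    · simpa using h1
    · simpa using hW0 _ (heS i) (hXe i)
  · intro i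
    refine Fin.lastCases ?_ (fun i => Fin.lastCases ?_ (fun i => ?_) i) i
    · simpa using ht.mem'
    · simpa using ht.mem
    · simpa using heS i

variable [Finite E]

/-- Orientation does not depend on the chosen elements. -/
theorem IsLevel.orientation_eq (hL : IsOrientedMatroid L) (hX : IsPosFlag L d X) (hk : k < d)
    (h : IsLevel L X (k + 1) S χ) {Y : SV E} (hY : IsCocircuit (flagCircle L X k S) Y)
    (hYT : Y.Lt ((X k).restrict S)) {e e' : Fin k → E} {eY eZ eY' eZ' : E}
    (ht : IsOrientingTuple X k S Y e eY eZ) (ht' : IsOrientingTuple X k S Y e' eY' eZ') :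
    χ (Fin.snoc (Fin.snoc e eY : Fin (k + 1) → E) eZ) =
      χ (Fin.snoc (Fin.snoc e' eY' : Fin (k + 1) → E) eZ') := by
  have hC := h.isCircle hL hX hk
  -- The entries are taken from the steps of the flag, from the zeros of `Y` outside the flag, and
  -- from the complement of the zeros of `Y`. Dual covectors have to be constant on each of these
  -- sets.
  let D : Fin (k + 2) → Set E :=
    Fin.snoc (Fin.snoc (fun i : Fin k => {a | X (i + 1) a = 0 ∧ X i a ≠ 0})
      {a | a ∈ S ∧ Y a = 0 ∧ X k a ≠ 0} : Fin (k + 1) → Set E) {a | a ∈ S ∧ Y a ≠ 0}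
  have hD1 : D (Fin.last (k + 1)) = {a | a ∈ S ∧ Y a ≠ 0} := Fin.snoc_last _ _
  have hD2 : D (Fin.last k).castSucc = {a | a ∈ S ∧ Y a = 0 ∧ X k a ≠ 0} := by
    simp only [D, Fin.snoc_castSucc, Fin.snoc_last]
  have hD3 : ∀ i : Fin k, D i.castSucc.castSucc = {a | X (i + 1) a = 0 ∧ X i a ≠ 0} := by
    intro i
    simp only [D, Fin.snoc_castSucc]
  have split : ∀ t : Fin (k + 2) → E, (∀ i, t i ∈ D i) →
      t = Fin.snoc (Fin.snoc (fun i : Fin k => t i.castSucc.castSucc)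
        (t (Fin.last k).castSucc) : Fin (k + 1) → E) (t (Fin.last (k + 1))) ∧
      IsOrientingTuple X k S Y (fun i : Fin k => t i.castSucc.castSucc)
        (t (Fin.last k).castSucc) (t (Fin.last (k + 1))) := by
    intro t ht
    constructor
    · funext a
      refine Fin.lastCases ?_ (fun a => Fin.lastCases ?_ (fun a => ?_) a) a <;> simp
    · have h1 := ht (Fin.last (k + 1))
      have h2 := ht (Fin.last k).castSucc
      rw [hD1] at h1
      rw [hD2] at h2
      refine ⟨fun i => ?_, h2.1, h2.2.1, h2.2.2, h1.1, h1.2⟩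
      have h3 := ht i.castSucc.castSucc
      rw [hD3] at h3
      exact h3
  have join : ∀ {e : Fin k → E} {eY eZ : E}, IsOrientingTuple X k S Y e eY eZ → ∀ i,
      (Fin.snoc (Fin.snoc e eY : Fin (k + 1) → E) eZ : Fin (k + 2) → E) i ∈ D i := by
    intro e eY eZ ht i
    refine Fin.lastCases ?_ (fun i => Fin.lastCases ?_ (fun i => ?_) i) i
    · rw [hD1, Fin.snoc_last]
      exact ⟨ht.mem', ht.ne_zero'⟩
    · rw [hD2, Fin.snoc_castSucc, Fin.snoc_last]
      exact ⟨ht.mem, ht.eq_zero, ht.ne_zero⟩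
    · rw [hD3, Fin.snoc_castSucc, Fin.snoc_castSucc]
      exact ht.flag i
  have vanish : ∀ t : Fin (k + 2) → E, (∀ i, t i ∈ D i) → ∀ U ∈ L, ∀ m ≤ k,
      (∀ i : Fin (k + 2), (i : ℕ) < m → U (t i) = 0) → ∀ e, X m e = 0 → U e = 0 := by
    intro t ht U hU m hm h0 e he
    refine hX.eq_zero hU (by omega) (fun i hi => ?_) he
    have h3 := ht (⟨i, by omega⟩ : Fin k).castSucc.castSucc
    rw [hD3] at h3
    exact ⟨_, h3.1, h3.2, h0 _ hi⟩
  refine h.chirotope.eq_of_transversal D ?_ ?_ ?_ (join ht) (join ht')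
  · intro i
    refine Fin.lastCases ?_ (fun i => Fin.lastCases ?_ (fun i => ?_) i) i
    · rw [hD1]; exact fun a ha => ha.1
    · rw [hD2]; exact fun a ha => ha.1
    · rw [hD3]; exact fun a ha => h.subset k rfl a (hX.mono' (by omega) hk ha.1)
  · intro t ht
    obtain ⟨h1, h2⟩ := split t ht
    rw [h1]
    exact (h.indep_orienting hL hX hk hY.1 h2).1
  · intro t ht i U hU h0
    have circ : (∀ e, X k e = 0 → U e = 0) → U.restrict S ∈ flagCircle L X k S := fun hz =>
      mem_flagCircle.2 ⟨U, hU, rfl, fun e _ he => hz e he⟩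
    have uniq : (∀ e, X k e = 0 → U e = 0) → ∀ a ∈ S, X k a ≠ 0 → Y a = 0 → U a = 0 →
        U.restrict S = 0 ∨ U.restrict S = Y ∨ U.restrict S = -Y := by
      intro hz a ha hXa hYa hUa
      by_cases hU0 : U.restrict S = 0
      · exact .inl hU0
      · exact .inr (hC.unique a ⟨ha, hXa⟩ Y hY.1 _ (circ hz) hY.2.1 hU0 hYa
          (by rw [SV.restrict_apply_of_mem _ ha, hUa]))
    revert h0
    refine Fin.lastCases ?_ (fun i => Fin.lastCases ?_ (fun i => ?_) i) i
    -- Last entry: `U` vanishes on the flag and at a zero of `Y`, so on `S` it is `0`, `Y` or `-Y`,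
    -- and `Y` is positive off its zeros.
    · intro h0 a ha b hb
      rw [hD1] at ha hb
      have hz := vanish t ht U hU k le_rfl (fun i hi => h0 i (by
        rintro rfl
        simp at hi))
      have h2 := ht (Fin.last k).castSucc
      rw [hD2] at h2
      rw [← SV.restrict_apply_of_mem U ha.1, ← SV.restrict_apply_of_mem U hb.1]
      have e1 := eq_one_of_lt_restrict hX hk hYT ha.2
      have e2 := eq_one_of_lt_restrict hX hk hYT hb.2
      rcases uniq hz _ h2.1 h2.2.2 h2.2.1 (h0 _ (Fin.castSucc_lt_last _).ne) with h3 | h3 | h3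
      · rw [h3]; rfl
      · rw [h3, e1, e2]
      · rw [h3, Pi.neg_apply, Pi.neg_apply, e1, e2]
    · intro h0 a ha b hb
      rw [hD2] at ha hb
      have hz := vanish t ht U hU k le_rfl (fun i hi => h0 i (by
        rintro rfl
        simp at hi))
      have zero_of : ∀ a b, (a ∈ S ∧ Y a = 0 ∧ X k a ≠ 0) → (b ∈ S ∧ Y b = 0 ∧ X k b ≠ 0) →
          U a = 0 → U b = 0 := by
        intro a b ha hb hUa
        rw [← SV.restrict_apply_of_mem U hb.1]
        rcases uniq hz a ha.1 ha.2.2 ha.2.1 hUa with h3 | h3 | h3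
        · rw [h3]; rfl
        · rw [h3, hb.2.1]
        · rw [h3, Pi.neg_apply, hb.2.1]; rfl
      by_cases hUa : U a = 0
      · rw [hUa, zero_of a b ha hb hUa]
      have hUb : U b ≠ 0 := fun hc => hUa (zero_of b a hb ha hc)
      -- Last entry but one: `Y ∘ U` is an edge at `Y`, either the positive edge or the one beyond
      -- `Y`, and both are constant on the zeros of `Y` outside the flag.
      have htope : IsTope (flagCircle L X k S) (Y.comp (U.restrict S)) := by
        rw [hC.isTope_iff]
        refine ⟨hC.om.comp_mem _ hY.1 _ (circ hz), ?_⟩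
        rintro g ⟨hgS, hg⟩ hc
        rw [SV.comp_apply_eq_zero, SV.restrict_apply_of_mem _ hgS] at hc
        exact hUa (zero_of g a ⟨hgS, hc.1, hg⟩ ha hc.2)
      have hlt : Y.Lt (Y.comp (U.restrict S)) :=
        hC.lt_of_le ⟨ha.1, ha.2.2⟩ htope ha.2.1 (SV.le_comp _ _)
      have hval : ∀ a, (a ∈ S ∧ Y a = 0 ∧ X k a ≠ 0) → Y.comp (U.restrict S) a = U a := by
        intro a ha
        rw [SV.comp_apply_of_eq_zero _ ha.2.1, SV.restrict_apply_of_mem _ ha.1]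
      rw [← hval a ha, ← hval b hb]
      have hXv : ∀ a, (a ∈ S ∧ Y a = 0 ∧ X k a ≠ 0) → (X k).restrict S a = 1 := by
        intro a ha
        rw [SV.restrict_apply_of_mem _ ha.1, hX.nonneg k hk a ha.2.2]
      by_cases heq : Y.comp (U.restrict S) = (X k).restrict S
      · rw [heq, hXv a ha, hXv b hb]
      · rw [hC.tope_apply_eq hY (h.isTope hL hX hk) htope hYT hlt heq,
          SV.comp_apply_of_eq_zero _ ha.2.1, SV.comp_apply_of_eq_zero _ hb.2.1, Pi.neg_apply,
          Pi.neg_apply, hXv a ha, hXv b hb]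
    · intro h0 a ha b hb
      rw [hD3] at ha hb
      have hz := vanish t ht U hU i i.2.le (fun j hj => h0 j (by
        rintro rfl
        simp at hj))
      exact hX.constant i (by have := i.2; omega) U hU hz a b ha.1 ha.2 hb.1 hb.2

end FlagOrders

/-! ### Existence and uniqueness of the order. -/

section FlagOrderTheorem

variable {E : Type*}

theorem IsLevel.flag_subset {L : Set (SV E)} {d : ℕ} {X : ℕ → SV E} {k : ℕ} {S : Finset E}
    {χ : (Fin (k + 2) → E) → SignType} (hX : IsPosFlag L d X) (hk : k < d)
    (h : IsLevel L X (k + 1) S χ) : ∀ i < k, ∀ e, X (i + 1) e = 0 → e ∈ S := fun _ hi e he =>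
  h.subset k rfl e (hX.mono' hi hk he)

theorem IsLevel.swap_sign {L : Set (SV E)} {X : ℕ → SV E} {k : ℕ} {S : Finset E}
    {χ : (Fin (k + 2) → E) → SignType} (h : IsLevel L X (k + 1) S χ) (e : Fin k → E) (a b : E) :
    χ (Fin.snoc (Fin.snoc e b : Fin (k + 1) → E) a) =
      -χ (Fin.snoc (Fin.snoc e a : Fin (k + 1) → E) b) := by
  rw [← Fin.snoc_snoc_comp_swap, h.chirotope.alternating _ _ _ (Fin.castSucc_lt_last _).ne]

variable [DecidableEq E]

/-- The order of the flat `S`, for the restricted flag. -/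
def IsLevelOrder (L : Set (SV E)) (X : ℕ → SV E) (k : ℕ) (S : Finset E)
    (χ : (Fin (k + 1) → E) → SignType) (ρ : List E) : Prop :=
  IsFlagOrder k S (deletionTo L S) χ (fun j => (X j).restrict S) ρ

/-- The list `B` is an order of the zero set of the vertex `V` of the circle. -/
def IsBlock (L : Set (SV E)) (X : ℕ → SV E) (k : ℕ) (S : Finset E)
    (χ : (Fin (k + 2) → E) → SignType) (V : SV E) (B : List E) : Prop :=
  ∃ f ∈ S, V f ≠ 0 ∧ IsLevelOrder L X k (V.zeros S) (fun x => χ (Fin.snoc x f) * V f) B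

/-- `Y` is the vertex of the positive edge of the circle at which the walk starts. -/
def IsOrientedAt (X : ℕ → SV E) (k : ℕ) (S : Finset E)
    (χ : (Fin (k + 2) → E) → SignType) (Y Z : SV E) : Prop :=
  ∃ (e : Fin k → E) (eY eZ : E), IsFlagTransversal X e ∧ (eY ∈ S ∧ Y eY = 0 ∧ X k eY ≠ 0) ∧
    (eZ ∈ S ∧ Z eZ = 0 ∧ X k eZ ≠ 0) ∧ χ (Fin.snoc (Fin.snoc e eY : Fin (k + 1) → E) eZ) = 1

/-- `Y` and `Z` are the two vertices of the positive edge of the circle. -/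
structure IsEdgePair (L : Set (SV E)) (X : ℕ → SV E) (k : ℕ) (S : Finset E) (Y Z : SV E) :
    Prop where
  left : IsCocircuit (flagCircle L X k S) Y
  left_lt : Y.Lt ((X k).restrict S)
  right : IsCocircuit (flagCircle L X k S) Z
  right_lt : Z.Lt ((X k).restrict S)
  ne : Y ≠ Z

theorem IsEdgePair.symm {L : Set (SV E)} {X : ℕ → SV E} {k : ℕ} {S : Finset E} {Y Z : SV E}
    (h : IsEdgePair L X k S Y Z) : IsEdgePair L X k S Z Y :=
  ⟨h.right, h.right_lt, h.left, h.left_lt, h.ne.symm⟩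

/-- One level of the recursion, with all minors rewritten over `L` itself; `hS` supplies the
membership of the flag elements in `S`. -/
theorem isLevelOrder_succ_iff {L : Set (SV E)} {X : ℕ → SV E} {k : ℕ} {S : Finset E}
    {χ : (Fin (k + 2) → E) → SignType} (hS : ∀ i < k, ∀ e, X (i + 1) e = 0 → e ∈ S)
    {ρ : List E} :
    IsLevelOrder L X (k + 1) S χ ρ ↔ ∃ Y Z Ys blocks, IsEdgePair L X k S Y Z ∧
      IsOrientedAt X k S χ Y Z ∧ Ys.head? = some Y ∧
      IsHalfWalk (flagCircle L X k S) ((X k).restrict S) Ys ∧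
      List.Forall₂ (IsBlock L X k S χ) Ys blocks ∧ ρ = concatBlocks ((X k).zeros S) blocks := by
  have hflag : ∀ e : Fin k → E, (∀ i : Fin k, e i ∈ (X (i + 1)).zeros S ∧
      e i ∉ (X i).zeros S) ↔ IsFlagTransversal X e := by
    intro e
    refine forall_congr' fun i => ?_
    rw [SV.mem_zeros, SV.mem_zeros]
    constructor
    · rintro ⟨⟨h1, h2⟩, h3⟩
      exact ⟨h2, fun hc => h3 ⟨h1, hc⟩⟩
    · rintro ⟨h1, h2⟩
      exact ⟨⟨hS i i.2 _ h1, h1⟩, fun hc => h2 hc.2⟩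
  have hmem : ∀ (Y : SV E) (a : E), (a ∈ Y.zeros S ∧ a ∉ (X k).zeros S) ↔
      (a ∈ S ∧ Y a = 0 ∧ X k a ≠ 0) := by
    intro Y a
    rw [SV.mem_zeros, SV.mem_zeros]
    constructor
    · rintro ⟨⟨h1, h2⟩, h3⟩
      exact ⟨h1, h2, fun hc => h3 ⟨h1, hc⟩⟩
    · rintro ⟨h1, h2, h3⟩
      exact ⟨⟨h1, h2⟩, fun hc => h3 hc.2⟩
  have hblock : (fun V B => ∃ f ∈ S, f ∉ V.zeros S ∧
      IsFlagOrder k (V.zeros S) (deletionTo (deletionTo L S) (V.zeros S))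
        (fun x => χ (Fin.snoc x f) * V f) (fun j => ((X j).restrict S).restrict (V.zeros S)) B) =
      IsBlock L X k S χ := by
    funext V B
    have h1 : (fun j => ((X j).restrict S).restrict (V.zeros S)) =
        fun j => (X j).restrict (V.zeros S) :=
      funext fun j => SV.restrict_restrict (SV.zeros_subset S V) (X j)
    rw [h1, deletionTo_deletionTo L (SV.zeros_subset S V)]
    refine propext (exists_congr fun f => and_congr_right fun hf => and_congr_left fun _ => ?_)
    rw [SV.mem_zeros]
    exact ⟨fun h hc => h ⟨hf, hc⟩, fun h hc => h hc.2⟩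
  unfold IsLevelOrder
  rw [IsFlagOrder]
  simp only [hflag, SV.restrict_zeros, hmem, hblock]
  constructor
  · rintro ⟨e, Y, Z, eY, eZ, Ys, blocks, h1, h2, h3, h4, h5, h6, h7, h8, h9, h10, h11, h12, h13⟩
    exact ⟨Y, Z, Ys, blocks, ⟨h2, h3, h4, h5, h6⟩, ⟨e, eY, eZ, h1, h7, h8, h9⟩, h10, h11, h12, h13⟩
  · rintro ⟨Y, Z, Ys, blocks, ⟨h2, h3, h4, h5, h6⟩, ⟨e, eY, eZ, h1, h7, h8, h9⟩, h10, h11, h12, h13⟩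
    exact ⟨e, Y, Z, eY, eZ, Ys, blocks, h1, h2, h3, h4, h5, h6, h7, h8, h9, h10, h11, h12, h13⟩

theorem List.Forall₂.exists_of_forall {α β : Type*} {R : α → β → Prop} {l : List α}
    (h : ∀ a ∈ l, ∃ b, R a b) : ∃ l', List.Forall₂ R l l' := by
  induction l with
  | nil => exact ⟨[], .nil⟩
  | cons a l ih =>
    obtain ⟨b, hb⟩ := h a (by simp)
    obtain ⟨l', hl'⟩ := ih fun a ha => h a (by simp [ha])
    exact ⟨b :: l', .cons hb hl'⟩

theorem List.Forall₂.unique {α β : Type*} {R R' : α → β → Prop} {l : List α} {l₁ l₂ : List β}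
    (h₁ : List.Forall₂ R l l₁) (h₂ : List.Forall₂ R' l l₂)
    (h : ∀ a ∈ l, ∀ b b', R a b → R' a b' → b = b') : l₁ = l₂ := by
  induction h₁ generalizing l₂ with
  | nil => cases h₂; rfl
  | cons hab _ ih =>
    cases h₂ with
    | cons hab' h' =>
      rw [h _ (by simp) _ _ hab hab', ih h' fun a ha => h a (by simp [ha])]

theorem List.Forall₂.exists_map_range {α β : Type*} {R : α → List β → Prop} {n : ℕ} {V : ℕ → α}
    {l : List (List β)} (h : List.Forall₂ R ((List.range n).map V) l) :
    ∃ B : ℕ → List β, l = (List.range n).map B ∧ ∀ i < n, R (V i) (B i) := by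
  have hlen := h.length_eq
  simp only [List.length_map, List.length_range] at hlen
  refine ⟨fun i => l.getD i [], ?_, fun i hi => ?_⟩
  · apply List.ext_getElem
    · simp [← hlen]
    · intro i h1 h2
      simp [h1]
  · rw [List.forall₂_iff_get] at h
    have h3 := h.2 i (by simpa using hi) (by omega)
    simp only [List.get_eq_getElem, List.getElem_map, List.getElem_range] at h3
    dsimp only
    rw [List.getD_eq_getElem _ _ (by omega)]
    exact h3

theorem concatBlocks_map_range (F : Finset E) (m : ℕ) (B : ℕ → List E) :
    concatBlocks F ((List.range (m + 1)).map B) =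
      B 0 ++ ((List.range m).map fun i => (B (i + 1)).filter fun e => e ∉ F).flatten := by
  rw [List.range_succ_eq_map, List.map_cons, concatBlocks, List.map_map, List.map_map]
  rfl

section

variable {L : Set (SV E)} {d : ℕ} {X : ℕ → SV E} {k : ℕ} {S : Finset E}
  {χ : (Fin (k + 2) → E) → SignType}

/-- Chirotopes that agree on independent families induce such chirotopes. -/
theorem IsLevel.induced_eq (hL : IsOrientedMatroid L) (h : IsLevel L X (k + 1) S χ)
    {χ' : (Fin (k + 2) → E) → SignType} (hχ : ∀ t, CovIndep L t → (∀ i, t i ∈ S) → χ t = χ' t)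
    {V : SV E} (hV : V ∈ flagCircle L X k S) {f f' : E} (hf : f ∈ S) (hVf : V f ≠ 0)
    (hf' : f' ∈ S) (hVf' : V f' ≠ 0) (x : Fin (k + 1) → E) (hx : CovIndep L x)
    (hxS : ∀ i, x i ∈ V.zeros S) : χ (Fin.snoc x f) * V f = χ' (Fin.snoc x f') * V f' := by
  obtain ⟨W, hW, rfl, -⟩ := mem_flagCircle.1 hV
  rw [SV.restrict_zeros] at hxS
  rw [SV.restrict_apply_of_mem _ hf] at hVf ⊢
  rw [SV.restrict_apply_of_mem _ hf'] at hVf' ⊢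
  have hxS' : ∀ i, x i ∈ S := fun i => (SV.mem_zeros.1 (hxS i)).1
  have hxW : ∀ i, W (x i) = 0 := fun i => (SV.mem_zeros.1 (hxS i)).2
  -- In the last entry the sign is `s * W`. Multiplication by the nonzero value of `W` at the same
  -- entry leaves `s` for every choice of `f`.
  obtain ⟨s, hs, hsW⟩ := h.chirotope.vector x hx hxS' W hW hxW ⟨f, hf, hVf⟩
  rw [← hχ _ (hx.snoc hL hW hxW hVf') (fun i => by
    refine Fin.lastCases ?_ (fun i => ?_) i
    · simpa using hf'
    · simpa using hxS' i), hsW f hf, hsW f' hf']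
  revert hVf hVf'
  generalize W f = a, W f' = b
  clear * -
  revert s a b
  decide

theorem IsEdgePair.orienting (hL : IsOrientedMatroid L) (hX : IsPosFlag L d X)
    (hk : k < d) (h : IsLevel L X (k + 1) S χ) {Y Z : SV E} (hYZ : IsEdgePair L X k S Y Z)
    {e : Fin k → E} {eY eZ : E} (he : IsFlagTransversal X e)
    (hY : eY ∈ S ∧ Y eY = 0 ∧ X k eY ≠ 0) (hZ : eZ ∈ S ∧ Z eZ = 0 ∧ X k eZ ≠ 0) :
    IsOrientingTuple X k S Y e eY eZ :=
  ⟨he, hY.1, hY.2.1, hY.2.2, hZ.1, (h.isCircle hL hX hk).no_common_zero hYZ.right hYZ.left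
    hYZ.right_lt hYZ.left_lt hYZ.ne.symm ⟨hZ.1, hZ.2.2⟩ hZ.2.1⟩

variable [Finite E]

theorem IsOrientedAt.sign_eq (hL : IsOrientedMatroid L) (hX : IsPosFlag L d X)
    (hk : k < d) (h : IsLevel L X (k + 1) S χ) {Y Z : SV E} (hYZ : IsEdgePair L X k S Y Z)
    (ho : IsOrientedAt X k S χ Y Z) {e : Fin k → E} {eY eZ : E} (he : IsFlagTransversal X e)
    (hY : eY ∈ S ∧ Y eY = 0 ∧ X k eY ≠ 0) (hZ : eZ ∈ S ∧ Z eZ = 0 ∧ X k eZ ≠ 0) :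
    χ (Fin.snoc (Fin.snoc e eY : Fin (k + 1) → E) eZ) = 1 := by
  obtain ⟨e', eY', eZ', he', hY', hZ', h1⟩ := ho
  rw [← h1]
  exact h.orientation_eq hL hX hk hYZ.left hYZ.left_lt (hYZ.orienting hL hX hk h he hY hZ)
    (hYZ.orienting hL hX hk h he' hY' hZ')

theorem IsOrientedAt.not_symm (hL : IsOrientedMatroid L) (hX : IsPosFlag L d X)
    (hk : k < d) (h : IsLevel L X (k + 1) S χ) {Y Z : SV E} (hYZ : IsEdgePair L X k S Y Z)
    (ho : IsOrientedAt X k S χ Y Z) : ¬ IsOrientedAt X k S χ Z Y := by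
  rintro ⟨e, eZ, eY, he, hZ, hY, h1⟩
  have h2 := ho.sign_eq hL hX hk h hYZ he hY hZ
  rw [h.swap_sign, h1] at h2
  revert h2; decide

theorem IsEdgePair.exists_mem (hL : IsOrientedMatroid L) (hX : IsPosFlag L d X)
    (hk : k < d) (h : IsLevel L X (k + 1) S χ) {Y Z : SV E} (hYZ : IsEdgePair L X k S Y Z) :
    ∃ e, e ∈ S ∧ Y e = 0 ∧ X k e ≠ 0 := by
  obtain ⟨g, hg, h0⟩ := (h.isCircle hL hX hk).exists_zero_of_isCocircuit hYZ.left
  exact ⟨g, hg.1, h0, hg.2⟩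

theorem IsEdgePair.oriented_or (hL : IsOrientedMatroid L) (hX : IsPosFlag L d X)
    (hk : k < d) (h : IsLevel L X (k + 1) S χ) {Y Z : SV E} (hYZ : IsEdgePair L X k S Y Z) :
    IsOrientedAt X k S χ Y Z ∨ IsOrientedAt X k S χ Z Y := by
  obtain ⟨e, he⟩ := hX.exists_transversal hk
  obtain ⟨eY, hY⟩ := hYZ.exists_mem hL hX hk h
  obtain ⟨eZ, hZ⟩ := hYZ.symm.exists_mem hL hX hk h
  obtain ⟨h1, h2⟩ := h.indep_orienting hL hX hk hYZ.left.1 (hYZ.orienting hL hX hk h he hY hZ)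
  rcases SignType.eq_or_eq_neg_of_ne_zero (h.chirotope.ne_zero h1 h2) one_ne_zero with h3 | h3
  · exact .inl ⟨e, eY, eZ, he, hY, hZ, h3⟩
  · exact .inr ⟨e, eZ, eY, he, hZ, hY, by rw [h.swap_sign, h3, neg_neg]⟩

theorem IsEdgePair.eq_or_eq (hL : IsOrientedMatroid L) (hX : IsPosFlag L d X)
    (hk : k < d) (h : IsLevel L X (k + 1) S χ) {Y Z Y' Z' : SV E} (hYZ : IsEdgePair L X k S Y Z)
    (hYZ' : IsEdgePair L X k S Y' Z') : (Y' = Y ∧ Z' = Z) ∨ (Y' = Z ∧ Z' = Y) := by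
  have hC := h.isCircle hL hX hk
  rcases hC.eq_or_eq_of_lt hYZ.left hYZ.right hYZ'.left hYZ.left_lt hYZ.right_lt hYZ'.left_lt
    hYZ.ne with rfl | rfl
  · exact .inl ⟨rfl, (hC.eq_or_eq_of_lt hYZ.left hYZ.right hYZ'.right hYZ.left_lt hYZ.right_lt
      hYZ'.right_lt hYZ.ne).resolve_left hYZ'.ne.symm⟩
  · exact .inr ⟨rfl, (hC.eq_or_eq_of_lt hYZ.left hYZ.right hYZ'.right hYZ.left_lt hYZ.right_lt
      hYZ'.right_lt hYZ.ne).resolve_right hYZ'.ne.symm⟩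

/-- One vertex of the positive edge suffices. Let `V` be any vertex and take its edge on the side of
`-X k`. If this is `-X k`, then `-V` lies on the positive edge; otherwise it is neither of the edges
`X k` and `-X k`, and a separating vertex of the positive edge exists. -/
theorem IsLevel.exists_edgePair (hL : IsOrientedMatroid L) (hX : IsPosFlag L d X)
    (hk : k < d) (h : IsLevel L X (k + 1) S χ) : ∃ Y Z, IsEdgePair L X k S Y Z := by
  have hC := h.isCircle hL hX hk
  obtain ⟨g, hg⟩ := hC.nonempty
  obtain ⟨V, hV, hV0, hVg⟩ := hC.exists_vertex g hg
  have hT := h.isTope hL hX hk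
  have hVc := hC.isCocircuit_of hV hV0 hg hVg
  by_cases hc : V.comp (-(X k).restrict S) = -(X k).restrict S
  · have hVn : (-V).Lt ((X k).restrict S) := by
      have h5 : V.Lt (-(X k).restrict S) :=
        hC.lt_of_le hg (hC.isTope_neg hT) hVg (by
          conv_rhs => rw [← hc]
          exact SV.le_comp _ _)
      simpa using h5.neg
    obtain ⟨B, hB, hBT, hne⟩ := hC.exists_other_vertex (hC.isCocircuit_neg hVc) hT hVn
    exact ⟨B, -V, hB, hBT, hC.isCocircuit_neg hVc, hVn, hne⟩
  · obtain ⟨g1, g2, g3⟩ := hC.isTope_opposite hVc hT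
    by_cases hc' : V.comp (-(X k).restrict S) = (X k).restrict S
    · exact absurd hc' g3
    · obtain ⟨Z, hZ, hZT, -⟩ := hC.exists_vertex_separated hT g1 hc' hc
      obtain ⟨B, hB, hBT, hne⟩ := hC.exists_other_vertex hZ hT hZT
      exact ⟨B, Z, hB, hBT, hZ, hZT, hne⟩

/-- The data of the construction descend to the zero sets of the vertices of the circle. -/
theorem IsLevel.descend (hL : IsOrientedMatroid L) (hX : IsPosFlag L d X)
    (hk : k < d) (h : IsLevel L X (k + 1) S χ) {V : SV E}
    (hV : IsCocircuit (flagCircle L X k S) V) {f : E} (hf : f ∈ S) (hVf : V f ≠ 0) :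
    IsLevel L X k (V.zeros S) fun x => χ (Fin.snoc x f) * V f := by
  obtain ⟨W, hW, rfl, hW0⟩ := mem_flagCircle.1 hV.1
  obtain ⟨g, hg, hVg⟩ := (h.isCircle hL hX hk).exists_zero_of_isCocircuit hV
  rw [SV.restrict_apply_of_mem _ hg.1] at hVg
  rw [SV.restrict_apply_of_mem _ hf] at hVf
  rw [SV.restrict_zeros]
  have hset : (↑(W.zeros S) : Set E) = {e | e ∈ (↑S : Set E) ∧ W e = 0} := by
    ext e
    simp [SV.mem_zeros]
  have hgZ : g ∈ W.zeros S := SV.mem_zeros.2 ⟨hg.1, hVg⟩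
  refine ⟨?_, ⟨g, hgZ⟩, ?_, ?_⟩
  · rw [hset, SV.restrict_apply_of_mem _ hf]
    exact h.chirotope.induced hL hW hf hVf
  · rintro j rfl e he
    have h1 := hX.mono j hk e he
    have h2 := h.subset _ rfl e h1
    exact SV.mem_zeros.2 ⟨h2, hW0 e h2 h1⟩
  · rintro j rfl
    -- In the next circle the flag itself supplies the vertex, which is nonzero at `g`, a zero of
    -- `V` outside the flag.
    refine ⟨X (j + 1), hX.mem _ hk, hX.mono j hk, ⟨g, hgZ, hg.2⟩, ?_⟩
    obtain ⟨e, h1, h2⟩ := hX.strict j hk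
    have h3 := h.subset _ rfl e h1
    exact ⟨e, SV.mem_zeros.2 ⟨h3, hW0 e h3 h1⟩, h1, h2⟩

theorem IsEdgePair.exists_halfCircle (hL : IsOrientedMatroid L) (hX : IsPosFlag L d X)
    (hk : k < d) (h : IsLevel L X (k + 1) S χ) {A B : SV E} (hAB : IsEdgePair L X k S A B) :
    ∃ T V m, IsHalfCircle (flagCircle L X k S) (flagCircleSupport X k S) ((X k).restrict S) A B
      T V m :=
  (h.isCircle hL hX hk).exists_halfCircle (h.isTope hL hX hk) hAB.left hAB.right hAB.left_lt
    hAB.right_lt hAB.ne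

end

variable [Finite E] {L : Set (SV E)} {d : ℕ} {X : ℕ → SV E}

/-- The order of a flat exists, is unique, and contains each element of the flat once. -/
theorem isLevelOrder_existsUnique (hL : IsOrientedMatroid L) (hnd : NoDuplicates L) (hd : 1 ≤ d)
    (hX : IsPosFlag L d X) (k : ℕ) (hk : k ≤ d) (S : Finset E) (χ : (Fin (k + 1) → E) → SignType)
    (h : IsLevel L X k S χ) :
    (∃ ρ, IsLevelOrder L X k S χ ρ) ∧
    (∀ χ', IsLevel L X k S χ' → (∀ t, CovIndep L t → (∀ i, t i ∈ S) → χ t = χ' t) →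
      ∀ ρ ρ', IsLevelOrder L X k S χ ρ → IsLevelOrder L X k S χ' ρ' → ρ = ρ') ∧
    ∀ ρ, IsLevelOrder L X k S χ ρ → ρ.Nodup ∧ ∀ e, e ∈ ρ ↔ e ∈ S := by
  induction k generalizing S with
  | zero =>
    obtain ⟨e, he⟩ := h.nonempty
    -- In rank 1 every covector is, on `S`, a multiple of the positive one, so distinct elements
    -- would be duplicates.
    have hsub : ∀ f ∈ S, f = e := by
      intro f hf
      by_contra hne
      obtain ⟨V, hV, hVne⟩ := hnd f e hne
      apply hVne
      have ind : CovIndep L (Fin.elim0 : Fin 0 → E) := fun i => i.elim0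
      have hX0 := hX.mem 0 hd
      rw [hX.zero] at hX0
      obtain ⟨s, hs, h1⟩ := h.chirotope.vector Fin.elim0 ind (fun i => i.elim0) _ hX0
        (fun i => i.elim0) ⟨e, he, one_ne_zero⟩
      have hex : ∃ e ∈ (↑S : Set E), V e ≠ 0 := by
        by_contra! hc
        rw [hc f hf, hc e he] at hVne
        exact hVne rfl
      obtain ⟨s', hs', h2⟩ := h.chirotope.vector Fin.elim0 ind (fun i => i.elim0) V hV
        (fun i => i.elim0) hex
      exact mul_left_cancel₀ hs' ((h2 f hf).symm.trans (((h1 f hf).trans (h1 e he).symm).trans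
        (h2 e he)))
    have hS : S = {e} := Finset.eq_singleton_iff_unique_mem.2 ⟨he, hsub⟩
    unfold IsLevelOrder
    simp only [IsFlagOrder]
    subst hS
    refine ⟨⟨[e], e, rfl, rfl⟩, ?_, ?_⟩
    · rintro - - - _ _ ⟨a, ha, rfl⟩ ⟨b, hb, rfl⟩
      rw [← Finset.singleton_inj.1 ha, ← Finset.singleton_inj.1 hb]
    · rintro _ ⟨a, ha, rfl⟩
      rw [← Finset.singleton_inj.1 ha]
      simp
  | succ k ih =>
    have hk' : k < d := hk
    have hC := h.isCircle hL hX hk'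
    have hsub := h.flag_subset hX hk'
    have blockEx : ∀ V, IsCocircuit (flagCircle L X k S) V → ∃ B, IsBlock L X k S χ V B := by
      intro V hV
      obtain ⟨f, hf⟩ := Function.ne_iff.1 hV.2.1
      have hfS := (hC.mem_of_ne_zero hV.1 hf).1
      obtain ⟨B, hB⟩ := (ih hk'.le _ _ (h.descend hL hX hk' hV hfS hf)).1
      exact ⟨B, f, hfS, hf, hB⟩
    refine ⟨?_, ?_, ?_⟩
    · obtain ⟨Y, Z, hYZ, ho⟩ : ∃ Y Z, IsEdgePair L X k S Y Z ∧ IsOrientedAt X k S χ Y Z := by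
        obtain ⟨Y, Z, hYZ⟩ := h.exists_edgePair hL hX hk'
        rcases hYZ.oriented_or hL hX hk' h with h1 | h1
        · exact ⟨Y, Z, hYZ, h1⟩
        · exact ⟨Z, Y, hYZ.symm, h1⟩
      obtain ⟨T, V, m, hh⟩ := hYZ.symm.exists_halfCircle hL hX hk' h
      obtain ⟨blocks, hb⟩ := List.Forall₂.exists_of_forall (R := IsBlock L X k S χ)
        (l := (List.range (m + 1)).map V) (by
          intro a ha
          obtain ⟨i, -, rfl⟩ := List.mem_map.1 ha
          exact blockEx _ (hh.walk.cocircuit i))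
      refine ⟨_, (isLevelOrder_succ_iff hsub).2 ⟨Y, Z, _, blocks, hYZ, ho, ?_, hh.halfWalk, hb,
        rfl⟩⟩
      rw [List.range_succ_eq_map, List.map_cons, List.head?_cons, hh.zero]
    -- Agreement on independent families is enough: only such tuples decide the orientation, and the
    -- agreement is inherited by the induced chirotopes.
    · intro χ' h' hχ ρ ρ' hρ hρ'
      obtain ⟨Y, Z, Ys, blocks, hYZ, ho, hd, hw, hb, rfl⟩ := (isLevelOrder_succ_iff hsub).1 hρ
      obtain ⟨Y', Z', Ys', blocks', hYZ', ho', hd', hw', hb', rfl⟩ :=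
        (isLevelOrder_succ_iff hsub).1 hρ'
      have hYY : Y' = Y := by
        rcases hYZ.eq_or_eq hL hX hk' h hYZ' with ⟨rfl, -⟩ | ⟨rfl, rfl⟩
        · rfl
        · exfalso
          obtain ⟨e, eY, eZ, he, hY, hZ, hs⟩ := ho'
          refine ho.not_symm hL hX hk' h hYZ ⟨e, eY, eZ, he, hY, hZ, ?_⟩
          obtain ⟨i1, i2⟩ := h.indep_orienting hL hX hk' hYZ'.left.1
            (hYZ'.orienting hL hX hk' h he hY hZ)
          rw [hχ _ i1 i2, hs]
      subst hYY
      obtain ⟨T, V, m, hh⟩ := hYZ.symm.exists_halfCircle hL hX hk' h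
      have e1 := hh.eq_of_head Ys hw hd
      have e2 := hh.eq_of_head Ys' hw' hd'
      rw [← e1] at e2
      subst e2
      rw [hb.unique hb' fun a ha B B' hB hB' => ?_]
      rw [e1] at ha
      obtain ⟨i, -, rfl⟩ := List.mem_map.1 ha
      have hVi := hh.walk.cocircuit i
      obtain ⟨f, hf, hVf, hB⟩ := hB
      obtain ⟨f', hf', hVf', hB'⟩ := hB'
      exact (ih hk'.le _ _ (h.descend hL hX hk' hVi hf hVf)).2.1 _
        (h'.descend hL hX hk' hVi hf' hVf')
        (h.induced_eq hL hχ hVi.1 hf hVf hf' hVf') B B' hB hB'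
    · intro ρ hρ
      obtain ⟨Y, Z, Ys, blocks, hYZ, ho, hd, hw, hb, rfl⟩ := (isLevelOrder_succ_iff hsub).1 hρ
      obtain ⟨T, V, m, hh⟩ := hYZ.symm.exists_halfCircle hL hX hk' h
      rw [hh.eq_of_head Ys hw hd] at hb
      obtain ⟨B, rfl, hB⟩ := hb.exists_map_range
      have hprop : ∀ i < m + 1, (B i).Nodup ∧ ∀ e, e ∈ B i ↔ e ∈ S ∧ V i e = 0 := by
        intro i hi
        obtain ⟨f, hf, hVf, hBi⟩ := hB i hi
        have := (ih hk'.le _ _ (h.descend hL hX hk' (hh.walk.cocircuit i) hf hVf)).2.2 _ hBi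
        simpa only [SV.mem_zeros] using this
      have hV0 : ∀ i, ∀ e ∈ S, X k e = 0 → V i e = 0 := fun i e he h0 => by
        obtain ⟨W, hW, hWV, hW0⟩ := mem_flagCircle.1 (hh.walk.cocircuit i).1
        rw [hWV, SV.restrict_apply_of_mem _ he, hW0 e he h0]
      -- Each non-loop is a zero of exactly one vertex of the half-walk. So the blocks without `F`
      -- are disjoint, and only the first one contributes `F`.
      have hmemf : ∀ i < m, ∀ e, (e ∈ (B (i + 1)).filter fun e => e ∉ (X k).zeros S) ↔
          e ∈ S ∧ V (i + 1) e = 0 ∧ X k e ≠ 0 := by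
        intro i hi e
        simp only [List.mem_filter, (hprop (i + 1) (by omega)).2, SV.mem_zeros, decide_eq_true_eq]
        tauto
      rw [concatBlocks_map_range]
      constructor
      · rw [List.nodup_append]
        refine ⟨(hprop 0 (by omega)).1, ?_, ?_⟩
        · rw [List.nodup_flatten]
          constructor
          · intro l hl
            obtain ⟨i, hi, rfl⟩ := List.mem_map.1 hl
            exact (hprop (i + 1) (by simpa using hi)).1.filter _
          · rw [List.pairwise_map]
            refine List.Pairwise.imp_of_mem ?_ List.pairwise_lt_range
            intro i j hi hj hij e hei hej
            rw [List.mem_range] at hi hj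
            rw [hmemf i hi] at hei
            rw [hmemf j hj] at hej
            exact hh.disjoint (i + 1) (j + 1) (by omega) (by omega) e ⟨hei.1, hei.2.2⟩ hei.2.1
              hej.2.1
        · intro a ha b hb hab
          subst hab
          obtain ⟨l, hl, hal⟩ := List.mem_flatten.1 hb
          obtain ⟨i, hi, rfl⟩ := List.mem_map.1 hl
          rw [List.mem_range] at hi
          rw [hmemf i hi] at hal
          exact hh.disjoint 0 (i + 1) (by omega) (by omega) a ⟨hal.1, hal.2.2⟩
            ((hprop 0 (by omega)).2 a |>.1 ha).2 hal.2.1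
      · intro e
        rw [List.mem_append, (hprop 0 (by omega)).2]
        constructor
        · rintro (h1 | h1)
          · exact h1.1
          · obtain ⟨l, hl, hal⟩ := List.mem_flatten.1 h1
            obtain ⟨i, hi, rfl⟩ := List.mem_map.1 hl
            exact ((hmemf i (by simpa using hi) e).1 hal).1
        · intro he
          by_cases h0 : V 0 e = 0
          · exact .inl ⟨he, h0⟩
          · right
            have hXe : X k e ≠ 0 := fun hc => h0 (hV0 0 e he hc)
            obtain ⟨i, hi, hVi⟩ := hh.cover e ⟨he, hXe⟩
            obtain ⟨j, rfl⟩ : ∃ j, i = j + 1 := ⟨i - 1, by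
              rcases Nat.eq_zero_or_pos i with rfl | h1
              · exact absurd hVi h0
              · omega⟩
            exact List.mem_flatten.2 ⟨_, List.mem_map.2 ⟨j, by simpa using hi, rfl⟩,
              (hmemf j (by omega) e).2 ⟨he, hVi, hXe⟩⟩

end FlagOrderTheorem

/-! ### Chains as positions, and the blocks met in a sweep. -/

section Sweep

variable {E : Type*}

/-- The covectors of a chain, indexed by the natural numbers. -/
def chainAt {d : ℕ} (τ : Fin (d + 2) → SV E) (i : ℕ) : SV E :=
  if h : i < d + 2 then τ ⟨i, h⟩ else 0

theorem chainAt_of_lt {d : ℕ} (τ : Fin (d + 2) → SV E) {i : ℕ} (h : i < d + 2) :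
    chainAt τ i = τ ⟨i, h⟩ := dif_pos h

theorem chainAt_val {d : ℕ} (τ : Fin (d + 2) → SV E) (i : Fin (d + 2)) :
    chainAt τ i = τ i := dif_pos i.2

namespace IsMaxCovChain

variable {L : Set (SV E)} {d : ℕ} {τ : Fin (d + 2) → SV E}

theorem chainAt_mem (hL : IsOrientedMatroid L) (h : IsMaxCovChain L τ) (i : ℕ) :
    chainAt τ i ∈ L := by
  unfold chainAt
  split_ifs
  · exact h.mem _
  · exact hL.zero_mem

theorem chainAt_lt (h : IsMaxCovChain L τ) {i j : ℕ} (hij : i < j) (hj : j ≤ d + 1) :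
    (chainAt τ j).Lt (chainAt τ i) := by
  rw [chainAt_of_lt τ (show i < d + 2 by omega), chainAt_of_lt τ (show j < d + 2 by omega)]
  exact h.lt _ _ hij

theorem chainAt_le (h : IsMaxCovChain L τ) {i j : ℕ} (hij : i ≤ j) (hj : j ≤ d + 1) :
    (chainAt τ j).Le (chainAt τ i) := by
  rcases hij.eq_or_lt with rfl | h'
  · exact SV.Le.refl _
  · exact (h.chainAt_lt h' hj).1

theorem chainAt_last (h : IsMaxCovChain L τ) : chainAt τ (d + 1) = 0 := by
  rw [chainAt_of_lt τ (show d + 1 < d + 2 by omega)]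
  exact h.last

theorem chainAt_constant [Finite E] (hL : IsOrientedMatroid L) (h : IsMaxCovChain L τ) {i : ℕ}
    (hi : i ≤ d) {W : SV E} (hW : W ∈ L) (h0 : ∀ e, chainAt τ i e = 0 → W e = 0) :
    (∀ e, chainAt τ (i + 1) e = 0 → W e = 0) ∨
    (∀ e, chainAt τ (i + 1) e = 0 → W e = chainAt τ i e) ∨
      ∀ e, chainAt τ (i + 1) e = 0 → W e = -chainAt τ i e := by
  rw [chainAt_of_lt τ (show i < d + 2 by omega)] at h0 ⊢
  rw [chainAt_of_lt τ (show i + 1 < d + 2 by omega)]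
  exact h.constant hL rfl hW h0

theorem chainAt_zero_ne_zero (hL : IsOrientedMatroid L) (hA : IsAcyclicOM L)
    (h : IsMaxCovChain L τ) (e : E) : chainAt τ 0 e ≠ 0 := by
  intro he
  have h0 : chainAt τ 0 = τ 0 := chainAt_val τ 0
  obtain ⟨i, hi⟩ := h.maximal _ (hL.comp_mem _ (h.mem 0) _ hA) fun i =>
    .inr ((h.le (Fin.zero_le i)).trans (SV.le_comp _ _))
  have h1 := (h.le (Fin.zero_le i)).antisymm (by rw [← hi]; exact SV.le_comp _ _)
  rw [h1] at hi
  have h2 := congrFun hi e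
  rw [h0] at he
  rw [SV.comp_apply_of_eq_zero _ he, he] at h2
  exact one_ne_zero h2

end IsMaxCovChain

/-- The chain `τ'` differs from `τ` exactly in its `i`-th covector. -/
structure IsSwitch (L : Set (SV E)) {d : ℕ} (i : ℕ) (τ τ' : Fin (d + 2) → SV E) : Prop where
  chain : IsMaxCovChain L τ'
  ne : chainAt τ' i ≠ chainAt τ i
  eq : ∀ j, j ≠ i → chainAt τ' j = chainAt τ j

/-- The position before the elements of the flat of the `(k + 1)`-st covector are swept. -/
structure IsSweepStart (L : Set (SV E)) (X : ℕ → SV E) {d : ℕ} (k : ℕ) (τ : Fin (d + 2) → SV E) :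
    Prop where
  chain : IsMaxCovChain L τ
  below : ∀ j < k, chainAt τ j = (chainAt τ (k + 1)).comp (X j)

/-- The position opposite to `τ`, as seen from its `(k + 1)`-st covector. -/
structure IsSweepEnd (L : Set (SV E)) (X : ℕ → SV E) {d : ℕ} (k : ℕ) (τ τ' : Fin (d + 2) → SV E) :
    Prop where
  chain : IsMaxCovChain L τ'
  opposite : chainAt τ' k = (chainAt τ (k + 1)).comp (-chainAt τ k)
  below : ∀ j < k, chainAt τ' j = (chainAt τ' k).comp (X j)
  above : ∀ j, k < j → chainAt τ' j = chainAt τ j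

/-- The position at the `i`-th vertex of the walk around a circle. -/
structure IsSweepState (L : Set (SV E)) (X : ℕ → SV E) {d : ℕ} (k : ℕ) (τ₀ : Fin (d + 2) → SV E)
    (T V : ℕ → SV E) (i : ℕ) (τ : Fin (d + 2) → SV E) : Prop where
  chain : IsMaxCovChain L τ
  vertex : chainAt τ (k + 1) = (chainAt τ₀ (k + 2)).comp (V i)
  edge : chainAt τ k = (chainAt τ₀ (k + 2)).comp (T i)
  below : ∀ j < k, chainAt τ j = (chainAt τ k).comp (X j)
  above : ∀ j, k + 2 ≤ j → chainAt τ j = chainAt τ₀ j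

/-- By constancy along the chain, the new tope is plus or minus the old one on the zeros of the
common facet. The plus sign would make the two topes equal. -/
theorem IsSwitch.isSweepEnd_zero [Finite E] {L : Set (SV E)} (hL : IsOrientedMatroid L)
    (hA : IsAcyclicOM L) {d : ℕ} {τ τ' : Fin (d + 2) → SV E} (hτ : IsMaxCovChain L τ)
    (h : IsSwitch L 0 τ τ') (X : ℕ → SV E) : IsSweepEnd L X 0 τ τ' := by
  refine ⟨h.chain, ?_, by simp, fun j hj => h.eq j (by omega)⟩
  have l1 := hτ.chainAt_lt (show 0 < 1 by omega) (by omega)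
  have l2 := h.chain.chainAt_lt (show 0 < 1 by omega) (by omega)
  rw [h.eq 1 (by omega)] at l2
  obtain ⟨e, he, -⟩ := l1.exists_ne_zero
  have hoff : ∀ e, chainAt τ 1 e ≠ 0 → chainAt τ' 0 e = chainAt τ 1 e ∧
      chainAt τ 0 e = chainAt τ 1 e := fun e he => ⟨(l2.1 e he).symm, (l1.1 e he).symm⟩
  rcases hτ.chainAt_constant hL (Nat.zero_le d) (h.chain.chainAt_mem hL 0)
    (fun e he => absurd he (hτ.chainAt_zero_ne_zero hL hA e)) with h1 | h1 | h1
  · exact absurd (h1 e he) (h.chain.chainAt_zero_ne_zero hL hA e)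
  · refine absurd (funext fun e => ?_) h.ne
    by_cases he : chainAt τ 1 e = 0
    · exact h1 e he
    · rw [(hoff e he).1, (hoff e he).2]
  · funext e
    by_cases he : chainAt τ 1 e = 0
    · rw [SV.comp_apply_of_eq_zero _ he]
      exact h1 e he
    · rw [SV.comp_apply_of_ne_zero _ he, (hoff e he).1]

/-- An element found by switching covectors downwards lies in the respective step of the chain. -/
theorem IsSwitch.zero_ne_zero [Finite E] {L : Set (SV E)} (hL : IsOrientedMatroid L)
    {d : ℕ} {τ τ' : Fin (d + 2) → SV E} (hτ : IsMaxCovChain L τ) {i : ℕ} (hi : i + 1 ≤ d)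
    (h : IsSwitch L (i + 1) τ τ') {g : E} (hg : chainAt τ' (i + 1) g = 0)
    (hg' : chainAt τ' i g ≠ 0) : chainAt τ (i + 2) g = 0 ∧ chainAt τ (i + 1) g ≠ 0 := by
  have e0 := h.eq i (by omega)
  have e2 := h.eq (i + 2) (by omega)
  have l1 := hτ.chainAt_lt (show i < i + 1 by omega) (by omega)
  have l2 := h.chain.chainAt_lt (show i < i + 1 by omega) (by omega)
  rw [e0] at l2 hg'
  constructor
  · rw [← e2]
    exact (h.chain.chainAt_lt (show i + 1 < i + 2 by omega) (by omega)).1.eq_zero hg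
  · intro hc
    apply h.ne
    -- If `g` were a zero of both covectors, constancy in each chain would give them the same zeros;
    -- lying below the same covector, they would coincide.
    have z1 : ∀ e, chainAt τ (i + 1) e = 0 → chainAt τ' (i + 1) e = 0 := by
      rcases hτ.chainAt_constant hL (by omega : i ≤ d) (h.chain.chainAt_mem hL (i + 1))
        (fun e he => l2.1.eq_zero he) with h1 | h1 | h1
      · exact h1
      · exact absurd ((h1 g hc).symm.trans hg) hg'
      · exact absurd ((h1 g hc).symm.trans hg) (SignType.neg_ne_zero_iff.2 hg')
    have z2 : ∀ e, chainAt τ' (i + 1) e = 0 → chainAt τ (i + 1) e = 0 := by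
      rcases h.chain.chainAt_constant hL (by omega : i ≤ d) (hτ.chainAt_mem hL (i + 1))
        (fun e he => l1.1.eq_zero (by rwa [e0] at he)) with h1 | h1 | h1
      · exact h1
      · exact absurd ((h1 g hg).symm.trans hc) (by rwa [e0])
      · exact absurd ((h1 g hg).symm.trans hc) (SignType.neg_ne_zero_iff.2 (by rwa [e0]))
    funext e
    by_cases he : chainAt τ (i + 1) e = 0
    · rw [he, z1 e he]
    · rw [l1.1 e he, l2.1 e (fun hc => he (z2 e hc))]

theorem IsHalfCircle.tope_apply [Finite E] {L : Set (SV E)} {D : Set E} (hC : IsCircle L D)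
    {T₀ A B : SV E} {T V : ℕ → SV E} {m : ℕ} (h : IsHalfCircle L D T₀ A B T V m) {i : ℕ} {g : E}
    (hg : ∀ j < i, V j g ≠ 0) : T i g = T₀ g := by
  induction i with
  | zero => rw [h.tope_zero]
  | succ i ih =>
    rw [h.walk.tope_succ hC, SV.comp_apply_of_ne_zero _ (hg i (by omega)),
      (h.walk.lt i).1 g (hg i (by omega)), ih fun j hj => hg j (by omega)]

variable [DecidableEq E]

theorem SV.comp_restrict_zeros [Fintype E] (c W : SV E) :
    c.comp (W.restrict (c.zeros Finset.univ)) = c.comp W := by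
  funext e
  by_cases he : c e = 0
  · rw [SV.comp_apply_of_eq_zero _ he, SV.comp_apply_of_eq_zero _ he,
      SV.restrict_apply_of_mem _ (SV.mem_zeros.2 ⟨Finset.mem_univ e, he⟩)]
  · rw [SV.comp_apply_of_ne_zero _ he, SV.comp_apply_of_ne_zero _ he]

variable {L : Set (SV E)} {d : ℕ} {X : ℕ → SV E} {k : ℕ} {S : Finset E}
  {χ : (Fin (k + 2) → E) → SignType}

/-- An order for `χ'` exists, and uniqueness across the two chirotopes identifies it with `ρ`. -/
theorem IsLevelOrder.congr [Finite E] (hL : IsOrientedMatroid L) (hnd : NoDuplicates L)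
    (hd : 1 ≤ d) (hX : IsPosFlag L d X) {k : ℕ} (hk : k ≤ d) {χ χ' : (Fin (k + 1) → E) → SignType}
    (h : IsLevel L X k S χ) (h' : IsLevel L X k S χ')
    (hχ : ∀ t, CovIndep L t → (∀ i, t i ∈ S) → χ t = χ' t) {ρ : List E}
    (hρ : IsLevelOrder L X k S χ ρ) : IsLevelOrder L X k S χ' ρ := by
  obtain ⟨ρ', hρ'⟩ := (isLevelOrder_existsUnique hL hnd hd hX k hk S χ' h').1
  rwa [(isLevelOrder_existsUnique hL hnd hd hX k hk S χ h).2.1 χ' h' hχ ρ ρ' hρ hρ']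

theorem List.map_range_sub_eq_reverse {α : Type*} (D : ℕ → α) (m : ℕ) :
    ((List.range m).map fun i => D (m - 1 - i)) = ((List.range m).map D).reverse := by
  apply List.ext_getElem
  · simp
  · intro i h1 h2
    simp

/-- The order without the flat of `A` is put together, in one of two ways, from the blocks met on
the way from `A` through the positive edge to the antipode of `A`. -/
theorem IsLevelOrder.decompose [Finite E] (hL : IsOrientedMatroid L) (hnd : NoDuplicates L)
    (hX : IsPosFlag L d X) (hk : k < d) (h : IsLevel L X (k + 1) S χ) {A B : SV E}
    (hAB : IsEdgePair L X k S A B) {T V : ℕ → SV E} {m : ℕ}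
    (hh : IsHalfCircle (flagCircle L X k S) (flagCircleSupport X k S) ((X k).restrict S) A B T V m)
    {f : E} (hf : f ∈ S) (hAf : A f = 0) (hXf : X k f ≠ 0) {ρ : List E}
    (hρ : IsLevelOrder L X (k + 1) S χ ρ) :
    ∃ (s : SignType) (D : ℕ → List E),
      (s = 1 ∧ IsOrientedAt X k S χ B A ∧
        ρ.filter (fun e => A e ≠ 0) = ((List.range m).map D).flatten ∨
      s = -1 ∧ IsOrientedAt X k S χ A B ∧
        ρ.filter (fun e => A e ≠ 0) = ((List.range m).map D).reverse.flatten) ∧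
      ∀ i < m, IsLevel L X k ((V i).zeros S) (fun x => s * χ (Fin.snoc x f)) ∧
        ∃ ρ', IsLevelOrder L X k ((V i).zeros S) (fun x => s * χ (Fin.snoc x f)) ρ' ∧
          D i = ρ'.filter fun e => X k e ≠ 0 := by
  have hC := h.isCircle hL hX hk
  have hsub := h.flag_subset hX hk
  -- The walk does not cross the zero `f` of `A` before `-A`, so `f` is positive at all earlier
  -- vertices. A single `f` thus induces the chirotopes of all blocks.
  have hVf : ∀ i < m, V i f = 1 := by
    intro i hi
    have hne : ∀ j < m, V j f ≠ 0 := fun j hj h0 =>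
      hh.disjoint j m hj le_rfl f ⟨hf, hXf⟩ h0 (by rw [hh.last, Pi.neg_apply, hAf]; rfl)
    rw [(hh.walk.lt i).1 f (hne i hi), hh.tope_apply hC fun j hj => hne j (by omega),
      SV.restrict_apply_of_mem _ hf, hX.nonneg k hk f hXf]
  have hflag0 : ∀ V, IsCocircuit (flagCircle L X k S) V → ∀ e ∈ S, X k e = 0 → V e = 0 := by
    intro V hV e he h0
    obtain ⟨W, hW, rfl, hW0⟩ := mem_flagCircle.1 hV.1
    rw [SV.restrict_apply_of_mem _ he, hW0 e he h0]
  have hblock : ∀ U, IsCocircuit (flagCircle L X k S) U → ∀ s : SignType, s ≠ 0 → U f = s →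
      IsLevel L X k (U.zeros S) (fun x => s * χ (Fin.snoc x f)) ∧ ∀ Bl, IsBlock L X k S χ U Bl →
      IsLevelOrder L X k (U.zeros S) (fun x => s * χ (Fin.snoc x f)) Bl ∧
        ∀ e ∈ Bl, e ∈ S ∧ U e = 0 := by
    rintro U hU s hs rfl
    have hfun : (fun x : Fin (k + 1) → E => U f * χ (Fin.snoc x f)) =
        fun x => χ (Fin.snoc x f) * U f := funext fun x => mul_comm _ _
    rw [hfun]
    have h1 := h.descend hL hX hk hU hf hs
    refine ⟨h1, ?_⟩
    rintro Bl ⟨f', hf', hUf', hBl⟩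
    have h2 := h.descend hL hX hk hU hf' hUf'
    have h3 := hBl.congr hL hnd (by omega) hX hk.le h2 h1
      (h.induced_eq hL (fun _ _ _ => rfl) hU.1 hf' hUf' hf hs)
    refine ⟨h3, fun e he => ?_⟩
    have := ((isLevelOrder_existsUnique hL hnd (by omega) hX k hk.le _ _ h1).2.2 _ h3).2 e
    exact SV.mem_zeros.1 (this.1 he)
  -- The vertex `A` vanishes on `F`. So the filter removes `F` everywhere, and it does not matter
  -- from which blocks `F` was already omitted.
  have hfilter : ∀ Bs : ℕ → List E, (∀ i ≤ m, ∀ e ∈ Bs i, e ∈ S) →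
      (concatBlocks ((X k).zeros S) ((List.range (m + 1)).map Bs)).filter (fun e => A e ≠ 0) =
      ((List.range (m + 1)).map fun i => (Bs i).filter fun e => A e ≠ 0).flatten := by
    intro Bs hBs
    rw [concatBlocks_map_range, List.filter_append, List.filter_flatten, List.map_map,
      List.range_succ_eq_map, List.map_cons, List.flatten_cons, List.map_map]
    congr 2
    apply List.map_congr_left
    intro i hi
    rw [List.mem_range] at hi
    simp only [Function.comp_apply]
    rw [List.filter_filter]
    apply List.filter_congr
    intro e he
    have heS := hBs (i + 1) (by omega) e he
    by_cases hA0 : A e = 0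
    · simp [hA0]
    · have : e ∉ (X k).zeros S := fun hc => hA0 (hflag0 A hAB.left e heS (SV.mem_zeros.1 hc).2)
      simp [hA0, this]
  have hAiff : ∀ i < m, ∀ e ∈ S, V i e = 0 → (A e ≠ 0 ↔ X k e ≠ 0) := by
    intro i hi e he hVe
    refine ⟨fun hA hX0 => hA (hflag0 A hAB.left e he hX0), fun hXe hA0 => ?_⟩
    exact hh.disjoint i m hi le_rfl e ⟨he, hXe⟩ hVe (by rw [hh.last, Pi.neg_apply, hA0]; rfl)
  obtain ⟨Y, Z, Ys, blocks, hYZ, ho, hhd, hw, hb, rfl⟩ := (isLevelOrder_succ_iff hsub).1 hρ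
  rcases hAB.eq_or_eq hL hX hk h hYZ with ⟨rfl, rfl⟩ | ⟨rfl, rfl⟩
  -- Here the walk starts at `A`, whose block is filtered out. The other vertices are the antipodes
  -- of the `V i` in reverse order, with `f` negative.
  · rw [hh.eq_of_head_reverse Ys hw hhd] at hb
    obtain ⟨Bl, rfl, hBl⟩ := hb.exists_map_range
    have hmem : ∀ i ≤ m, ∀ e ∈ Bl i, e ∈ S := by
      intro i hi e he
      obtain ⟨f', hf', hUf', hBl'⟩ := hBl i (by omega)
      have hU := hC.isCocircuit_neg (hh.walk.cocircuit (m - i))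
      have h2 := h.descend hL hX hk hU hf' hUf'
      exact SV.zeros_subset _ _
        (((isLevelOrder_existsUnique hL hnd (by omega) hX k hk.le _ _ h2).2.2 _ hBl').2 e |>.1 he)
    have h0 : (Bl 0).filter (fun e => Y e ≠ 0) = [] := by
      rw [List.filter_eq_nil_iff]
      intro e he
      obtain ⟨f', hf', hUf', hBl'⟩ := hBl 0 (by omega)
      have hU := hC.isCocircuit_neg (hh.walk.cocircuit (m - 0))
      have h2 := h.descend hL hX hk hU hf' hUf'
      have h3 := SV.mem_zeros.1
        (((isLevelOrder_existsUnique hL hnd (by omega) hX k hk.le _ _ h2).2.2 _ hBl').2 e |>.1 he)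
      rw [Nat.sub_zero, hh.last, neg_neg] at h3
      simp [h3.2]
    refine ⟨-1, fun i => (Bl (m - i)).filter fun e => X k e ≠ 0, .inr ⟨rfl, ho, ?_⟩, ?_⟩
    · rw [hfilter Bl hmem, List.range_succ_eq_map, List.map_cons, List.flatten_cons, h0,
        List.nil_append, List.map_map, ← List.map_range_sub_eq_reverse]
      congr 1
      apply List.map_congr_left
      intro i hi
      rw [List.mem_range] at hi
      simp only [Function.comp_apply]
      rw [show m - (m - 1 - i) = i + 1 by omega]
      apply List.filter_congr
      intro e he
      have h2 := (hblock _ (hC.isCocircuit_neg (hh.walk.cocircuit (m - (i + 1)))) (-1) (by decide)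
        (by rw [Pi.neg_apply, hVf _ (by omega)])).2 _ (hBl (i + 1) (by omega))
      have h3 := h2.2 e he
      simp only [hAiff (m - (i + 1)) (by omega) e h3.1
        (SignType.neg_eq_zero_iff.1 h3.2)]
    · intro i hi
      have h2 := hblock _ (hC.isCocircuit_neg (hh.walk.cocircuit i)) (-1) (by decide)
        (by rw [Pi.neg_apply, hVf _ hi])
      rw [SV.neg_zeros] at h2
      have h3 := hBl (m - i) (by omega)
      rw [show m - (m - i) = i by omega] at h3
      exact ⟨h2.1, _, (h2.2 _ h3).1, rfl⟩
  · rw [hh.eq_of_head Ys hw hhd] at hb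
    obtain ⟨Bl, rfl, hBl⟩ := hb.exists_map_range
    have hmem' : ∀ i ≤ m, ∀ e ∈ Bl i, e ∈ S ∧ V i e = 0 := by
      intro i hi e he
      obtain ⟨f', hf', hUf', hBl'⟩ := hBl i (by omega)
      have h2 := h.descend hL hX hk (hh.walk.cocircuit i) hf' hUf'
      exact SV.mem_zeros.1
        (((isLevelOrder_existsUnique hL hnd (by omega) hX k hk.le _ _ h2).2.2 _ hBl').2 e |>.1 he)
    have h0 : (Bl m).filter (fun e => Z e ≠ 0) = [] := by
      rw [List.filter_eq_nil_iff]
      intro e he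
      have h3 := (hmem' m le_rfl e he).2
      rw [hh.last, Pi.neg_apply, SignType.neg_eq_zero_iff] at h3
      simp [h3]
    refine ⟨1, fun i => (Bl i).filter fun e => X k e ≠ 0, .inl ⟨rfl, ho, ?_⟩, ?_⟩
    · rw [hfilter Bl fun i hi e he => (hmem' i hi e he).1, List.range_succ, List.map_append,
        List.flatten_append, List.map_singleton, h0, List.flatten_singleton, List.append_nil]
      congr 1
      apply List.map_congr_left
      intro i hi
      rw [List.mem_range] at hi
      apply List.filter_congr
      intro e he
      have h3 := hmem' i hi.le e he
      simp only [hAiff i hi e h3.1 h3.2]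
    · intro i hi
      have h2 := hblock _ (hh.walk.cocircuit i) 1 one_ne_zero (hVf i hi)
      exact ⟨h2.1, _, (h2.2 _ (hBl i (by omega))).1, rfl⟩

end Sweep

/-! ### A sweep as a walk around a circle. -/

section SweepGeometry

variable {E : Type*}

theorem IsPosFlag.le {L : Set (SV E)} {d : ℕ} {X : ℕ → SV E} (hX : IsPosFlag L d X) {i j : ℕ}
    (hij : i ≤ j) (hj : j < d) : (X j).Le (X i) := fun e he => by
  have h1 : X i e ≠ 0 := fun hc => he (hX.mono' hij hj hc)
  rw [hX.nonneg j hj e he, hX.nonneg i (by omega) e h1]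

variable {L : Set (SV E)} {d : ℕ} {X : ℕ → SV E} {k : ℕ} {S : Finset E}
  {χ : (Fin (k + 2) → E) → SignType} {τ₀ τ : Fin (d + 2) → SV E} {T V : ℕ → SV E} {m i : ℕ}

theorem IsSweepState.below_eq (hX : IsPosFlag L d X) (hk : k < d)
    (hs : IsSweepState L X k τ₀ T V i τ) (he : chainAt τ k = (chainAt τ (k + 1)).comp (X k))
    {j : ℕ} (hj : j ≤ k) : chainAt τ j = (chainAt τ (k + 1)).comp (X j) := by
  rcases hj.eq_or_lt with rfl | hj'
  · exact he
  · rw [hs.below j hj', he, SV.comp_assoc, (hX.le hj hk).comp_eq]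

theorem IsSweepState.zeros_eq [Fintype E] (hS : S = (chainAt τ₀ (k + 2)).zeros Finset.univ)
    (hs : IsSweepState L X k τ₀ T V i τ) :
    (chainAt τ (k + 1)).zeros Finset.univ = (V i).zeros S := by
  ext e
  rw [hs.vertex, hS]
  simp only [SV.mem_zeros, SV.comp_apply_eq_zero, Finset.mem_univ, true_and]

variable [DecidableEq E]

/-- The sign that orients the circle is found with any element outside the zero set of `A`. -/
theorem IsEdgePair.sign_of_oriented [Finite E] (hL : IsOrientedMatroid L) (hX : IsPosFlag L d X)
    (hk : k < d) (h : IsLevel L X (k + 1) S χ) {A B : SV E} (hAB : IsEdgePair L X k S A B)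
    {e : Fin k → E} (he : IsFlagTransversal X e) {f g : E} (hf : f ∈ S) (hAf : A f = 0)
    (hXf : X k f ≠ 0) (hg : g ∈ S) (hAg : A g ≠ 0) :
    (IsOrientedAt X k S χ A B → χ (Fin.snoc (Fin.snoc e f : Fin (k + 1) → E) g) = 1) ∧
      (IsOrientedAt X k S χ B A → χ (Fin.snoc (Fin.snoc e f : Fin (k + 1) → E) g) = -1) := by
  have ht : IsOrientingTuple X k S A e f g := ⟨he, hf, hAf, hXf, hg, hAg⟩
  constructor
  · rintro ⟨e', eA, eB, he', hA, hB, hs⟩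
    rw [← hs]
    exact h.orientation_eq hL hX hk hAB.left hAB.left_lt ht (hAB.orienting hL hX hk h he' hA hB)
  · rintro ⟨e', eB, eA, he', hB, hA, hs⟩
    rw [h.orientation_eq hL hX hk hAB.left hAB.left_lt ht (hAB.orienting hL hX hk h he' hA hB),
      h.swap_sign, hs]

theorem IsEdgePair.sign_eq_zero [Finite E] (hL : IsOrientedMatroid L) (hX : IsPosFlag L d X)
    (hk : k < d) (h : IsLevel L X (k + 1) S χ) {A B : SV E} (hAB : IsEdgePair L X k S A B)
    {e : Fin k → E} (he : IsFlagTransversal X e) {f g : E} (hf : f ∈ S) (hAf : A f = 0)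
    (hXf : X k f ≠ 0) (hg : g ∈ S) (hAg : A g = 0) :
    χ (Fin.snoc (Fin.snoc e f : Fin (k + 1) → E) g) = 0 := by
  obtain ⟨W, hW, hAW, hW0⟩ := mem_flagCircle.1 hAB.left.1
  have hXe : ∀ i, X k (e i) = 0 := fun i => hX.mono' (by omega) hk (he i).1
  have heS : ∀ i, e i ∈ S := fun i => h.subset k rfl _ (hXe i)
  have hWS : ∀ a ∈ S, W a = A a := fun a ha => by rw [hAW, SV.restrict_apply_of_mem _ ha]
  obtain ⟨s, -, hs⟩ := h.chirotope.vector _ (hX.indep_snoc hL hk he hXf) (fun i => by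
    refine Fin.lastCases ?_ (fun i => ?_) i
    · simpa using hf
    · simpa using heS i) W hW (fun i => by
    refine Fin.lastCases ?_ (fun i => ?_) i
    · simpa [hWS f hf] using hAf
    · simpa using hW0 _ (heS i) (hXe i)) (by
    obtain ⟨a, ha⟩ := Function.ne_iff.1 hAB.left.2.1
    have haS := ((h.isCircle hL hX hk).mem_of_ne_zero hAB.left.1 ha).1
    exact ⟨a, haS, by rwa [hWS a haS]⟩)
  rw [hs g hg, hWS g hg, hAg, mul_zero]

variable [Fintype E]

/-- The `(k + 1)`-st covector of a chain as a vertex of the circle. -/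
theorem IsMaxCovChain.vertex (hL : IsOrientedMatroid L) (hX : IsPosFlag L d X) (hk : k < d)
    {c : SV E} (hS : S = c.zeros Finset.univ) (h : IsLevel L X (k + 1) S χ)
    (hτ : IsMaxCovChain L τ) (hc : chainAt τ (k + 2) = c) {T : SV E}
    (hT : IsTope (flagCircle L X k S) T) (hTc : chainAt τ k = c.comp T) :
    IsCocircuit (flagCircle L X k S) ((chainAt τ (k + 1)).restrict S) ∧
      ((chainAt τ (k + 1)).restrict S).Lt T ∧
      chainAt τ (k + 1) = c.comp ((chainAt τ (k + 1)).restrict S) := by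
  have hC := h.isCircle hL hX hk
  have l1 := hτ.chainAt_lt (show k < k + 1 by omega) (by omega)
  have l2 := hτ.chainAt_lt (show k + 1 < k + 2 by omega) (by omega)
  rw [hc] at l2
  rw [hTc] at l1
  have hmem : ∀ {e}, e ∈ S ↔ c e = 0 := by
    intro e
    rw [hS, SV.mem_zeros]
    simp
  have hle : ((chainAt τ (k + 1)).restrict S).Le T := by
    intro e he
    have heS : e ∈ S := by
      by_contra hcon
      exact he (SV.restrict_apply_of_notMem _ hcon)
    rw [SV.restrict_apply_of_mem _ heS] at he ⊢
    rw [l1.1 e he, SV.comp_apply_of_eq_zero _ (hmem.1 heS)]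
  have hmemC : (chainAt τ (k + 1)).restrict S ∈ flagCircle L X k S := by
    refine mem_flagCircle.2 ⟨_, hτ.chainAt_mem hL _, rfl, fun e he h0 => ?_⟩
    rw [← SV.restrict_apply_of_mem (chainAt τ (k + 1)) he]
    exact hle.eq_zero (hC.supp T hT.1 e fun hD => hD.2 h0)
  have hne : (chainAt τ (k + 1)).restrict S ≠ 0 := by
    obtain ⟨e, h1, h2⟩ := l2.exists_ne_zero
    exact Function.ne_iff.2 ⟨e, by rwa [SV.restrict_apply_of_mem _ (hmem.2 h1)]⟩
  obtain ⟨g, hg, hg'⟩ := l1.exists_ne_zero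
  have hcg := l2.1.eq_zero hg
  rw [SV.comp_apply_of_eq_zero _ hcg] at hg'
  have hgD := hC.mem_of_ne_zero hT.1 hg'
  have hg0 : (chainAt τ (k + 1)).restrict S g = 0 := by rw [SV.restrict_apply_of_mem _ hgD.1, hg]
  refine ⟨hC.isCocircuit_of hmemC hne hgD hg0, hC.lt_of_le hgD hT hg0 hle, ?_⟩
  rw [hS, SV.comp_restrict_zeros, l2.1.comp_eq]

theorem IsSweepStart.edge (h : IsSweepStart L X (k + 1) τ₀)
    (hS : S = (chainAt τ₀ (k + 2)).zeros Finset.univ) :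
    chainAt τ₀ k = (chainAt τ₀ (k + 2)).comp ((X k).restrict S) := by
  rw [h.below k (by omega), hS, SV.comp_restrict_zeros]

theorem IsSweepStart.exists_halfCircle (hL : IsOrientedMatroid L) (hX : IsPosFlag L d X)
    (hk : k < d) (hst : IsSweepStart L X (k + 1) τ₀)
    (hS : S = (chainAt τ₀ (k + 2)).zeros Finset.univ) (h : IsLevel L X (k + 1) S χ) :
    ∃ B T V m, IsEdgePair L X k S ((chainAt τ₀ (k + 1)).restrict S) B ∧
      IsHalfCircle (flagCircle L X k S) (flagCircleSupport X k S) ((X k).restrict S)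
        ((chainAt τ₀ (k + 1)).restrict S) B T V m := by
  have hT := h.isTope hL hX hk
  obtain ⟨h1, h2, -⟩ := hst.chain.vertex hL hX hk hS h rfl hT (hst.edge hS)
  obtain ⟨B, hB, hBT, hne⟩ := (h.isCircle hL hX hk).exists_other_vertex h1 hT h2
  have hp : IsEdgePair L X k S ((chainAt τ₀ (k + 1)).restrict S) B := ⟨h1, h2, hB, hBT, hne.symm⟩
  obtain ⟨T, V, m, hh⟩ := hp.exists_halfCircle hL hX hk h
  exact ⟨B, T, V, m, hp, hh⟩

variable {B : SV E}

/-- The chain `τ₀` stands at a vertex of the positive edge; as the edge has only two vertices, the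
switch leads to `B`. -/
theorem IsSweepStart.state_zero (hL : IsOrientedMatroid L) (hX : IsPosFlag L d X)
    (hk : k < d) (hst : IsSweepStart L X (k + 1) τ₀)
    (hS : S = (chainAt τ₀ (k + 2)).zeros Finset.univ) (h : IsLevel L X (k + 1) S χ)
    (hp : IsEdgePair L X k S ((chainAt τ₀ (k + 1)).restrict S) B)
    (hh : IsHalfCircle (flagCircle L X k S) (flagCircleSupport X k S) ((X k).restrict S)
      ((chainAt τ₀ (k + 1)).restrict S) B T V m)
    (hs : IsSwitch L (k + 1) τ₀ τ) : IsSweepState L X k τ₀ T V 0 τ := by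
  have hT := h.isTope hL hX hk
  obtain ⟨g1, g2, g3⟩ := hst.chain.vertex hL hX hk hS h rfl hT (hst.edge hS)
  have hedge : chainAt τ k = (chainAt τ₀ (k + 2)).comp ((X k).restrict S) := by
    rw [hs.eq k (by omega), hst.edge hS]
  obtain ⟨h1, h2, h3⟩ := hs.chain.vertex hL hX hk hS h (hs.eq (k + 2) (by omega)) hT hedge
  refine ⟨hs.chain, ?_, by rw [hh.tope_zero, hedge], fun j hj => ?_, fun j hj =>
    hs.eq j (by omega)⟩
  · rcases (h.isCircle hL hX hk).eq_or_eq_of_lt hp.left hp.right h1 hp.left_lt hp.right_lt h2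
      hp.ne with h4 | h4
    · rw [h4, ← g3] at h3
      exact absurd h3 hs.ne
    · rw [h3, h4, hh.zero]
  · rw [hs.eq j (by omega), hs.eq k (by omega), hst.below j (by omega), hst.below k (by omega),
      SV.comp_assoc, (hX.le hj.le hk).comp_eq]

/-- The zeros of `V i` have not been crossed before, so `T i` has on them the signs of the first
edge. Hence the chain again has the form required for a sweep one level below. -/
theorem IsSweepState.edge_eq (hL : IsOrientedMatroid L) (hX : IsPosFlag L d X) (hk : k < d)
    (hS : S = (chainAt τ₀ (k + 2)).zeros Finset.univ) (h : IsLevel L X (k + 1) S χ) {A : SV E}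
    (hh : IsHalfCircle (flagCircle L X k S) (flagCircleSupport X k S) ((X k).restrict S) A B T V m)
    (hi : i ≤ m) (hs : IsSweepState L X k τ₀ T V i τ) :
    chainAt τ k = (chainAt τ (k + 1)).comp (X k) := by
  rw [hs.edge, hs.vertex, SV.comp_assoc]
  funext e
  by_cases hc : chainAt τ₀ (k + 2) e = 0
  · rw [SV.comp_apply_of_eq_zero _ hc, SV.comp_apply_of_eq_zero _ hc]
    have heS : e ∈ S := by rw [hS, SV.mem_zeros]; simp [hc]
    by_cases hV : V i e = 0
    · rw [SV.comp_apply_of_eq_zero _ hV]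
      by_cases h0 : X k e = 0
      · rw [h0]
        exact (h.isCircle hL hX hk).supp _ (hh.walk.tope i).1 e fun hD => hD.2 h0
      · rw [hh.pos i hi e ⟨heS, h0⟩ hV, SV.restrict_apply_of_mem _ heS]
    · rw [SV.comp_apply_of_ne_zero _ hV, (hh.walk.lt i).1 e hV]
  · rw [SV.comp_apply_of_ne_zero _ hc, SV.comp_apply_of_ne_zero _ hc]

theorem IsSweepState.edge_eq_zero_iff (hL : IsOrientedMatroid L) (hX : IsPosFlag L d X)
    (hk : k < d) (hS : S = (chainAt τ₀ (k + 2)).zeros Finset.univ)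
    (h : IsLevel L X (k + 1) S χ) {A : SV E}
    (hh : IsHalfCircle (flagCircle L X k S) (flagCircleSupport X k S) ((X k).restrict S) A B T V m)
    (hs : IsSweepState L X k τ₀ T V i τ) {e : E} (he : e ∈ S) :
    chainAt τ k e = 0 ↔ X k e = 0 := by
  have hc : chainAt τ₀ (k + 2) e = 0 := by
    rw [hS, SV.mem_zeros] at he
    exact he.2
  have hC := h.isCircle hL hX hk
  rw [hs.edge, SV.comp_apply_of_eq_zero _ hc]
  constructor
  · intro h0
    by_contra hne
    exact (hC.isTope_iff.1 (hh.walk.tope i)).2 e ⟨he, hne⟩ h0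
  · intro h0
    exact hC.supp _ (hh.walk.tope i).1 e fun hD => hD.2 h0

/-- The sweep at `V i` reverses the edge on the zeros of `V i`, that is, it crosses the vertex. The
switch then passes to the other end of the new edge. -/
theorem IsSweepState.succ (hL : IsOrientedMatroid L) (hX : IsPosFlag L d X) (hk : k < d)
    (hS : S = (chainAt τ₀ (k + 2)).zeros Finset.univ) (h : IsLevel L X (k + 1) S χ) {A : SV E}
    (hh : IsHalfCircle (flagCircle L X k S) (flagCircleSupport X k S) ((X k).restrict S) A B T V m)
    (hs : IsSweepState L X k τ₀ T V i τ) {τ' τ'' : Fin (d + 2) → SV E}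
    (he : IsSweepEnd L X k τ τ') (hsw : IsSwitch L (k + 1) τ' τ'') :
    IsSweepState L X k τ₀ T V (i + 1) τ'' := by
  have hC := h.isCircle hL hX hk
  have hedge : chainAt τ'' k = (chainAt τ₀ (k + 2)).comp (T (i + 1)) := by
    rw [hsw.eq k (by omega), he.opposite, hs.vertex, hs.edge, hh.walk.tope_succ hC, SV.comp_assoc]
    funext e
    by_cases hc : chainAt τ₀ (k + 2) e = 0
    · rw [SV.comp_apply_of_eq_zero _ hc, SV.comp_apply_of_eq_zero _ hc]
      by_cases hV : V i e = 0
      · rw [SV.comp_apply_of_eq_zero _ hV, SV.comp_apply_of_eq_zero _ hV, Pi.neg_apply,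
          Pi.neg_apply, SV.comp_apply_of_eq_zero _ hc]
      · rw [SV.comp_apply_of_ne_zero _ hV, SV.comp_apply_of_ne_zero _ hV]
    · rw [SV.comp_apply_of_ne_zero _ hc, SV.comp_apply_of_ne_zero _ hc]
  have hab : ∀ j, k + 2 ≤ j → chainAt τ'' j = chainAt τ₀ j := fun j hj => by
    rw [hsw.eq j (by omega), he.above j (by omega), hs.above j hj]
  obtain ⟨h1, h2, h3⟩ := hsw.chain.vertex hL hX hk hS h (hab (k + 2) le_rfl)
    (hh.walk.tope (i + 1)) hedge
  refine ⟨hsw.chain, ?_, hedge, fun j hj => ?_, hab⟩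
  · rcases hC.eq_or_eq_of_lt (hh.walk.cocircuit i) (hh.walk.cocircuit (i + 1)) h1
      (hh.walk.lt_succ i) (hh.walk.lt (i + 1)) h2 (hh.walk.vertex_ne i).symm with h4 | h4
    · rw [h4, ← hs.vertex, ← he.above (k + 1) (by omega)] at h3
      exact absurd h3 hsw.ne
    · rw [h3, h4]
  · rw [hsw.eq j (by omega), hsw.eq k (by omega), he.below j hj]

theorem IsSweepState.isSweepEnd (hL : IsOrientedMatroid L) (hX : IsPosFlag L d X) (hk : k < d)
    (hS : S = (chainAt τ₀ (k + 2)).zeros Finset.univ) (h : IsLevel L X (k + 1) S χ)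
    (hh : IsHalfCircle (flagCircle L X k S) (flagCircleSupport X k S) ((X k).restrict S)
      ((chainAt τ₀ (k + 1)).restrict S) B T V m)
    (hs : IsSweepState L X k τ₀ T V m τ) : IsSweepEnd L X (k + 1) τ₀ τ := by
  have he := hs.edge_eq hL hX hk hS h hh le_rfl
  refine ⟨hs.chain, ?_, fun j hj => hs.below_eq hX hk he (by omega), fun j hj =>
    hs.above j (by omega)⟩
  rw [hs.vertex, hh.last, ← SV.restrict_neg, hS, SV.comp_restrict_zeros]

end SweepGeometry

/-! ### Running times and linked lists. -/

section Machine

/-- Started in `s`, the program `p` halts after at most `t` steps in a state that satisfies `Q`. -/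
def Runs {r n : ℕ} (χ : (Fin r → Fin n) → SignType) (inp : ℕ → ℕ) (p : Prog r) (s : MState)
    (t : ℕ) (Q : MState → Prop) : Prop :=
  ∃ t' s', t' ≤ t ∧ Exec χ inp p s t' s' ∧ Q s'

section

variable {r n : ℕ} {χ : (Fin r → Fin n) → SignType} {inp : ℕ → ℕ} {p q : Prog r} {s : MState}
  {t t₁ t₂ : ℕ} {Q R : MState → Prop}

theorem Runs.instr {a : Instr r} (h : Q (a.apply χ inp s)) : Runs χ inp (.instr a) s 1 Q :=
  ⟨1, _, le_rfl, .instr a s, h⟩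

theorem Runs.seq (h₁ : Runs χ inp p s t₁ R) (h₂ : ∀ s', R s' → Runs χ inp q s' t₂ Q) :
    Runs χ inp (.seq p q) s (t₁ + t₂) Q := by
  obtain ⟨u₁, s₁, hu₁, he₁, hR⟩ := h₁
  obtain ⟨u₂, s₂, hu₂, he₂, hQ⟩ := h₂ s₁ hR
  exact ⟨u₁ + u₂, s₂, by omega, .seq he₁ he₂, hQ⟩

theorem Runs.mono {t' : ℕ} (h : Runs χ inp p s t R) (ht : t ≤ t') (hQ : ∀ s', R s' → Q s') :
    Runs χ inp p s t' Q := by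
  obtain ⟨u, s', hu, he, hR⟩ := h
  exact ⟨u, s', hu.trans ht, he, hQ s' hR⟩

theorem Runs.ite {b : Test} (h₁ : b.Holds s → Runs χ inp p s t Q)
    (h₂ : ¬ b.Holds s → Runs χ inp q s t Q) : Runs χ inp (.ite b p q) s (t + 1) Q := by
  by_cases hb : b.Holds s
  · obtain ⟨u, s', hu, he, hQ⟩ := h₁ hb
    exact ⟨u + 1, s', by omega, .ite_true hb he, hQ⟩
  · obtain ⟨u, s', hu, he, hQ⟩ := h₂ hb
    exact ⟨u + 1, s', by omega, .ite_false hb he, hQ⟩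

theorem Runs.loop_end {b : Test} (hb : ¬ b.Holds s) (hQ : Q s) :
    Runs χ inp (.loop b p) s 1 Q :=
  ⟨1, s, le_rfl, Exec.loop_stop hb, hQ⟩

theorem Runs.loop_step {b : Test} (hb : b.Holds s) (h₁ : Runs χ inp p s t₁ R)
    (h₂ : ∀ s', R s' → Runs χ inp (.loop b p) s' t₂ Q) :
    Runs χ inp (.loop b p) s (t₁ + t₂ + 1) Q := by
  obtain ⟨u₁, s₁, hu₁, he₁, hR⟩ := h₁
  obtain ⟨u₂, s₂, hu₂, he₂, hQ⟩ := h₂ s₁ hR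
  exact ⟨u₁ + u₂ + 1, s₂, by omega, .loop_step hb he₁ he₂, hQ⟩

theorem MState.setReg_reg (s : MState) (x v y : ℕ) :
    (s.setReg x v).reg y = if y = x then v else s.reg y := by
  simp [MState.setReg, Function.update_apply]

@[simp]
theorem MState.setReg_mem (s : MState) (x v : ℕ) : (s.setReg x v).mem = s.mem := rfl

theorem MState.setReg_setReg (s : MState) (x v w : ℕ) :
    (s.setReg x v).setReg x w = s.setReg x w := by
  simp [MState.setReg]

/-- Add a constant to a register. -/
def Prog.addConst (r x : ℕ) : ℕ → Prog r
  | 0 => .instr (.copy x x)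
  | i + 1 => .seq (.instr (.succ x x)) (Prog.addConst r x i)

theorem Runs.addConst (x i : ℕ) :
    Runs χ inp (Prog.addConst r x i) s (i + 1) fun s' => s' = s.setReg x (s.reg x + i) := by
  induction i generalizing s with
  | zero => exact Runs.instr rfl
  | succ i ih =>
    refine ((Runs.instr (Q := fun s' => s' = s.setReg x (s.reg x + 1)) rfl).seq
      (t₂ := i + 1) ?_).mono (by omega) fun s' h => h
    rintro _ rfl
    refine ih.mono le_rfl ?_
    rintro _ rfl
    rw [MState.setReg_setReg, MState.setReg_reg, if_pos rfl, Nat.add_assoc, Nat.add_comm 1 i]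

/-- Replace the address in a register by the input cell that is `i` cells further on. -/
def Prog.fetch (r x i : ℕ) : Prog r :=
  .seq (Prog.addConst r x i) (.instr (.input x x))

theorem Runs.fetch (x i : ℕ) :
    Runs χ inp (Prog.fetch r x i) s (i + 2) fun s' => s' = s.setReg x (inp (s.reg x + i)) := by
  refine (Runs.addConst x i).seq (t₂ := 1) ?_
  rintro _ rfl
  refine Runs.instr ?_
  simp only [Instr.apply]
  rw [MState.setReg_setReg, MState.setReg_reg, if_pos rfl]

end

section Segments

variable {n : ℕ} {mem mem' : ℕ → ℕ} {l l' : List (Fin n)} {h t h' t' : ℕ}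

/-- The memory holds the list `l` as a linked list from `h` to `t`; the empty list has `h = n`. -/
def IsSegment (mem : ℕ → ℕ) (l : List (Fin n)) (h t : ℕ) : Prop :=
  (l = [] ∧ h = n) ∨ ∃ a b : Fin n, l.head? = some a ∧ l.getLast? = some b ∧ h = a ∧ t = b ∧
    l.IsChain fun x y : Fin n => mem x = (y : ℕ)

theorem IsSegment.congr (hl : IsSegment mem l h t) (hm : ∀ x ∈ l, mem' x = mem x) :
    IsSegment mem' l h t := by
  rcases hl with hl | ⟨a, b, h1, h2, h3, h4, h5⟩
  · exact .inl hl
  · refine .inr ⟨a, b, h1, h2, h3, h4, ?_⟩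
    exact List.IsChain.imp_of_mem_imp (fun x y hx _ hxy => (hm x hx).trans hxy) h5

theorem IsSegment.head_lt (hl : IsSegment mem l h t) (h0 : l ≠ []) : h < n := by
  rcases hl with hl | ⟨a, b, h1, h2, rfl, h4, h5⟩
  · exact absurd hl.1 h0
  · exact a.2

/-- Without repetitions the last entry is the source of no link, so its pointer may be overwritten.
-/
theorem List.IsChain.of_eq_off_last {α : Type*} {R R' : α → α → Prop} {l : List α} {b : α}
    (h : l.IsChain R) (hb : l.getLast? = some b) (hnd : l.Nodup)
    (hR : ∀ x y, x ≠ b → R x y → R' x y) : l.IsChain R' := by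
  induction l with
  | nil => exact .nil
  | cons a l ih =>
    cases l with
    | nil => exact .singleton a
    | cons c l =>
      rw [List.isChain_cons_cons] at h ⊢
      rw [List.getLast?_cons_cons] at hb
      refine ⟨hR a c ?_ h.1, ih h.2 hb (List.nodup_cons.1 hnd).2⟩
      rintro rfl
      exact (List.nodup_cons.1 hnd).1 (List.mem_of_getLast? hb)

theorem IsSegment.append (hl : IsSegment mem l h t) (hl' : IsSegment mem l' h' t')
    (h0 : l ≠ []) (h0' : l' ≠ []) (hnd : (l ++ l').Nodup) :
    IsSegment (Function.update mem t h') (l ++ l') h t' := by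
  rcases hl with hl | ⟨a, b, h1, h2, rfl, rfl, h5⟩
  · exact absurd hl.1 h0
  rcases hl' with hl' | ⟨a', b', h1', h2', rfl, rfl, h5'⟩
  · exact absurd hl'.1 h0'
  have hnd' := List.nodup_append.1 hnd
  refine .inr ⟨a, b', by rw [List.head?_append, h1]; rfl, by rw [List.getLast?_append, h2']; rfl,
    rfl, rfl, ?_⟩
  rw [List.isChain_append]
  refine ⟨h5.of_eq_off_last h2 hnd'.1 fun x y hx hxy => ?_, ?_, ?_⟩
  · rw [Function.update_of_ne (fun hc => hx (Fin.ext hc))]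
    exact hxy
  · refine List.IsChain.imp_of_mem_imp (fun x y hx _ hxy => ?_) h5'
    rw [Function.update_of_ne]
    · exact hxy
    · intro hc
      exact hnd'.2.2 b (List.mem_of_getLast? h2) x hx (Fin.ext hc.symm)
  · intro x hx y hy
    rw [h2] at hx
    rw [h1'] at hy
    simp only [Option.mem_def, Option.some.injEq] at hx hy
    subst hx hy
    simp

theorem IsSegment.singleton (mem : ℕ → ℕ) (a : Fin n) : IsSegment mem [a] a a :=
  .inr ⟨a, a, rfl, rfl, rfl, rfl, .singleton a⟩

theorem IsSegment.tail_eq (hl : IsSegment mem l h t) (h0 : l ≠ []) : ∃ b ∈ l, t = (b : ℕ) := by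
  rcases hl with hl | ⟨a, b, h1, h2, rfl, rfl, h5⟩
  · exact absurd hl.1 h0
  · exact ⟨b, List.mem_of_getLast? h2, rfl⟩

end Segments

end Machine

/-! ### The sweep program. -/

section SweepProgram

theorem oracle_eq {r n : ℕ} (χ : (Fin r → Fin n) → SignType) {v : Fin r → ℕ} {t : Fin r → Fin n}
    (h : ∀ i, v i = t i) : oracle χ v = signCode (χ t) := by
  have h' : ∀ i, v i < n := fun i => h i ▸ (t i).2
  rw [oracle, dif_pos h']
  congr 2
  funext i
  exact Fin.ext (h i)

theorem signCode_eq_zero_iff {s : SignType} : signCode s = 0 ↔ s = 0 := by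
  revert s; decide

theorem signCode_injective {s t : SignType} (h : signCode s = signCode t) : s = t := by
  revert s t; decide

/-- The tuple that starts with `x` and goes on with the values of `r`. -/
def extendTuple {E : Type*} (d : ℕ) {m : ℕ} (x : Fin m → E) (r : ℕ → E) : Fin (d + 1) → E :=
  fun i => if h : (i : ℕ) < m then x ⟨i, h⟩ else r i

/-- The tuple `r 1, …, r (k + 1), g, r (k + 2), …, r d`. -/
def probeTuple {E : Type*} (d k : ℕ) (r : ℕ → E) (g : E) : Fin (d + 1) → E :=
  fun i => if (i : ℕ) < k + 1 then r (i + 1) else if (i : ℕ) = k + 1 then g else r i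

theorem extendTuple_snoc {E : Type*} (d : ℕ) {m : ℕ} (x : Fin m → E) (r : ℕ → E) :
    extendTuple d (Fin.snoc x (r m) : Fin (m + 1) → E) r = extendTuple d x r := by
  funext i
  unfold extendTuple
  by_cases h : (i : ℕ) < m
  · rw [dif_pos h, dif_pos (by omega)]
    exact Fin.snoc_castSucc (α := fun _ => E) (x := r m) (p := x) (i := ⟨i, h⟩)
  · rw [dif_neg h]
    by_cases h' : (i : ℕ) = m
    · rw [dif_pos (by omega)]
      have : (⟨i, by omega⟩ : Fin (m + 1)) = Fin.last m := Fin.ext h'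
      rw [this, Fin.snoc_last, h']
    · rw [dif_neg (by omega)]

theorem extendTuple_snoc_snoc {E : Type*} (d k : ℕ) (r : ℕ → E) (g : E) :
    extendTuple d (Fin.snoc (Fin.snoc (fun i : Fin k => r (i + 1)) (r (k + 1)) : Fin (k + 1) → E) g
      : Fin (k + 2) → E) r = probeTuple d k r g := by
  funext i
  unfold extendTuple probeTuple
  by_cases h : (i : ℕ) < k + 1
  · rw [dif_pos (by omega), if_pos h]
    have e1 : (⟨i, by omega⟩ : Fin (k + 2)) = Fin.castSucc ⟨i, h⟩ := rfl
    rw [e1, Fin.snoc_castSucc]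
    by_cases h' : (i : ℕ) < k
    · exact Fin.snoc_castSucc (α := fun _ => E) (x := r (k + 1))
        (p := fun i : Fin k => r (i + 1)) (i := ⟨i, h'⟩)
    · have h2 : (i : ℕ) = k := by omega
      have e2 : (⟨i, h⟩ : Fin (k + 1)) = Fin.last k := Fin.ext h2
      rw [e2, Fin.snoc_last, h2]
  · rw [if_neg h]
    by_cases h' : (i : ℕ) = k + 1
    · rw [dif_pos (by omega), if_pos h']
      have e1 : (⟨i, by omega⟩ : Fin (k + 2)) = Fin.last (k + 1) := Fin.ext h'
      rw [e1, Fin.snoc_last]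
    · rw [dif_neg (by omega), if_neg h']

/-- Put the label of an element of the `i`-th step of the chain with address in register `x`
there. -/
def Prog.label (d x : ℕ) : ℕ → Prog (d + 1)
  | 0 => .fetch (d + 1) x (d + 1)
  | i + 1 => .seq (.fetch (d + 1) x (i + 1)) (Prog.label d x i)

def labelCost (d : ℕ) : ℕ → ℕ
  | 0 => d + 3
  | i + 1 => (i + 3) + labelCost d i

/-- The registers of the tuple that is queried on level `k + 1`. -/
def probeRegs (d k : ℕ) : Fin (d + 1) → ℕ :=
  -- Register 1 holds the address of the current chain, 3 the element just found, 4 the answer of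
  -- the last query, and `10 + 4 * j` the element `r j`. Level `k` has the head and tail of its list
  -- in `11 + 4 * k` and `12 + 4 * k`, and its sign in `13 + 4 * k`.
  fun i => if (i : ℕ) < k + 1 then 10 + 4 * (i + 1) else if (i : ℕ) = k + 1 then 3 else 10 + 4 * i

/-- Find an element of the `k`-th step of the current chain and query the orientation. -/
def Prog.probe (d k : ℕ) : Prog (d + 1) :=
  .seq (.instr (.copy 3 1)) (.seq (.label d 3 k) (.instr (.orient 4 (probeRegs d k))))

/-- Join the list of level `k` to the list of level `k + 1`. -/
def Prog.join (d k : ℕ) : Prog (d + 1) :=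
  .ite (.eq (11 + 4 * (k + 1)) 0)
    (.seq (.instr (.copy (11 + 4 * (k + 1)) (11 + 4 * k)))
      (.instr (.copy (12 + 4 * (k + 1)) (12 + 4 * k))))
    -- The signs of the two levels agree exactly when blocks are to be appended.
    (.ite (.eq (13 + 4 * k) (13 + 4 * (k + 1)))
      (.seq (.instr (.store (12 + 4 * (k + 1)) (11 + 4 * k)))
        (.instr (.copy (12 + 4 * (k + 1)) (12 + 4 * k))))
      (.seq (.instr (.store (12 + 4 * k) (11 + 4 * (k + 1))))
        (.instr (.copy (11 + 4 * (k + 1)) (11 + 4 * k)))))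

/-- Pass to the other vertex of the current edge of a circle, and query the orientation there. -/
def Prog.advance (d k : ℕ) : Prog (d + 1) :=
  .seq (.fetch (d + 1) 1 (k + 1)) (.probe d k)

/-- List the elements of the `k`-th step of the current chain and move to the opposite chain. -/
def Prog.sweep (d : ℕ) : ℕ → Prog (d + 1)
  | 0 => .seq (.instr (.copy 11 1)) (.seq (.label d 11 0)
      (.seq (.instr (.copy 12 11)) (.fetch (d + 1) 1 0)))
  -- The head `n` codes the empty list. The loop runs while the query is nonzero, register 5 being
  -- `0`, and level `k` gets the sign opposite to the query.
  | k + 1 => .seq (.instr (.copy (11 + 4 * (k + 1)) 0)) (.seq (.advance d k) (.loop (.lt 5 4)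
      (.seq (.ite (.eq 4 6) (.instr (.const (13 + 4 * k) 2)) (.instr (.const (13 + 4 * k) 1)))
        (.seq (Prog.sweep d k) (.seq (.join d k) (.advance d k))))))

def probeCost (d k : ℕ) : ℕ := 1 + (labelCost d k + 1)

/-- The cost per listed element. The first added term pays for one round of the loop, the second for
the work outside the loop. -/
def sweepCost (d : ℕ) : ℕ → ℕ
  | 0 => d + 8
  | k + 1 => sweepCost d k + (10 + k + probeCost d k) + (k + 5 + probeCost d k)

/-- An arrangement in memory, together with a flag. -/
structure IsStoredFlag {n d : ℕ} (L : Set (SV (Fin n))) (X : ℕ → SV (Fin n)) (inp : ℕ → ℕ)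
    (addr : (Fin (d + 2) → SV (Fin n)) → ℕ) : Prop where
  om : IsOrientedMatroid L
  acyclic : IsAcyclicOM L
  noDuplicates : NoDuplicates L
  one_le : 1 ≤ d
  flag : IsPosFlag L d X
  stores : StoresArrangement d L inp addr

/-- The registers that hold `n`, the constants `0` and `1`, and the elements `r 1, …, r d`. -/
structure HoldsElements {n : ℕ} (d : ℕ) (r : ℕ → Fin n) (s : MState) : Prop where
  size : s.reg 0 = n
  zero : s.reg 5 = 0
  one : s.reg 6 = 1
  elements : ∀ j, 1 ≤ j → j ≤ d → s.reg (10 + 4 * j) = r j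

theorem HoldsElements.congr {n d : ℕ} {r : ℕ → Fin n} {s s' : MState} (h : HoldsElements d r s)
    (hs : ∀ y, (y = 0 ∨ y = 5 ∨ y = 6 ∨ (10 ≤ y ∧ y % 4 = 2)) → s'.reg y = s.reg y) :
    HoldsElements d r s' where
  size := (hs 0 (by omega)).trans h.size
  zero := (hs 5 (by omega)).trans h.zero
  one := (hs 6 (by omega)).trans h.one
  elements j h1 h2 := (hs _ (by omega)).trans (h.elements j h1 h2)

/-- The induced chirotope on a flat of rank `k + 1`. -/
def signedInduced {n d : ℕ} (χ : (Fin (d + 1) → Fin n) → SignType) (σ : SignType) (r : ℕ → Fin n)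
    (k : ℕ) : (Fin (k + 1) → Fin n) → SignType :=
  fun x => σ * χ (extendTuple d x r)

/-- The states from which the flat of the `(k + 1)`-st covector can be swept. -/
structure IsSweepInput {n d : ℕ} (L : Set (SV (Fin n))) (X : ℕ → SV (Fin n))
    (χ : (Fin (d + 1) → Fin n) → SignType) (addr : (Fin (d + 2) → SV (Fin n)) → ℕ) (k : ℕ)
    (τ : Fin (d + 2) → SV (Fin n)) (σ : SignType) (r : ℕ → Fin n) (ρ : List (Fin n))
    (s : MState) : Prop where
  start : IsSweepStart L X k τ
  addr_eq : s.reg 1 = addr τ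
  holds : HoldsElements d r s
  sign : s.reg (13 + 4 * k) = signCode σ
  sign_ne : σ ≠ 0
  flag : ∀ i, i + 1 < k → X (i + 1) (r (i + 1)) = 0 ∧ X i (r (i + 1)) ≠ 0
  -- The element `r k` is a zero of the vertex `A` outside the flag. The entries `r j` with `j > k`
  -- only serve to define the induced chirotope.
  top : ∀ i, i + 1 = k → chainAt τ k (r k) = 0 ∧ X i (r k) ≠ 0
  level : IsLevel L X k ((chainAt τ (k + 1)).zeros Finset.univ) (signedInduced χ σ r k)
  order : IsLevelOrder L X k ((chainAt τ (k + 1)).zeros Finset.univ) (signedInduced χ σ r k) ρ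

/-- The result of a sweep. -/
def IsSweepOutput {n d : ℕ} (L : Set (SV (Fin n))) (X : ℕ → SV (Fin n))
    (addr : (Fin (d + 2) → SV (Fin n)) → ℕ) (k : ℕ) (τ : Fin (d + 2) → SV (Fin n))
    (l : List (Fin n)) (s s' : MState) : Prop :=
  (∃ τ', IsSweepEnd L X k τ τ' ∧ s'.reg 1 = addr τ') ∧
    IsSegment s'.mem l (s'.reg (11 + 4 * k)) (s'.reg (12 + 4 * k)) ∧
    (∀ x : ℕ, (∀ e ∈ l, x ≠ (e : ℕ)) → s'.mem x = s.mem x) ∧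
    -- A sweep preserves `n`, the constants and saved data, the elements `r j`, and everything from
    -- the sign of level `k` upwards.
    ∀ y, (y = 0 ∨ (5 ≤ y ∧ y < 10) ∨ (10 ≤ y ∧ y % 4 = 2) ∨ 13 + 4 * k ≤ y) → s'.reg y = s.reg y

variable {n d : ℕ} {L : Set (SV (Fin n))} {X : ℕ → SV (Fin n)}
  {χ : (Fin (d + 1) → Fin n) → SignType} {inp : ℕ → ℕ}
  {addr : (Fin (d + 2) → SV (Fin n)) → ℕ}

theorem StoresArrangement.exists_switch (h : StoresArrangement d L inp addr)
    {τ : Fin (d + 2) → SV (Fin n)} (hτ : IsMaxCovChain L τ) {i : ℕ} (hi : i ≤ d) :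
    ∃ τ', IsSwitch L i τ τ' ∧ inp (addr τ + i) = addr τ' := by
  obtain ⟨τ', h1, h2, h3, h4⟩ := h.switch τ hτ ⟨i, by omega⟩
  refine ⟨τ', ⟨h1, ?_, fun j hj => ?_⟩, h4⟩
  · rw [chainAt_of_lt _ (show i < d + 2 by omega), chainAt_of_lt _ (show i < d + 2 by omega)]
    exact h2
  · unfold chainAt
    split_ifs with hj'
    · refine h3 ⟨j, hj'⟩ fun hc => hj ?_
      simpa using congrArg Fin.val hc
    · rfl

/-- Labels are stored only for step 0. After a switch of the covector `i + 1`, any element of the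
`i`-th step of the new chain lies in step `i + 1` of the old one (`IsSwitch.zero_ne_zero`), so the
search descends to step 0. -/
theorem Runs.label (hf : IsStoredFlag L X inp addr) (x i : ℕ) (hi : i ≤ d)
    {τ : Fin (d + 2) → SV (Fin n)} (hτ : IsMaxCovChain L τ) {s : MState}
    (hs : s.reg x = addr τ) :
    Runs χ inp (Prog.label d x i) s (labelCost d i) fun s' => ∃ g : Fin n,
      s' = s.setReg x g ∧ chainAt τ (i + 1) g = 0 ∧ chainAt τ i g ≠ 0 := by
  induction i generalizing τ s with
  | zero =>
    refine (Runs.fetch x (d + 1)).mono le_rfl ?_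
    rintro _ rfl
    obtain ⟨g, hg, hg'⟩ := (hτ.chainAt_lt (show 0 < 0 + 1 by omega) (by omega)).exists_ne_zero
    refine ⟨g, ?_, hg, hg'⟩
    rw [hs, hf.stores.label τ hτ g]
    rw [← hg, chainAt_of_lt τ (show 0 + 1 < d + 2 by omega)]
    congr 1
  | succ i ih =>
    obtain ⟨τ', hsw, ha⟩ := hf.stores.exists_switch hτ hi
    refine (Runs.fetch x (i + 1)).seq ?_
    rintro _ rfl
    rw [hs, ha]
    refine (ih (by omega) hsw.chain (by rw [MState.setReg_reg, if_pos rfl])).mono le_rfl ?_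
    rintro _ ⟨g, rfl, h1, h2⟩
    have h3 := hsw.zero_ne_zero hf.om hτ hi h1 h2
    exact ⟨g, MState.setReg_setReg _ _ _ _, h3.1, h3.2⟩

theorem Runs.probe (hf : IsStoredFlag L X inp addr) {k : ℕ} (hk : k < d)
    {τ : Fin (d + 2) → SV (Fin n)} (hτ : IsMaxCovChain L τ) {r : ℕ → Fin n} {s : MState}
    (hs : s.reg 1 = addr τ) (hr : HoldsElements d r s) :
    Runs χ inp (Prog.probe d k) s (probeCost d k) fun s' => ∃ g : Fin n,
      chainAt τ (k + 1) g = 0 ∧ chainAt τ k g ≠ 0 ∧ s'.reg 3 = g ∧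
      s'.reg 4 = signCode (χ (probeTuple d k r g)) ∧ s'.mem = s.mem ∧
      ∀ y, y ≠ 3 → y ≠ 4 → s'.reg y = s.reg y := by
  refine (Runs.instr (Q := fun s' => s' = s.setReg 3 (s.reg 1)) rfl).seq ?_
  rintro _ rfl
  refine (Runs.label hf 3 k hk.le hτ (by rw [MState.setReg_reg, if_pos rfl, hs])).seq ?_
  rintro _ ⟨g, rfl, h1, h2⟩
  rw [MState.setReg_setReg]
  refine Runs.instr ⟨g, h1, h2, ?_⟩
  simp only [Instr.apply]
  refine ⟨?_, ?_, rfl, fun y h3 h4 => ?_⟩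
  · rw [MState.setReg_reg, if_neg (by omega), MState.setReg_reg, if_pos rfl]
  · rw [MState.setReg_reg, if_pos rfl]
    apply oracle_eq
    intro i
    unfold probeRegs probeTuple
    rw [MState.setReg_reg]
    by_cases c1 : (i : ℕ) < k + 1
    · rw [if_pos c1, if_neg (by omega), if_pos c1]
      exact hr.elements _ (by omega) (by omega)
    · by_cases c2 : (i : ℕ) = k + 1
      · rw [if_neg c1, if_pos c2, if_pos rfl, if_neg c1, if_pos c2]
      · rw [if_neg c1, if_neg c2, if_neg (by omega), if_neg c1, if_neg c2]
        exact hr.elements _ (by omega) (by omega)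
  · rw [MState.setReg_reg, if_neg h4, MState.setReg_reg, if_neg h3]

theorem Runs.advance (hf : IsStoredFlag L X inp addr) {k : ℕ} (hk : k < d)
    {τ : Fin (d + 2) → SV (Fin n)} (hτ : IsMaxCovChain L τ) {r : ℕ → Fin n} {s : MState}
    (hs : s.reg 1 = addr τ) (hr : HoldsElements d r s) :
    Runs χ inp (Prog.advance d k) s (k + 3 + probeCost d k) fun s' =>
      (∃ τ', IsSwitch L (k + 1) τ τ' ∧ s'.reg 1 = addr τ' ∧ ∃ g : Fin n,
        chainAt τ' (k + 1) g = 0 ∧ chainAt τ' k g ≠ 0 ∧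
        s'.reg 3 = g ∧ s'.reg 4 = signCode (χ (probeTuple d k r g))) ∧ s'.mem = s.mem ∧
      ∀ y, y ≠ 1 → y ≠ 3 → y ≠ 4 → s'.reg y = s.reg y := by
  obtain ⟨τ', hsw, ha⟩ := hf.stores.exists_switch hτ (show k + 1 ≤ d by omega)
  refine (Runs.fetch 1 (k + 1)).seq ?_
  rintro _ rfl
  rw [hs, ha]
  have h1 : (s.setReg 1 (addr τ')).reg 1 = addr τ' := by rw [MState.setReg_reg, if_pos rfl]
  have h2 : HoldsElements d r (s.setReg 1 (addr τ')) :=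
    hr.congr fun y hy => by rw [MState.setReg_reg, if_neg (by omega)]
  refine (Runs.probe hf hk hsw.chain h1 h2).mono le_rfl ?_
  rintro s' ⟨g, h3, h4, h5, h6, h7, h8⟩
  refine ⟨⟨τ', hsw, by rw [h8 1 (by omega) (by omega), h1], g, h3, h4, h5, h6⟩, h7,
    fun y c1 c3 c4 => ?_⟩
  rw [h8 y c3 c4, MState.setReg_reg, if_neg c1]

theorem Runs.join {k : ℕ} {s : MState} {l l' : List (Fin n)} (hn : s.reg 0 = n)
    (hl : IsSegment s.mem l (s.reg (11 + 4 * (k + 1))) (s.reg (12 + 4 * (k + 1))))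
    (hl' : IsSegment s.mem l' (s.reg (11 + 4 * k)) (s.reg (12 + 4 * k))) (h0 : l' ≠ [])
    (hnd : (l ++ l').Nodup) :
    Runs χ inp (Prog.join d k) s 4 fun s' =>
      IsSegment s'.mem (if s.reg (13 + 4 * k) = s.reg (13 + 4 * (k + 1)) then l ++ l' else l' ++ l)
        (s'.reg (11 + 4 * (k + 1))) (s'.reg (12 + 4 * (k + 1))) ∧
      (∀ x : ℕ, (∀ e ∈ l ++ l', x ≠ (e : ℕ)) → s'.mem x = s.mem x) ∧
      ∀ y, y ≠ 11 + 4 * (k + 1) → y ≠ 12 + 4 * (k + 1) → s'.reg y = s.reg y := by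
  have hnd' : (l' ++ l).Nodup := List.nodup_append_comm.1 hnd
  refine Runs.ite (t := 3) (fun h => ?_) fun h => ?_
  · have hl0 : l = [] := by
      by_contra hne
      have := hl.head_lt hne
      simp only [Test.Holds] at h
      omega
    subst hl0
    refine (((Runs.instr (Q := fun s' => s' = s.setReg (11 + 4 * (k + 1)) (s.reg (11 + 4 * k)))
      rfl).seq (t₂ := 1) ?_)).mono (by omega) fun s' h => h
    rintro _ rfl
    refine Runs.instr ?_
    simp only [Instr.apply, List.nil_append, List.append_nil, ite_self, MState.setReg_mem]
    refine ⟨?_, ?_, fun y h1 h2 => ?_⟩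
    · rw [MState.setReg_reg, if_neg (by omega), MState.setReg_reg, if_pos rfl, MState.setReg_reg,
        if_pos rfl, MState.setReg_reg, if_neg (by omega)]
      exact hl'
    · simp
    · rw [MState.setReg_reg, if_neg h2, MState.setReg_reg, if_neg h1]
  · have hl0 : l ≠ [] := by
      rintro rfl
      rcases hl with hl | ⟨a, b, h1, -⟩
      · exact h (hl.2.trans hn.symm)
      · simp at h1
    refine Runs.ite (t := 2) (fun h1 => ?_) fun h1 => ?_
    · simp only [Test.Holds] at h1
      rw [if_pos h1]
      refine ((Runs.instr (Q := fun s' => s' = ⟨s.reg, Function.update s.mem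
        (s.reg (12 + 4 * (k + 1))) (s.reg (11 + 4 * k))⟩) rfl).seq (t₂ := 1) ?_)
      rintro _ rfl
      refine Runs.instr ?_
      simp only [Instr.apply, MState.setReg_mem]
      refine ⟨?_, fun x hx => ?_, fun y h3 h4 => ?_⟩
      · rw [MState.setReg_reg, if_neg (by omega), MState.setReg_reg, if_pos rfl]
        exact hl.append hl' hl0 h0 hnd
      · obtain ⟨b, hb, hb'⟩ := hl.tail_eq hl0
        rw [Function.update_of_ne]
        rw [hb']
        exact hx b (List.mem_append_left _ hb)
      · rw [MState.setReg_reg, if_neg h4]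
    · simp only [Test.Holds] at h1
      rw [if_neg h1]
      refine ((Runs.instr (Q := fun s' => s' = ⟨s.reg, Function.update s.mem
        (s.reg (12 + 4 * k)) (s.reg (11 + 4 * (k + 1)))⟩) rfl).seq (t₂ := 1) ?_)
      rintro _ rfl
      refine Runs.instr ?_
      simp only [Instr.apply, MState.setReg_mem]
      refine ⟨?_, fun x hx => ?_, fun y h3 h4 => ?_⟩
      · rw [MState.setReg_reg, if_pos rfl, MState.setReg_reg, if_neg (by omega)]
        exact hl'.append hl h0 hl0 hnd'
      · obtain ⟨b, hb, hb'⟩ := hl'.tail_eq h0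
        rw [Function.update_of_ne]
        rw [hb']
        exact hx b (List.mem_append_right _ hb)
      · rw [MState.setReg_reg, if_neg h3]

/-- Blocks put together by appending or by prepending. -/
def accumulate {α : Type*} (s : SignType) (D : ℕ → List α) : ℕ → List α
  | 0 => []
  | i + 1 => if s = 1 then accumulate s D i ++ D i else D i ++ accumulate s D i

theorem accumulate_one {α : Type*} (D : ℕ → List α) (i : ℕ) :
    accumulate 1 D i = ((List.range i).map D).flatten := by
  induction i with
  | zero => rfl
  | succ i ih => simp [accumulate, ih, List.range_succ]

theorem accumulate_neg_one {α : Type*} (D : ℕ → List α) (i : ℕ) :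
    accumulate (-1) D i = ((List.range i).map D).reverse.flatten := by
  induction i with
  | zero => rfl
  | succ i ih => simp [accumulate, ih, List.range_succ, show (-1 : SignType) ≠ 1 by decide]

theorem length_accumulate {α : Type*} (s : SignType) (D : ℕ → List α) (i : ℕ) :
    (accumulate s D i).length = ∑ j ∈ Finset.range i, (D j).length := by
  induction i with
  | zero => rfl
  | succ i ih =>
    rw [Finset.sum_range_succ, accumulate]
    split_ifs <;> simp [ih, Nat.add_comm]

theorem accumulate_sublist {α : Type*} (s : SignType) (D : ℕ → List α) {i m : ℕ} (h : i ≤ m) :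
    (accumulate s D i).Sublist (accumulate s D m) := by
  induction m, h using Nat.le_induction with
  | base => exact List.Sublist.refl _
  | succ m _ ih =>
    rw [accumulate]
    split_ifs
    · exact ih.trans (List.sublist_append_left _ _)
    · exact ih.trans (List.sublist_append_right _ _)

end SweepProgram

/-! ### Correctness and cost of a sweep. -/

section SweepSpec

variable {n d : ℕ} {L : Set (SV (Fin n))} {X : ℕ → SV (Fin n)}
  {χ : (Fin (d + 1) → Fin n) → SignType} {inp : ℕ → ℕ}
  {addr : (Fin (d + 2) → SV (Fin n)) → ℕ}

theorem Runs.sweep_zero (hf : IsStoredFlag L X inp addr) {τ : Fin (d + 2) → SV (Fin n)}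
    {σ : SignType} {r : ℕ → Fin n} {ρ : List (Fin n)} {s : MState}
    (h : IsSweepInput L X χ addr 0 τ σ r ρ s) :
    Runs χ inp (Prog.sweep d 0) s
      (sweepCost d 0 * (ρ.filter fun e => chainAt τ 0 e ≠ 0).length)
      (IsSweepOutput L X addr 0 τ (ρ.filter fun e => chainAt τ 0 e ≠ 0) s) := by
  obtain ⟨e, he, rfl⟩ := h.order
  have hl : ([e].filter fun e => chainAt τ 0 e ≠ 0) = [e] := by
    simp [h.start.chain.chainAt_zero_ne_zero hf.om hf.acyclic e]
  rw [hl]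
  obtain ⟨τ', hsw, ha⟩ := hf.stores.exists_switch h.start.chain (Nat.zero_le d)
  refine ((Runs.instr (Q := fun s' => s' = s.setReg 11 (s.reg 1)) rfl).seq
    (t₂ := labelCost d 0 + (1 + 2)) ?_).mono (by simp [sweepCost, labelCost]; omega)
    fun s' h => h
  rintro _ rfl
  refine (Runs.label hf 11 0 (Nat.zero_le d) h.start.chain
    (by rw [MState.setReg_reg, if_pos rfl, h.addr_eq])).seq ?_
  rintro _ ⟨g, rfl, hg, -⟩
  rw [MState.setReg_setReg]
  have hge : g = e := by
    have : g ∈ (chainAt τ 1).zeros Finset.univ := SV.mem_zeros.2 ⟨Finset.mem_univ g, hg⟩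
    rw [he] at this
    exact Finset.mem_singleton.1 this
  subst hge
  refine (Runs.instr (Q := fun s' => s' = (s.setReg 11 g).setReg 12 g)
    (by simp [Instr.apply, MState.setReg_reg])).seq ?_
  rintro _ rfl
  refine (Runs.fetch 1 0).mono le_rfl ?_
  rintro _ rfl
  refine ⟨⟨τ', hsw.isSweepEnd_zero hf.om hf.acyclic h.start.chain X, ?_⟩, ?_, fun x _ => rfl,
    fun y hy => ?_⟩
  · simp [MState.setReg_reg, h.addr_eq, ← ha]
  · simp only [MState.setReg_reg, Nat.mul_zero, Nat.add_zero, Nat.reduceEqDiff, if_pos, if_false]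
    exact IsSegment.singleton _ g
  · simp only [MState.setReg_reg]
    rw [if_neg (by omega), if_neg (by omega), if_neg (by omega)]

/-- The states at the test of the loop of a sweep, where the blocks in `l` have been listed. -/
structure IsLoopState (L : Set (SV (Fin n))) (X : ℕ → SV (Fin n))
    (χ : (Fin (d + 1) → Fin n) → SignType) (addr : (Fin (d + 2) → SV (Fin n)) → ℕ) (k : ℕ)
    (τ₀ : Fin (d + 2) → SV (Fin n)) (T V : ℕ → SV (Fin n)) (r : ℕ → Fin n) (l : List (Fin n))
    (i : ℕ) (s₀ s : MState) : Prop where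
  position : ∃ τ, IsSweepState L X k τ₀ T V i τ ∧ s.reg 1 = addr τ ∧ ∃ g : Fin n,
    chainAt τ (k + 1) g = 0 ∧ chainAt τ k g ≠ 0 ∧ s.reg 4 = signCode (χ (probeTuple d k r g))
  segment : IsSegment s.mem l (s.reg (11 + 4 * (k + 1))) (s.reg (12 + 4 * (k + 1)))
  mem_eq : ∀ x : ℕ, (∀ e ∈ l, x ≠ (e : ℕ)) → s.mem x = s₀.mem x
  reg_eq : ∀ y, (y = 0 ∨ (5 ≤ y ∧ y < 10) ∨ (10 ≤ y ∧ y % 4 = 2) ∨ 13 + 4 * (k + 1) ≤ y) →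
    s.reg y = s₀.reg y

/-- The circle of a sweep, together with the blocks `D i` to be listed at its vertices. -/
structure IsSweepCircle (L : Set (SV (Fin n))) (X : ℕ → SV (Fin n))
    (χ : (Fin (d + 1) → Fin n) → SignType) (k : ℕ) (τ₀ : Fin (d + 2) → SV (Fin n))
    (σ : SignType) (r : ℕ → Fin n) (ρ : List (Fin n)) (B : SV (Fin n)) (T V : ℕ → SV (Fin n))
    (m : ℕ) (s₀ : SignType) (D : ℕ → List (Fin n)) : Prop where
  pair : IsEdgePair L X k ((chainAt τ₀ (k + 2)).zeros Finset.univ)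
    ((chainAt τ₀ (k + 1)).restrict ((chainAt τ₀ (k + 2)).zeros Finset.univ)) B
  half : IsHalfCircle (flagCircle L X k ((chainAt τ₀ (k + 2)).zeros Finset.univ))
    (flagCircleSupport X k ((chainAt τ₀ (k + 2)).zeros Finset.univ))
    ((X k).restrict ((chainAt τ₀ (k + 2)).zeros Finset.univ))
    ((chainAt τ₀ (k + 1)).restrict ((chainAt τ₀ (k + 2)).zeros Finset.univ)) B T V m
  sign_ne : s₀ ≠ 0
  blocks_eq : accumulate s₀ D m = ρ.filter fun e => chainAt τ₀ (k + 1) e ≠ 0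
  query : ∀ g, chainAt τ₀ (k + 2) g = 0 → chainAt τ₀ (k + 1) g ≠ 0 →
    σ * χ (probeTuple d k r g) = -s₀
  query_zero : ∀ g, chainAt τ₀ (k + 1) g = 0 → σ * χ (probeTuple d k r g) = 0
  child : ∀ i < m, IsLevel L X k ((V i).zeros ((chainAt τ₀ (k + 2)).zeros Finset.univ))
      (signedInduced χ (s₀ * σ) r k) ∧
    ∃ ρ', IsLevelOrder L X k ((V i).zeros ((chainAt τ₀ (k + 2)).zeros Finset.univ))
      (signedInduced χ (s₀ * σ) r k) ρ' ∧ D i = ρ'.filter fun e => X k e ≠ 0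

/-- The sign `s₀` is `1` if the walk of the construction starts at `B`, and `-1` if it starts at
`A`. A query at any element of the flat that is not a zero of `A` recovers it. -/
theorem IsSweepInput.exists_circle (hf : IsStoredFlag L X inp addr) {k : ℕ} (hk : k < d)
    {τ : Fin (d + 2) → SV (Fin n)} {σ : SignType} {r : ℕ → Fin n} {ρ : List (Fin n)} {s : MState}
    (h : IsSweepInput L X χ addr (k + 1) τ σ r ρ s) :
    ∃ B T V m s₀ D, IsSweepCircle L X χ k τ σ r ρ B T V m s₀ D := by
  obtain ⟨B, T, V, m, hp, hh⟩ := h.start.exists_halfCircle hf.om hf.flag hk rfl h.level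
  obtain ⟨hr, hXr⟩ := h.top k rfl
  have hle := h.start.chain.chainAt_le (show k + 1 ≤ k + 2 by omega) (by omega)
  have hmem : ∀ {e}, e ∈ (chainAt τ (k + 2)).zeros Finset.univ ↔ chainAt τ (k + 2) e = 0 := by
    simp [SV.mem_zeros]
  have hS : ∀ {e}, chainAt τ (k + 1) e = 0 → e ∈ (chainAt τ (k + 2)).zeros Finset.univ :=
    fun he => hmem.2 (hle.eq_zero he)
  have hAr : (chainAt τ (k + 1)).restrict ((chainAt τ (k + 2)).zeros Finset.univ) (r (k + 1)) = 0 :=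
    by rw [SV.restrict_apply_of_mem _ (hS hr), hr]
  have htr : IsFlagTransversal X (fun i : Fin k => r (i + 1)) := fun i =>
    h.flag i (by have := i.2; omega)
  have hρ := (isLevelOrder_existsUnique hf.om hf.noDuplicates hf.one_le hf.flag (k + 1) hk _ _
    h.level).2.2 ρ h.order
  have hχ : ∀ g, signedInduced χ σ r (k + 1) (Fin.snoc (Fin.snoc (fun i : Fin k => r (i + 1))
      (r (k + 1)) : Fin (k + 1) → Fin n) g) = σ * χ (probeTuple d k r g) := fun g => by
    rw [signedInduced, extendTuple_snoc_snoc]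
  obtain ⟨s₀, D, hs, hD⟩ := h.order.decompose hf.om hf.noDuplicates hf.flag hk h.level hp hh
    (hS hr) hAr hXr
  have hfilter : ρ.filter (fun e => (chainAt τ (k + 1)).restrict
      ((chainAt τ (k + 2)).zeros Finset.univ) e ≠ 0) =
      ρ.filter fun e => chainAt τ (k + 1) e ≠ 0 := by
    apply List.filter_congr
    intro e he
    rw [SV.restrict_apply_of_mem _ ((hρ.2 e).1 he)]
  have hfun : (fun x : Fin (k + 1) → Fin n => s₀ * signedInduced χ σ r (k + 1)
      (Fin.snoc x (r (k + 1)))) = signedInduced χ (s₀ * σ) r k := funext fun x => by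
    rw [signedInduced, signedInduced, extendTuple_snoc, mul_assoc]
  rw [hfun] at hD
  have hsign := fun g hg hAg => hp.sign_of_oriented hf.om hf.flag hk h.level htr (hS hr) hAr hXr
    (g := g) hg hAg
  refine ⟨B, T, V, m, s₀, D, hp, hh, ?_, ?_, fun g h2 h1 => ?_, fun g h1 => ?_, hD⟩
  · rcases hs with ⟨rfl, -⟩ | ⟨rfl, -⟩ <;> decide
  · rcases hs with ⟨rfl, -, hs⟩ | ⟨rfl, -, hs⟩
    · rw [← hfilter, hs, accumulate_one]
    · rw [← hfilter, hs, accumulate_neg_one]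
  · have h3 := hsign g (hmem.2 h2) (by rwa [SV.restrict_apply_of_mem _ (hmem.2 h2)])
    rw [hχ] at h3
    rcases hs with ⟨rfl, ho, -⟩ | ⟨rfl, ho, -⟩
    · exact h3.2 ho
    · rw [h3.1 ho, neg_neg]
  · rw [← hχ]
    exact hp.sign_eq_zero hf.om hf.flag hk h.level htr (hS hr) hAr hXr (hS h1)
      (by rw [SV.restrict_apply_of_mem _ (hS h1), h1])

/-- A vertex vanishes at some non-loop. This is what lets the cost of a visit be charged to a listed
element. -/
theorem IsSweepCircle.block_ne_nil (hf : IsStoredFlag L X inp addr) {k : ℕ} (hk : k < d)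
    {τ : Fin (d + 2) → SV (Fin n)} {σ : SignType} {r : ℕ → Fin n} {ρ : List (Fin n)} {s : MState}
    (h : IsSweepInput L X χ addr (k + 1) τ σ r ρ s) {B : SV (Fin n)} {T V : ℕ → SV (Fin n)} {m : ℕ}
    {s₀ : SignType} {D : ℕ → List (Fin n)} (hc : IsSweepCircle L X χ k τ σ r ρ B T V m s₀ D)
    {i : ℕ} (hi : i < m) : D i ≠ [] := by
  obtain ⟨h1, ρ', h2, h3⟩ := hc.child i hi
  obtain ⟨g, hg, hVg⟩ := (h.level.isCircle hf.om hf.flag hk).exists_zero_of_isCocircuit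
    (hc.half.walk.cocircuit i)
  have h4 := ((isLevelOrder_existsUnique hf.om hf.noDuplicates hf.one_le hf.flag k hk.le _ _
    h1).2.2 ρ' h2).2 g
  rw [h3]
  exact List.ne_nil_of_mem (a := g) (List.mem_filter.2
    ⟨h4.2 (SV.mem_zeros.2 ⟨hg.1, hVg⟩), by simpa using hg.2⟩)

/-- The sign of the query at a vertex of the circle. -/
theorem IsSweepCircle.query_eq (hf : IsStoredFlag L X inp addr) {k : ℕ} (hk : k < d)
    {τ₀ τ : Fin (d + 2) → SV (Fin n)} {σ : SignType} {r : ℕ → Fin n} {ρ : List (Fin n)}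
    {s : MState}
    (h : IsSweepInput L X χ addr (k + 1) τ₀ σ r ρ s) {B : SV (Fin n)} {T V : ℕ → SV (Fin n)}
    {m : ℕ} {s₀ : SignType} {D : ℕ → List (Fin n)}
    (hc : IsSweepCircle L X χ k τ₀ σ r ρ B T V m s₀ D) {i : ℕ}
    (hs : IsSweepState L X k τ₀ T V i τ) {g : Fin n} (hg : chainAt τ (k + 1) g = 0)
    (hg' : chainAt τ k g ≠ 0) :
    (i < m → χ (probeTuple d k r g) = -(s₀ * σ)) ∧ (i = m → χ (probeTuple d k r g) = 0) := by
  have hg0 : chainAt τ₀ (k + 2) g = 0 ∧ V i g = 0 := by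
    rwa [hs.vertex, SV.comp_apply_eq_zero] at hg
  have hgS : g ∈ (chainAt τ₀ (k + 2)).zeros Finset.univ :=
    SV.mem_zeros.2 ⟨Finset.mem_univ g, hg0.1⟩
  have hXg : X k g ≠ 0 := fun h0 =>
    hg' ((hs.edge_eq_zero_iff hf.om hf.flag hk rfl h.level hc.half hgS).2 h0)
  -- Up to sign `V m` is the vertex `A`, so `g` is a zero of `A` only at the last vertex of the
  -- walk.
  have hA : V m g = -chainAt τ₀ (k + 1) g := by
    rw [hc.half.last, Pi.neg_apply, SV.restrict_apply_of_mem _ hgS]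
  constructor
  · intro hi
    have h1 := hc.half.disjoint i m hi le_rfl g ⟨hgS, hXg⟩ hg0.2
    rw [hA, SignType.neg_ne_zero_iff] at h1
    have h2 := hc.query g hg0.1 h1
    have h3 := h.sign_ne
    generalize χ (probeTuple d k r g) = w at *
    clear * - h2 h3
    revert σ s₀ w
    decide
  · rintro rfl
    rw [hg0.2, eq_comm, SignType.neg_eq_zero_iff] at hA
    have h2 := hc.query_zero g hA
    have h3 := h.sign_ne
    generalize χ (probeTuple d k r g) = w at *
    clear * - h2 h3
    revert σ w
    decide

/-- The same elements `r` serve at all vertices: on the flat the current edge has the same zeros as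
`X k`, so `r k` qualifies one level below. -/
theorem IsSweepCircle.child_input (hf : IsStoredFlag L X inp addr) {k : ℕ} (hk : k < d)
    {τ₀ τ : Fin (d + 2) → SV (Fin n)} {σ : SignType} {r : ℕ → Fin n} {ρ : List (Fin n)}
    {s s' : MState} (h : IsSweepInput L X χ addr (k + 1) τ₀ σ r ρ s) {B : SV (Fin n)}
    {T V : ℕ → SV (Fin n)} {m : ℕ} {s₀ : SignType} {D : ℕ → List (Fin n)}
    (hc : IsSweepCircle L X χ k τ₀ σ r ρ B T V m s₀ D) {i : ℕ} (hi : i < m)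
    (hs : IsSweepState L X k τ₀ T V i τ) (h1 : s'.reg 1 = addr τ) (hr : HoldsElements d r s')
    (hσ : s'.reg (13 + 4 * k) = signCode (s₀ * σ)) :
    ∃ ρ', IsSweepInput L X χ addr k τ (s₀ * σ) r ρ' s' ∧
      ρ'.filter (fun e => chainAt τ k e ≠ 0) = D i := by
  obtain ⟨h2, ρ', h3, h4⟩ := hc.child i hi
  have hz : (chainAt τ (k + 1)).zeros Finset.univ = _ := hs.zeros_eq rfl
  refine ⟨ρ', ⟨⟨hs.chain, fun j hj => ?_⟩, h1, hr, hσ, ?_, fun j hj => h.flag j (by omega),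
    fun j hj => ?_, hz ▸ h2, hz ▸ h3⟩, ?_⟩
  · exact hs.below_eq hf.flag hk (hs.edge_eq hf.om hf.flag hk rfl h.level hc.half hi.le) hj.le
  · exact mul_ne_zero hc.sign_ne h.sign_ne
  · obtain ⟨h5, h6⟩ := h.flag j (by omega)
    subst hj
    exact ⟨(hs.edge_eq_zero_iff hf.om hf.flag hk rfl h.level hc.half
      (h.level.subset _ rfl _ h5)).2 h5, h6⟩
  · rw [h4]
    apply List.filter_congr
    intro e he
    have h5 := (((isLevelOrder_existsUnique hf.om hf.noDuplicates hf.one_le hf.flag k hk.le _ _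
      h2).2.2 ρ' h3).2 e).1 he
    simp only [ne_eq, hs.edge_eq_zero_iff hf.om hf.flag hk rfl h.level hc.half
      (SV.zeros_subset _ _ h5)]

theorem nodup_accumulate {α : Type*} {s : SignType} {D : ℕ → List α} {i m : ℕ} (hi : i < m)
    (h : (accumulate s D m).Nodup) : (accumulate s D i ++ D i).Nodup := by
  have h1 := h.sublist (accumulate_sublist s D (show i + 1 ≤ m from hi))
  rw [accumulate] at h1
  split_ifs at h1
  · exact h1
  · exact List.nodup_append_comm.1 h1

theorem mem_accumulate_succ {α : Type*} {s : SignType} {D : ℕ → List α} {i : ℕ} {a : α} :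
    a ∈ accumulate s D (i + 1) ↔ a ∈ accumulate s D i ∨ a ∈ D i := by
  rw [accumulate]
  split_ifs <;> simp [or_comm]

theorem Runs.setSign {k : ℕ} {s : MState} {w : SignType} (hw : w ≠ 0) (h6 : s.reg 6 = 1)
    (h4 : s.reg 4 = signCode w) :
    Runs χ inp (.ite (.eq 4 6) (.instr (.const (13 + 4 * k) 2)) (.instr (.const (13 + 4 * k) 1)))
      s 2 fun s' => s' = s.setReg (13 + 4 * k) (signCode (-w)) := by
  refine Runs.ite (t := 1) (fun h => Runs.instr ?_) fun h => Runs.instr ?_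
  all_goals
    simp only [Test.Holds, h4, h6] at h
    simp only [Instr.apply]
    congr 1
    clear * - h hw
    revert w
    decide

/-- The loop of a sweep. -/
theorem IsSweepCircle.runs_loop (hf : IsStoredFlag L X inp addr) {k : ℕ} (hk : k < d)
    {τ₀ : Fin (d + 2) → SV (Fin n)} {σ : SignType} {r : ℕ → Fin n} {ρ : List (Fin n)}
    {s₁ : MState} (h : IsSweepInput L X χ addr (k + 1) τ₀ σ r ρ s₁) {B : SV (Fin n)}
    {T V : ℕ → SV (Fin n)} {m : ℕ} {s₀ : SignType} {D : ℕ → List (Fin n)}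
    (hc : IsSweepCircle L X χ k τ₀ σ r ρ B T V m s₀ D) {p : Prog (d + 1)} {c : ℕ}
    (hp : ∀ τ σ ρ s, IsSweepInput L X χ addr k τ σ r ρ s →
      Runs χ inp p s (c * (ρ.filter fun e => chainAt τ k e ≠ 0).length)
        (IsSweepOutput L X addr k τ (ρ.filter fun e => chainAt τ k e ≠ 0) s))
    {i : ℕ} (hi : i ≤ m) {s : MState}
    (hs : IsLoopState L X χ addr k τ₀ T V r (accumulate s₀ D i) i s₁ s) :
    Runs χ inp (.loop (.lt 5 4)
      (.seq (.ite (.eq 4 6) (.instr (.const (13 + 4 * k) 2)) (.instr (.const (13 + 4 * k) 1)))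
        (.seq p (.seq (.join d k) (.advance d k))))) s
      ((c + (10 + k + probeCost d k)) * (∑ j ∈ Finset.Ico i m, (D j).length) + 1)
      (IsLoopState L X χ addr k τ₀ T V r (accumulate s₀ D m) m s₁) := by
  obtain ⟨u, rfl⟩ := Nat.exists_eq_add_of_le hi
  induction u generalizing i s with
  | zero =>
    obtain ⟨τ, hτ, h1, g, hg, hg', hw⟩ := hs.position
    rw [(hc.query_eq hf hk h hτ hg hg').2 rfl] at hw
    refine (Runs.loop_end ?_ hs).mono (by simp) fun _ h => h
    simp [Test.Holds, hw, signCode]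
  | succ u ih =>
    have him : i < i + (u + 1) := by omega
    obtain ⟨τ, hτ, h1, g, hg, hg', hw⟩ := hs.position
    have hws := (hc.query_eq hf hk h hτ hg hg').1 him
    have hw0 : χ (probeTuple d k r g) ≠ 0 := by
      rw [hws, SignType.neg_ne_zero_iff]
      exact mul_ne_zero hc.sign_ne h.sign_ne
    have hr : HoldsElements d r s := h.holds.congr fun y hy => hs.reg_eq y (by omega)
    have hDne := hc.block_ne_nil hf hk h him
    have hnd : (accumulate s₀ D (i + (u + 1))).Nodup := by
      rw [hc.blocks_eq]
      exact ((isLevelOrder_existsUnique hf.om hf.noDuplicates hf.one_le hf.flag (k + 1) hk _ _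
        h.level).2.2 ρ h.order).1.filter _
    have hnd' := nodup_accumulate him hnd
    have htest : (Test.lt 5 4).Holds s := by
      have := mt signCode_eq_zero_iff.1 hw0
      simp only [Test.Holds, hr.zero, hw]
      omega
    have hstep : Runs χ inp (.seq (.ite (.eq 4 6) (.instr (.const (13 + 4 * k) 2))
        (.instr (.const (13 + 4 * k) 1))) (.seq p (.seq (.join d k) (.advance d k)))) s
        (2 + (c * (D i).length + (4 + (k + 3 + probeCost d k))))
        (IsLoopState L X χ addr k τ₀ T V r (accumulate s₀ D (i + 1)) (i + 1) s₁) := by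
      refine (Runs.setSign hw0 hr.one hw).seq ?_
      rintro _ rfl
      rw [hws, neg_neg]
      have hreg : ∀ y, y ≠ 13 + 4 * k →
          (s.setReg (13 + 4 * k) (signCode (s₀ * σ))).reg y = s.reg y := fun y hy => by
        rw [MState.setReg_reg, if_neg hy]
      obtain ⟨ρ', hin, hρ'⟩ := hc.child_input hf hk h him hτ
        (s' := s.setReg (13 + 4 * k) (signCode (s₀ * σ))) (by rw [hreg 1 (by omega), h1])
        (hr.congr fun y hy => hreg y (by omega)) (by rw [MState.setReg_reg, if_pos rfl])
      have hrun := hp _ _ _ _ hin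
      rw [hρ'] at hrun
      refine hrun.seq ?_
      rintro s' ⟨⟨τ', hend, ha⟩, hseg, hmem, hfr⟩
      have hσ₀ : s'.reg (13 + 4 * k) = signCode (s₀ * σ) := by
        rw [hfr _ (by omega), MState.setReg_reg, if_pos rfl]
      have hfr' : ∀ y, (y = 0 ∨ (5 ≤ y ∧ y < 10) ∨ (10 ≤ y ∧ y % 4 = 2) ∨ 13 + 4 * k < y) →
          s'.reg y = s.reg y := fun y hy => by
        rw [hfr y (by omega), hreg y (by omega)]
      have hσ₁ : s'.reg (13 + 4 * (k + 1)) = signCode σ := by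
        rw [hfr' _ (by omega), hs.reg_eq _ (by omega), h.sign]
      have hn : s'.reg 0 = n := by rw [hfr' 0 (by omega), hr.size]
      have hseg₁ : IsSegment s'.mem (accumulate s₀ D i) (s'.reg (11 + 4 * (k + 1)))
          (s'.reg (12 + 4 * (k + 1))) := by
        rw [hfr' _ (by omega), hfr' _ (by omega)]
        refine hs.segment.congr fun x hx => ?_
        rw [hmem x fun e he hxe => ?_, MState.setReg_mem]
        exact (List.nodup_append.1 hnd').2.2 x hx e he (Fin.ext hxe)
      -- Level `k` has the sign `s₀ * σ`; comparing it with `σ` tests whether `s₀ = 1`.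
      have hacc : (if s'.reg (13 + 4 * k) = s'.reg (13 + 4 * (k + 1)) then
          accumulate s₀ D i ++ D i else D i ++ accumulate s₀ D i) = accumulate s₀ D (i + 1) := by
        rw [accumulate, hσ₀, hσ₁]
        refine if_congr ⟨fun hc' => ?_, ?_⟩ rfl rfl
        · have h2 := signCode_injective hc'
          have h3 := h.sign_ne
          clear * - h2 h3
          revert s₀ σ
          decide
        · rintro rfl
          rw [one_mul]
      have hjoin := Runs.join (χ := χ) (inp := inp) hn hseg₁ hseg hDne hnd'
      rw [hacc] at hjoin
      refine hjoin.seq ?_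
      rintro s'' ⟨hseg₂, hmem₂, hreg₂⟩
      have hreg₃ : ∀ y, (y = 0 ∨ (5 ≤ y ∧ y < 10) ∨ (10 ≤ y ∧ y % 4 = 2) ∨
          13 + 4 * (k + 1) ≤ y) → s''.reg y = s₁.reg y := fun y hy => by
        rw [hreg₂ y (by omega) (by omega), hfr' y (by omega), hs.reg_eq y hy]
      refine (Runs.advance hf hk hend.chain (by rw [hreg₂ 1 (by omega) (by omega), ha])
        (h.holds.congr fun y hy => hreg₃ y (by omega))).mono le_rfl ?_
      rintro s₃ ⟨⟨τ'', hsw, ha'', g', hg1, hg2, -, hw'⟩, hmem₃, hreg₄⟩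
      refine ⟨⟨τ'', hτ.succ hf.om hf.flag hk rfl h.level hc.half hend hsw, ha'', g', hg1, hg2,
        hw'⟩, ?_, fun x hx => ?_, fun y hy => ?_⟩
      · rw [hmem₃, hreg₄ _ (by omega) (by omega) (by omega), hreg₄ _ (by omega) (by omega)
          (by omega)]
        exact hseg₂
      · have hx1 : ∀ e ∈ accumulate s₀ D i, x ≠ e := fun e he =>
          hx e (mem_accumulate_succ.2 (.inl he))
        have hx2 : ∀ e ∈ D i, x ≠ e := fun e he => hx e (mem_accumulate_succ.2 (.inr he))
        rw [hmem₃, hmem₂ x fun e he => (List.mem_append.1 he).elim (hx1 e) (hx2 e), hmem x hx2,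
          MState.setReg_mem, hs.mem_eq x hx1]
      · rw [hreg₄ y (by omega) (by omega) (by omega), hreg₃ y hy]
    refine (Runs.loop_step htest hstep (t₂ := (c + (10 + k + probeCost d k)) *
      (∑ j ∈ Finset.Ico (i + 1) (i + (u + 1)), (D j).length) + 1) fun s' hs' => ?_).mono ?_
      fun _ h => h
    · have e1 : i + (u + 1) = i + 1 + u := by omega
      rw [e1] at hc ⊢
      exact ih hs' hc (by omega)
    · rw [Finset.sum_eq_sum_Ico_succ_bot him]
      have h3 : 1 ≤ (D i).length := List.length_pos_iff.2 hDne
      generalize (∑ j ∈ Finset.Ico (i + 1) (i + (u + 1)), (D j).length) = z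
      generalize (D i).length = y at *
      -- The block is nonempty, so its elements pay for the round.
      have h4 : 10 + k + probeCost d k ≤ (10 + k + probeCost d k) * y := Nat.le_mul_of_pos_right _ h3
      have h5 := add_mul c (10 + k + probeCost d k) y
      rw [mul_add]
      omega

/-- A sweep lists its elements in order, in time proportional to their number. -/
theorem Runs.sweep (hf : IsStoredFlag L X inp addr) {k : ℕ} (hk : k ≤ d) {r : ℕ → Fin n}
    {τ : Fin (d + 2) → SV (Fin n)} {σ : SignType} {ρ : List (Fin n)} {s : MState}
    (h : IsSweepInput L X χ addr k τ σ r ρ s) :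
    Runs χ inp (Prog.sweep d k) s
      (sweepCost d k * (ρ.filter fun e => chainAt τ k e ≠ 0).length)
      (IsSweepOutput L X addr k τ (ρ.filter fun e => chainAt τ k e ≠ 0) s) := by
  induction k generalizing τ σ ρ s with
  | zero => exact Runs.sweep_zero hf h
  | succ k ih =>
    obtain ⟨B, T, V, m, s₀, D, hc⟩ := h.exists_circle hf hk
    refine ((Runs.instr (Q := fun s' => s' = s.setReg (11 + 4 * (k + 1)) (s.reg 0)) rfl).seq
      (t₂ := (k + 3 + probeCost d k) + ((sweepCost d k + (10 + k + probeCost d k)) *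
        (∑ j ∈ Finset.Ico 0 m, (D j).length) + 1)) ?_).mono ?_ fun _ h => h
    · rintro _ rfl
      have hreg : ∀ y, y ≠ 11 + 4 * (k + 1) →
          (s.setReg (11 + 4 * (k + 1)) (s.reg 0)).reg y = s.reg y := fun y hy => by
        rw [MState.setReg_reg, if_neg hy]
      refine (Runs.advance hf hk h.start.chain (by rw [hreg 1 (by omega), h.addr_eq])
        (h.holds.congr fun y hy => hreg y (by omega))).seq ?_
      rintro s' ⟨⟨τ', hsw, ha, g, hg1, hg2, -, hw⟩, hmem, hreg'⟩
      refine (hc.runs_loop hf hk h (fun τ σ ρ s hin => ih (by omega) hin) (Nat.zero_le m)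
        (s := s') ⟨⟨τ', h.start.state_zero hf.om hf.flag hk rfl h.level hc.pair hc.half hsw, ha, g,
        hg1, hg2, hw⟩, .inl ⟨rfl, ?_⟩, fun x _ => ?_, fun y hy => ?_⟩).mono le_rfl ?_
      · rw [hreg' _ (by omega) (by omega) (by omega), MState.setReg_reg, if_pos rfl, h.holds.size]
      · rw [hmem, MState.setReg_mem]
      · rw [hreg' y (by omega) (by omega) (by omega), hreg y (by omega)]
      · rintro s'' ⟨⟨τ'', hτ'', ha'', -⟩, hseg, hmem'', hreg''⟩
        rw [hc.blocks_eq] at hseg hmem''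
        exact ⟨⟨τ'', hτ''.isSweepEnd hf.om hf.flag hk rfl h.level hc.half, ha''⟩, hseg, hmem'',
          hreg''⟩
    · have h1 := length_accumulate s₀ D m
      rw [hc.blocks_eq, Finset.range_eq_Ico] at h1
      -- Since `1 ≤ m`, at least one element is listed, and it pays for the work outside the loop.
      have h2 : 1 ≤ ∑ j ∈ Finset.Ico 0 m, (D j).length := by
        rw [Finset.sum_eq_sum_Ico_succ_bot hc.half.one_le]
        have := List.length_pos_iff.2 (hc.block_ne_nil hf hk h hc.half.one_le)
        omega
      rw [h1, sweepCost]
      generalize (∑ j ∈ Finset.Ico 0 m, (D j).length) = z at *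
      have h3 : k + 5 + probeCost d k ≤ (k + 5 + probeCost d k) * z := Nat.le_mul_of_pos_right _ h2
      have h4 := add_mul (sweepCost d k + (10 + k + probeCost d k)) (k + 5 + probeCost d k) z
      have h5 := add_mul (sweepCost d k) (10 + k + probeCost d k) z
      omega

end SweepSpec

/-! ### Splitting off the first block. -/

section FirstBlock

variable {E : Type*} [DecidableEq E] [Finite E]

/-- The order of a flat starts with the order of the first vertex of the walk. -/
theorem IsLevelOrder.eq_append {L : Set (SV E)} (hL : IsOrientedMatroid L) (hnd : NoDuplicates L)
    {d : ℕ} {X : ℕ → SV E} (hX : IsPosFlag L d X) {k : ℕ} (hk : k < d) {S : Finset E}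
    {χ : (Fin (k + 2) → E) → SignType} (h : IsLevel L X (k + 1) S χ) {Y Z : SV E}
    (hYZ : IsEdgePair L X k S Y Z) (ho : IsOrientedAt X k S χ Y Z) {f : E} (hf : f ∈ S)
    (hYf : Y f ≠ 0) {ρ : List E} (hρ : IsLevelOrder L X (k + 1) S χ ρ) :
    ∃ ρ', IsLevelOrder L X k (Y.zeros S) (fun x => χ (Fin.snoc x f) * Y f) ρ' ∧
      ρ = ρ' ++ ρ.filter fun e => Y e ≠ 0 := by
  have hC := h.isCircle hL hX hk
  obtain ⟨Y', Z', Ys, blocks, hYZ', ho', hhd, hw, hb, rfl⟩ :=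
    (isLevelOrder_succ_iff (h.flag_subset hX hk)).1 hρ
  have hYY : Y' = Y ∧ Z' = Z := by
    refine (hYZ.eq_or_eq hL hX hk h hYZ').resolve_right ?_
    rintro ⟨rfl, rfl⟩
    exact ho'.not_symm hL hX hk h hYZ' ho
  obtain ⟨rfl, rfl⟩ := hYY
  obtain ⟨T, V, m, hh⟩ := hYZ.symm.exists_halfCircle hL hX hk h
  rw [hh.eq_of_head Ys hw hhd] at hb
  obtain ⟨Bl, rfl, hBl⟩ := hb.exists_map_range
  have hmem : ∀ i ≤ m, ∀ e ∈ Bl i, e ∈ S ∧ V i e = 0 := by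
    intro i hi e he
    obtain ⟨f', hf', hUf', hBl'⟩ := hBl i (by omega)
    have h2 := h.descend hL hX hk (hh.walk.cocircuit i) hf' hUf'
    exact SV.mem_zeros.1
      (((isLevelOrder_existsUnique hL hnd (by omega) hX k hk.le _ _ h2).2.2 _ hBl').2 e |>.1 he)
  obtain ⟨f', hf', hYf', hB⟩ := hBl 0 (by omega)
  rw [hh.zero] at hYf' hB
  have h2 := h.descend hL hX hk hYZ.left hf' hYf'
  have h1 := h.descend hL hX hk hYZ.left hf hYf
  refine ⟨Bl 0, hB.congr hL hnd (by omega) hX hk.le h2 h1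
    (h.induced_eq hL (fun _ _ _ => rfl) hYZ.left.1 hf' hYf' hf hYf), ?_⟩
  -- The filter removes the first block, and it keeps the later ones, whose elements outside `F` are
  -- not zeros of `Y`.
  rw [concatBlocks_map_range, List.filter_append, List.filter_eq_nil_iff.2, List.nil_append,
    List.filter_eq_self.2]
  · intro e he
    obtain ⟨l, hl, he⟩ := List.mem_flatten.1 he
    obtain ⟨i, hi, rfl⟩ := List.mem_map.1 hl
    rw [List.mem_range] at hi
    obtain ⟨he, heF⟩ := List.mem_filter.1 he
    obtain ⟨heS, hVe⟩ := hmem (i + 1) (by omega) e he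
    simp only [SV.mem_zeros, heS, true_and, decide_eq_true_eq] at heF
    have hY0 : Y' e ≠ 0 := fun h0 =>
      hh.disjoint 0 (i + 1) (by omega) (by omega) e ⟨heS, heF⟩ (by rw [hh.zero, h0]) hVe
    simpa using hY0
  · intro e he
    have := (hmem 0 (by omega) e he).2
    rw [hh.zero] at this
    simp [this]

end FirstBlock

/-! ### Positions at the vertices of the positive edge. -/

section FullGeometry

variable {n d : ℕ} {L : Set (SV (Fin n))} {X : ℕ → SV (Fin n)}
  {χ : (Fin (d + 1) → Fin n) → SignType} {inp : ℕ → ℕ}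
  {addr : (Fin (d + 2) → SV (Fin n)) → ℕ}

theorem extendTuple_congr {E : Type*} (d : ℕ) {m : ℕ} (x : Fin m → E) {r r' : ℕ → E}
    (h : ∀ i, m ≤ i → r i = r' i) : extendTuple d x r = extendTuple d x r' := by
  funext i
  unfold extendTuple
  split_ifs
  · rfl
  · exact h i (by omega)

theorem signedInduced_update (σ : SignType) (r : ℕ → Fin n) (k : ℕ) (g : Fin n) :
    signedInduced χ σ (Function.update r k g) k = signedInduced χ σ r k := by
  funext x
  rw [signedInduced, signedInduced, extendTuple_congr d x (r' := r)]
  intro i hi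
  rw [Function.update_of_ne (by omega)]

/-- The positions from which a flat that contains the flag can be listed. -/
structure IsListingStart (L : Set (SV (Fin n))) (X : ℕ → SV (Fin n))
    (χ : (Fin (d + 1) → Fin n) → SignType) (k : ℕ) (τ : Fin (d + 2) → SV (Fin n))
    (r : ℕ → Fin n) (ρ : List (Fin n)) : Prop where
  chain : IsMaxCovChain L τ
  below : ∀ j < k, chainAt τ j = X j
  flag : ∀ i, i + 1 < k → X (i + 1) (r (i + 1)) = 0 ∧ X i (r (i + 1)) ≠ 0
  top : ∀ i, i + 1 = k → chainAt τ k (r k) = 0 ∧ X i (r k) ≠ 0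
  level : IsLevel L X k ((chainAt τ (k + 1)).zeros Finset.univ) (signedInduced χ 1 r k)
  order : IsLevelOrder L X k ((chainAt τ (k + 1)).zeros Finset.univ) (signedInduced χ 1 r k) ρ

variable {k : ℕ} {τ τ' : Fin (d + 2) → SV (Fin n)} {r : ℕ → Fin n} {ρ : List (Fin n)} {g : Fin n}

theorem IsListingStart.sweepStart (h : IsListingStart L X χ k τ r ρ) (hk : k ≤ d) :
    IsSweepStart L X k τ := by
  refine ⟨h.chain, fun j hj => ?_⟩
  rw [← h.below j hj, (h.chain.chainAt_le (show j ≤ k + 1 by omega) (by omega)).comp_eq]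

theorem IsListingStart.sweepInput (h : IsListingStart L X χ k τ r ρ) (hk : k ≤ d) {s : MState}
    (h1 : s.reg 1 = addr τ) (hr : HoldsElements d r s) (hs : s.reg (13 + 4 * k) = 1) :
    IsSweepInput L X χ addr k τ 1 r ρ s :=
  ⟨h.sweepStart hk, h1, hr, hs, one_ne_zero, h.flag, h.top, h.level, h.order⟩

theorem IsSwitch.symm {i : ℕ} (hτ : IsMaxCovChain L τ) (h : IsSwitch L i τ τ') :
    IsSwitch L i τ' τ :=
  ⟨hτ, h.ne.symm, fun j hj => (h.eq j hj).symm⟩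

/-- The other vertex of the positive edge. -/
theorem IsListingStart.switch (h : IsListingStart L X χ (k + 1) τ r ρ)
    (hs : IsSwitch L (k + 1) τ τ') (hg : chainAt τ' (k + 1) g = 0) (hg' : chainAt τ' k g ≠ 0) :
    IsListingStart L X χ (k + 1) τ' (Function.update r (k + 1) g) ρ := by
  have hσ := signedInduced_update (χ := χ) 1 r (k + 1) g
  have hc := hs.eq (k + 2) (by omega)
  refine ⟨hs.chain, fun j hj => ?_, fun i hi => ?_, fun i hi => ?_, ?_, ?_⟩
  · rw [hs.eq j (by omega), h.below j hj]
  · rw [Function.update_of_ne (by omega)]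
    exact h.flag i hi
  · obtain rfl : i = k := by omega
    rw [Function.update_self]
    refine ⟨hg, ?_⟩
    rwa [← h.below i (by omega), ← hs.eq i (by omega)]
  · rw [hσ, hc]
    exact h.level
  · rw [hσ, hc]
    exact h.order

theorem IsListingStart.transversal (h : IsListingStart L X χ (k + 1) τ r ρ) :
    IsFlagTransversal X fun i : Fin k => r (i + 1) := fun i => h.flag i (by have := i.2; omega)

theorem IsListingStart.zeros_eq (h : IsListingStart L X χ (k + 1) τ r ρ) (hk : k < d) :
    ((chainAt τ (k + 1)).restrict ((chainAt τ (k + 2)).zeros Finset.univ)).zeros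
      ((chainAt τ (k + 2)).zeros Finset.univ) = (chainAt τ (k + 1)).zeros Finset.univ := by
  have hle := h.chain.chainAt_le (show k + 1 ≤ k + 2 by omega) (by omega)
  rw [SV.restrict_zeros]
  ext e
  simp only [SV.mem_zeros, Finset.mem_univ, true_and, and_iff_right_iff_imp]
  exact hle.eq_zero

theorem IsListingStart.edgePair (hf : IsStoredFlag L X inp addr) (hk : k < d)
    (h : IsListingStart L X χ (k + 1) τ r ρ) (hs : IsSwitch L (k + 1) τ τ') :
    IsEdgePair L X k ((chainAt τ (k + 2)).zeros Finset.univ)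
      ((chainAt τ (k + 1)).restrict ((chainAt τ (k + 2)).zeros Finset.univ))
      ((chainAt τ' (k + 1)).restrict ((chainAt τ (k + 2)).zeros Finset.univ)) := by
  have hT := h.level.isTope hf.om hf.flag hk
  have he := (h.sweepStart hk).edge rfl
  obtain ⟨h1, h2, h3⟩ := h.chain.vertex hf.om hf.flag hk rfl h.level rfl hT he
  obtain ⟨h1', h2', h3'⟩ := hs.chain.vertex hf.om hf.flag hk rfl h.level (hs.eq (k + 2) (by omega))
    hT (by rw [hs.eq k (by omega), he])
  refine ⟨h1, h2, h1', h2', fun hc => hs.ne ?_⟩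
  rw [h3, h3', hc]

theorem IsListingStart.mem (hk : k < d) (h : IsListingStart L X χ (k + 1) τ r ρ)
    (hs : IsSwitch L (k + 1) τ τ') (hg : chainAt τ' (k + 1) g = 0) (hg' : chainAt τ' k g ≠ 0) :
    g ∈ (chainAt τ (k + 2)).zeros Finset.univ ∧
      (chainAt τ' (k + 1)).restrict ((chainAt τ (k + 2)).zeros Finset.univ) g = 0 ∧ X k g ≠ 0 := by
  have hle := hs.chain.chainAt_le (show k + 1 ≤ k + 2 by omega) (by omega)
  have hgS : g ∈ (chainAt τ (k + 2)).zeros Finset.univ := by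
    rw [SV.mem_zeros, ← hs.eq (k + 2) (by omega)]
    exact ⟨Finset.mem_univ g, hle.eq_zero hg⟩
  refine ⟨hgS, by rw [SV.restrict_apply_of_mem _ hgS, hg], ?_⟩
  rwa [← h.below k (by omega), ← hs.eq k (by omega)]

theorem IsListingStart.mem_self (hk : k < d) (h : IsListingStart L X χ (k + 1) τ r ρ) :
    r (k + 1) ∈ (chainAt τ (k + 2)).zeros Finset.univ ∧
      (chainAt τ (k + 1)).restrict ((chainAt τ (k + 2)).zeros Finset.univ) (r (k + 1)) = 0 ∧
      X k (r (k + 1)) ≠ 0 := by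
  have hle := h.chain.chainAt_le (show k + 1 ≤ k + 2 by omega) (by omega)
  obtain ⟨h1, h2⟩ := h.top k rfl
  have hgS : r (k + 1) ∈ (chainAt τ (k + 2)).zeros Finset.univ :=
    SV.mem_zeros.2 ⟨Finset.mem_univ _, hle.eq_zero h1⟩
  exact ⟨hgS, by rw [SV.restrict_apply_of_mem _ hgS, h1], h2⟩

theorem signedInduced_probe (r : ℕ → Fin n) (k : ℕ) (g : Fin n) :
    signedInduced χ 1 r (k + 1) (Fin.snoc (Fin.snoc (fun i : Fin k => r (i + 1))
      (r (k + 1)) : Fin (k + 1) → Fin n) g) = χ (probeTuple d k r g) := by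
  rw [signedInduced, extendTuple_snoc_snoc, one_mul]

/-- The query is nonzero because its tuple is independent, and exchanging the two vertices exchanges
two entries. -/
theorem IsListingStart.query_swap (hf : IsStoredFlag L X inp addr) (hk : k < d)
    (h : IsListingStart L X χ (k + 1) τ r ρ) (hs : IsSwitch L (k + 1) τ τ')
    (hg : chainAt τ' (k + 1) g = 0) (hg' : chainAt τ' k g ≠ 0)
    (hw : χ (probeTuple d k r g) ≠ 1) :
    χ (probeTuple d k (Function.update r (k + 1) g) (r (k + 1))) = 1 := by
  have h1 := h.edgePair hf hk hs
  obtain ⟨h2, h3⟩ := h.level.indep_orienting hf.om hf.flag hk h1.left.1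
    (h1.orienting hf.om hf.flag hk h.level h.transversal (h.mem_self hk) (h.mem hk hs hg hg'))
  have h4 := h.level.chirotope.ne_zero h2 h3
  have h5 := h.level.swap_sign (fun i : Fin k => r (i + 1)) (r (k + 1)) g
  have h6 := signedInduced_probe (χ := χ) (Function.update r (k + 1) g) k (r (k + 1))
  have h7 : (fun i : Fin k => Function.update r (k + 1) g (i + 1)) = fun i : Fin k => r (i + 1) :=
    funext fun i => Function.update_of_ne (by have := i.2; omega) _ _
  rw [h7, Function.update_self, signedInduced_update, h5] at h6
  rw [← h6]
  rw [← signedInduced_probe (χ := χ) r k g] at hw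
  generalize signedInduced χ 1 r (k + 1) _ = w at h4 hw
  clear * - h4 hw
  revert w
  decide

/-- The flat at the first vertex of the walk, and the remaining elements. -/
theorem IsListingStart.descend (hf : IsStoredFlag L X inp addr) (hk : k < d)
    (h : IsListingStart L X χ (k + 1) τ r ρ) (hs : IsSwitch L (k + 1) τ τ')
    (hg : chainAt τ' (k + 1) g = 0) (hg' : chainAt τ' k g ≠ 0)
    (hw : χ (probeTuple d k r g) = 1) :
    ∃ ρ', IsListingStart L X χ k τ (Function.update r (k + 1) g) ρ' ∧
      ρ = ρ' ++ ρ.filter fun e => chainAt τ (k + 1) e ≠ 0 := by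
  have h1 := h.edgePair hf hk hs
  have hgm := h.mem hk hs hg hg'
  have ho : IsOrientedAt X k ((chainAt τ (k + 2)).zeros Finset.univ) (signedInduced χ 1 r (k + 1))
      ((chainAt τ (k + 1)).restrict ((chainAt τ (k + 2)).zeros Finset.univ))
      ((chainAt τ' (k + 1)).restrict ((chainAt τ (k + 2)).zeros Finset.univ)) :=
    ⟨_, _, _, h.transversal, h.mem_self hk, hgm, by rw [signedInduced_probe, hw]⟩
  have hAg := (h1.orienting hf.om hf.flag hk h.level h.transversal (h.mem_self hk) hgm).ne_zero'
  -- The element `g` of the other vertex lies off the zeros of the first vertex, which is positive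
  -- there. So replacing `r (k + 1)` by `g` gives the induced chirotope without a change of sign.
  have hfun : (fun x : Fin (k + 1) → Fin n => signedInduced χ 1 r (k + 1) (Fin.snoc x g) *
      (chainAt τ (k + 1)).restrict ((chainAt τ (k + 2)).zeros Finset.univ) g) =
      signedInduced χ 1 (Function.update r (k + 1) g) k := by
    funext x
    rw [eq_one_of_lt_restrict hf.flag hk h1.left_lt hAg, mul_one, signedInduced, signedInduced,
      ← extendTuple_snoc d x, Function.update_self]
    congr 2
    exact extendTuple_congr d _ fun i hi => (Function.update_of_ne (by omega) _ _).symm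
  have hl := h.level.descend hf.om hf.flag hk h1.left hgm.1 hAg
  obtain ⟨ρ', h2, h3⟩ := h.order.eq_append hf.om hf.noDuplicates hf.flag hk h.level h1 ho hgm.1 hAg
  have hρ := (isLevelOrder_existsUnique hf.om hf.noDuplicates hf.one_le hf.flag (k + 1) hk _ _
    h.level).2.2 ρ h.order
  rw [hfun, h.zeros_eq hk] at hl h2
  refine ⟨ρ', ⟨h.chain, fun j hj => h.below j (by omega), fun i hi => ?_, fun i hi => ?_, hl, h2⟩,
    ?_⟩
  · rw [Function.update_of_ne (by omega)]
    exact h.flag i (by omega)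
  · subst hi
    rw [Function.update_of_ne (by omega), h.below _ (by omega)]
    exact h.flag i (by omega)
  · conv_lhs => rw [h3]
    congr 1
    apply List.filter_congr
    intro e he
    rw [SV.restrict_apply_of_mem _ ((hρ.2 e).1 he)]

end FullGeometry

/-! ### Listing a whole flat. -/

section Listing

/-- Choose the first vertex of the walk among the ends of the positive edge. -/
def Prog.orientEdge (d k : ℕ) : Prog (d + 1) :=
  .seq (.instr (.copy 7 1)) (.seq (.advance d k) (.ite (.eq 4 6)
    (.seq (.instr (.copy 1 7)) (.instr (.copy 9 3)))
    (.seq (.instr (.copy 7 1)) (.seq (.instr (.copy 9 (10 + 4 * (k + 1))))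
      (.instr (.copy (10 + 4 * (k + 1)) 3))))))

/-- Prepend the list of level `k` to the list with head in register 8. -/
def Prog.prepend (d k : ℕ) : Prog (d + 1) :=
  .seq (.instr (.store (12 + 4 * k) 8)) (.instr (.copy 8 (11 + 4 * k)))

/-- List the elements of a flat that contains the flag. -/
def Prog.list (d : ℕ) : ℕ → Prog (d + 1)
  | 0 => .seq (.label d 1 0) (.seq (.instr (.store 1 8)) (.instr (.copy 8 1)))
  -- The order is built from its end: the sweep yields what follows the first block, and the first
  -- block itself is left to level `k`. Registers 7 and 9 keep the chain at `Y` and the element of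
  -- the other vertex during the sweep.
  | k + 1 => .seq (.orientEdge d k) (.seq (.sweep d (k + 1)) (.seq (.prepend d (k + 1))
      (.seq (.instr (.copy 1 7)) (.seq (.instr (.copy (10 + 4 * (k + 1)) 9))
        (.seq (.instr (.const (13 + 4 * k) 1)) (Prog.list d k))))))

def orientCost (d k : ℕ) : ℕ := 1 + ((k + 3 + probeCost d k) + (3 + 1))

def listCost (d : ℕ) : ℕ → ℕ
  | 0 => labelCost d 0 + 2
  | k + 1 => listCost d k + sweepCost d (k + 1) + (orientCost d k + 5)

/-- The second list may be empty, as it is at the start, and the tail of the result is never needed.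
-/
theorem IsSegment.exists_append {n : ℕ} {mem : ℕ → ℕ} {l l' : List (Fin n)} {h t h' t' : ℕ}
    (hl : IsSegment mem l h t) (hl' : IsSegment mem l' h' t') (h0 : l ≠ [])
    (hnd : (l ++ l').Nodup) : ∃ t'', IsSegment (Function.update mem t h') (l ++ l') h t'' := by
  by_cases h1 : l' = []
  · subst h1
    rw [List.append_nil] at hnd ⊢
    rcases hl with hl | ⟨a, b, h1, h2, rfl, rfl, h5⟩
    · exact absurd hl.1 h0
    refine ⟨_, .inr ⟨a, b, h1, h2, rfl, rfl, h5.of_eq_off_last h2 hnd fun x y hx hxy => ?_⟩⟩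
    rw [Function.update_of_ne fun hc => hx (Fin.ext hc)]
    exact hxy
  · exact ⟨t', hl.append hl' h0 h1 hnd⟩

variable {n d : ℕ} {L : Set (SV (Fin n))} {X : ℕ → SV (Fin n)}
  {χ : (Fin (d + 1) → Fin n) → SignType} {inp : ℕ → ℕ}
  {addr : (Fin (d + 2) → SV (Fin n)) → ℕ} {k : ℕ} {τ : Fin (d + 2) → SV (Fin n)} {r : ℕ → Fin n}
  {ρ : List (Fin n)}

theorem HoldsElements.update {s s' : MState} (h : HoldsElements d r s) {k : ℕ} {g : Fin n}
    (hg : s'.reg (10 + 4 * k) = g)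
    (hs : ∀ y, (y = 0 ∨ y = 5 ∨ y = 6 ∨ (10 ≤ y ∧ y % 4 = 2)) → y ≠ 10 + 4 * k →
      s'.reg y = s.reg y) : HoldsElements d (Function.update r k g) s' where
  size := (hs 0 (by omega) (by omega)).trans h.size
  zero := (hs 5 (by omega) (by omega)).trans h.zero
  one := (hs 6 (by omega) (by omega)).trans h.one
  elements j h1 h2 := by
    by_cases hj : j = k
    · subst hj
      rw [Function.update_self, hg]
    · rw [Function.update_of_ne hj, hs _ (by omega) (by omega), h.elements j h1 h2]

/-- `Prog.advance` leads to the other vertex and queries there. If the answer is `+`, the saved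
chain stands at `Y` and is restored; otherwise the current one does, and the elements of the two
vertices exchange their roles. -/
theorem Runs.orientEdge (hf : IsStoredFlag L X inp addr) (hk : k < d)
    (h : IsListingStart L X χ (k + 1) τ r ρ) {s : MState} (h1 : s.reg 1 = addr τ)
    (hr : HoldsElements d r s) :
    Runs χ inp (Prog.orientEdge d k) s (orientCost d k) fun s' =>
      (∃ τ₁ τ₂ r₁, ∃ g : Fin n, IsListingStart L X χ (k + 1) τ₁ r₁ ρ ∧ IsSwitch L (k + 1) τ₁ τ₂ ∧
        chainAt τ₂ (k + 1) g = 0 ∧ chainAt τ₂ k g ≠ 0 ∧ χ (probeTuple d k r₁ g) = 1 ∧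
        s'.reg 1 = addr τ₁ ∧ s'.reg 7 = addr τ₁ ∧ s'.reg 9 = g ∧ HoldsElements d r₁ s') ∧
      s'.mem = s.mem ∧ ∀ y, (y = 0 ∨ y = 8 ∨ 13 + 4 * (k + 1) ≤ y ∧ y % 4 = 1) →
        s'.reg y = s.reg y := by
  refine (Runs.instr (Q := fun s' => s' = s.setReg 7 (s.reg 1)) rfl).seq ?_
  rintro _ rfl
  have hreg : ∀ y, y ≠ 7 → (s.setReg 7 (s.reg 1)).reg y = s.reg y := fun y hy => by
    rw [MState.setReg_reg, if_neg hy]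
  have h7 : (s.setReg 7 (s.reg 1)).reg 7 = addr τ := by rw [MState.setReg_reg, if_pos rfl, h1]
  have hr₁ : HoldsElements d r (s.setReg 7 (s.reg 1)) :=
    hr.congr fun y hy => hreg y (by omega)
  rw [← hreg 1 (by omega)] at h1
  rw [← MState.setReg_mem s 7 (s.reg 1)]
  generalize s.setReg 7 (s.reg 1) = s₁ at *
  refine (Runs.advance hf hk h.chain h1 hr₁).seq ?_
  rintro s₂ ⟨⟨τ', hsw, ha, g, hg, hg', h3, hw⟩, hmem₂, hreg₂⟩
  have h6 : s₂.reg 6 = 1 := by rw [hreg₂ 6 (by omega) (by omega) (by omega), hr₁.one]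
  refine Runs.ite (t := 3) (fun ht => ?_) fun ht => ?_
  · have hw1 : χ (probeTuple d k r g) = 1 := by
      simp only [Test.Holds, hw, h6] at ht
      exact signCode_injective ht
    refine ((Runs.instr (Q := fun s' => s' = s₂.setReg 1 (s₂.reg 7)) rfl).seq (t₂ := 1) ?_).mono
      (by omega) fun _ h => h
    rintro _ rfl
    refine Runs.instr ?_
    have hreg₃ : ∀ y, y ≠ 1 → y ≠ 9 → (Instr.apply χ inp (.copy 9 3)
        (s₂.setReg 1 (s₂.reg 7))).reg y = s₂.reg y := fun y c1 c9 => by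
      simp only [Instr.apply]
      rw [MState.setReg_reg, if_neg c9, MState.setReg_reg, if_neg c1]
    have hτ7 : s₂.reg 7 = addr τ := by rw [hreg₂ 7 (by omega) (by omega) (by omega), h7]
    refine ⟨⟨τ, τ', r, g, h, hsw, hg, hg', hw1, ?_, ?_, ?_, hr₁.congr fun y hy => ?_⟩, hmem₂,
      fun y hy => ?_⟩
    · simp [Instr.apply, MState.setReg_reg, hτ7]
    · rw [hreg₃ 7 (by omega) (by omega), hτ7]
    · simp [Instr.apply, MState.setReg_reg, h3]
    · rw [hreg₃ y (by omega) (by omega), hreg₂ y (by omega) (by omega) (by omega)]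
    · rw [hreg₃ y (by omega) (by omega), hreg₂ y (by omega) (by omega) (by omega),
        hreg y (by omega)]
  · have hw1 : χ (probeTuple d k r g) ≠ 1 := fun hc => ht (by
      simp only [Test.Holds, hw, h6, hc]
      rfl)
    have hR : s₂.reg (10 + 4 * (k + 1)) = r (k + 1) := by
      rw [hreg₂ _ (by omega) (by omega) (by omega), hr₁.elements _ (by omega) (by omega)]
    refine (Runs.instr (Q := fun s' => s' = s₂.setReg 7 (s₂.reg 1)) rfl).seq (t₂ := 2) ?_
    rintro _ rfl
    refine (Runs.instr (Q := fun s' => s' = (s₂.setReg 7 (s₂.reg 1)).setReg 9 (r (k + 1)))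
      ?_).seq (t₂ := 1) ?_
    · simp only [Instr.apply]
      rw [MState.setReg_reg, if_neg (by omega), hR]
    rintro _ rfl
    refine Runs.instr ?_
    have hreg₃ : ∀ y, y ≠ 7 → y ≠ 9 → y ≠ 10 + 4 * (k + 1) →
        (Instr.apply χ inp (.copy (10 + 4 * (k + 1)) 3)
        ((s₂.setReg 7 (s₂.reg 1)).setReg 9 (r (k + 1)))).reg y = s₂.reg y := fun y c1 c9 c => by
      simp only [Instr.apply]
      rw [MState.setReg_reg, if_neg c, MState.setReg_reg, if_neg c9, MState.setReg_reg, if_neg c1]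
    obtain ⟨h4, h5⟩ := h.top k rfl
    refine ⟨⟨τ', τ, _, r (k + 1), h.switch hsw hg hg', hsw.symm h.chain, h4, ?_,
      h.query_swap hf hk hsw hg hg' hw1, ?_, ?_, ?_, hr₁.update ?_ fun y hy hne => ?_⟩, hmem₂,
      fun y hy => ?_⟩
    · rwa [h.below k (by omega)]
    · rw [hreg₃ 1 (by omega) (by omega) (by omega), ha]
    · simp only [Instr.apply]
      rw [MState.setReg_reg, if_neg (by omega), MState.setReg_reg, if_neg (by omega),
        MState.setReg_reg, if_pos rfl, ha]
    · simp only [Instr.apply]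
      rw [MState.setReg_reg, if_neg (by omega), MState.setReg_reg, if_pos rfl]
    · simp only [Instr.apply]
      rw [MState.setReg_reg, if_pos rfl, MState.setReg_reg, if_neg (by omega), MState.setReg_reg,
        if_neg (by omega), h3]
    · rw [hreg₃ y (by omega) (by omega) hne, hreg₂ y (by omega) (by omega) (by omega)]
    · rw [hreg₃ y (by omega) (by omega) (by omega), hreg₂ y (by omega) (by omega) (by omega),
        hreg y (by omega)]

theorem Runs.prepend {s : MState} {l G : List (Fin n)} {t : ℕ}
    (hl : IsSegment s.mem l (s.reg (11 + 4 * k)) (s.reg (12 + 4 * k)))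
    (hG : IsSegment s.mem G (s.reg 8) t) (h0 : l ≠ []) (hnd : (l ++ G).Nodup) :
    Runs χ inp (Prog.prepend d k) s 2 fun s' =>
      (∃ t', IsSegment s'.mem (l ++ G) (s'.reg 8) t') ∧ ∀ y, y ≠ 8 → s'.reg y = s.reg y := by
  refine (Runs.instr (Q := fun s' => s' = ⟨s.reg, Function.update s.mem (s.reg (12 + 4 * k))
    (s.reg 8)⟩) rfl).seq (t₂ := 1) ?_
  rintro _ rfl
  refine Runs.instr ⟨?_, fun y hy => ?_⟩
  · simp only [Instr.apply, MState.setReg_mem]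
    rw [MState.setReg_reg, if_pos rfl]
    exact hl.exists_append hG h0 hnd
  · simp only [Instr.apply]
    rw [MState.setReg_reg, if_neg hy]

/-- The elements of the flat are listed in order, in time proportional to their number. -/
theorem Runs.list (hf : IsStoredFlag L X inp addr) (hk : k ≤ d)
    (h : IsListingStart L X χ k τ r ρ) {s : MState} (h1 : s.reg 1 = addr τ)
    (hr : HoldsElements d r s) (hσ : s.reg (13 + 4 * k) = 1) {G : List (Fin n)} {t : ℕ}
    (hG : IsSegment s.mem G (s.reg 8) t) (hnd : (ρ ++ G).Nodup) :
    Runs χ inp (Prog.list d k) s (listCost d k * ρ.length) fun s' =>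
      (∃ t', IsSegment s'.mem (ρ ++ G) (s'.reg 8) t') ∧ s'.reg 0 = s.reg 0 := by
  induction k generalizing τ r ρ s G t with
  | zero =>
    obtain ⟨e, he, rfl⟩ := h.order
    refine ((Runs.label hf 1 0 hk h.chain h1).seq (t₂ := 2) ?_).mono (by simp [listCost])
      fun _ h => h
    rintro _ ⟨g, rfl, hg, -⟩
    have hge : g = e := by
      have : g ∈ (chainAt τ 1).zeros Finset.univ := SV.mem_zeros.2 ⟨Finset.mem_univ g, hg⟩
      rw [he] at this
      exact Finset.mem_singleton.1 this
    subst hge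
    refine (Runs.instr (Q := fun s' => s' = ⟨(s.setReg 1 g).reg, Function.update s.mem g
      (s.reg 8)⟩) ?_).seq (t₂ := 1) ?_
    · simp [Instr.apply, MState.setReg_reg]
    rintro _ rfl
    refine Runs.instr ⟨?_, ?_⟩
    · simp only [Instr.apply, MState.setReg_mem, MState.setReg_reg, if_pos]
      exact (IsSegment.singleton s.mem g).exists_append hG (by simp) hnd
    · simp [Instr.apply, MState.setReg_reg]
  | succ k ih =>
    have hlen : 1 ≤ ρ.length := by
      obtain ⟨e, he⟩ := h.level.nonempty
      exact List.length_pos_of_mem (((isLevelOrder_existsUnique hf.om hf.noDuplicates hf.one_le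
        hf.flag (k + 1) hk _ _ h.level).2.2 ρ h.order).2 e |>.2 he)
    refine ((Runs.orientEdge hf hk h h1 hr).seq (t₂ := sweepCost d (k + 1) * ρ.length +
      (2 + (1 + (1 + (1 + listCost d k * ρ.length))))) ?_).mono ?_ fun _ h => h
    · rintro s₁ ⟨⟨τ₁, τ₂, r₁, g, h₁, hsw, hg, hg', hw, ha, h7, h9, hr₁⟩, hmem₁, hreg₁⟩
      obtain ⟨ρ', h₂, hρ⟩ := h₁.descend hf hk hsw hg hg' hw
      have hlρ : (ρ.filter fun e => chainAt τ₁ (k + 1) e ≠ 0).length ≤ ρ.length :=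
        List.length_filter_le _ _
      have hin := h₁.sweepInput hk ha hr₁ (by rw [hreg₁ _ (by omega), hσ])
      refine ((Runs.sweep hf hk hin).mono (Nat.mul_le_mul_left _ hlρ) fun _ h => h).seq ?_
      have hl0 : (ρ.filter fun e => chainAt τ₁ (k + 1) e ≠ 0) ≠ [] := by
        have hlt := h₁.chain.chainAt_lt (show k + 1 < k + 2 by omega) (by omega)
        obtain ⟨e, he, he'⟩ := hlt.exists_ne_zero
        refine List.ne_nil_of_mem (a := e) (List.mem_filter.2 ⟨?_, by simpa using he'⟩)
        exact ((isLevelOrder_existsUnique hf.om hf.noDuplicates hf.one_le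
          hf.flag (k + 1) hk _ _ h₁.level).2.2 ρ h₁.order).2 e |>.2
          (SV.mem_zeros.2 ⟨Finset.mem_univ e, he⟩)
      generalize (ρ.filter fun e => chainAt τ₁ (k + 1) e ≠ 0) = l at *
      rw [hρ, List.append_assoc] at hnd ⊢
      rintro s₂ ⟨-, hseg, hmem₂, hreg₂⟩
      have hndlG : (l ++ G).Nodup := hnd.sublist (List.sublist_append_right _ _)
      have hG₂ : IsSegment s₂.mem G (s₂.reg 8) t := by
        rw [hreg₂ 8 (by omega), hreg₁ 8 (by omega)]
        refine hG.congr fun x hx => ?_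
        rw [hmem₂ x fun e he hxe => ?_, hmem₁]
        exact (List.nodup_append.1 hndlG).2.2 e he x hx (Fin.ext hxe.symm)
      refine (Runs.prepend hseg hG₂ hl0 hndlG).seq ?_
      rintro s₃ ⟨⟨t', hseg₃⟩, hreg₃⟩
      refine (Runs.instr (Q := fun s' => s' = s₃.setReg 1 (addr τ₁)) ?_).seq ?_
      · simp only [Instr.apply]
        rw [hreg₃ 7 (by omega), hreg₂ 7 (by omega), h7]
      rintro _ rfl
      refine (Runs.instr (Q := fun s' => s' = (s₃.setReg 1 (addr τ₁)).setReg
        (10 + 4 * (k + 1)) g) ?_).seq ?_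
      · simp only [Instr.apply]
        rw [MState.setReg_reg, if_neg (by omega), hreg₃ 9 (by omega), hreg₂ 9 (by omega), h9]
      rintro _ rfl
      refine (Runs.instr (Q := fun s' => s' = ((s₃.setReg 1 (addr τ₁)).setReg
        (10 + 4 * (k + 1)) g).setReg (13 + 4 * k) 1) rfl).seq ?_
      rintro _ rfl
      have hreg₄ : ∀ y, y ≠ 1 → y ≠ 10 + 4 * (k + 1) → y ≠ 13 + 4 * k →
          (((s₃.setReg 1 (addr τ₁)).setReg (10 + 4 * (k + 1)) g).setReg (13 + 4 * k) 1).reg y =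
          s₃.reg y := fun y c1 c2 c3 => by
        rw [MState.setReg_reg, if_neg c3, MState.setReg_reg, if_neg c2, MState.setReg_reg,
          if_neg c1]
      refine (ih (by omega) h₂ ?_ (hr₁.update ?_ fun y hy hne => ?_) ?_ (G := l ++ G) (t := t') ?_
        hnd).mono (Nat.mul_le_mul_left _ (by simp)) ?_
      · rw [MState.setReg_reg, if_neg (by omega), MState.setReg_reg, if_neg (by omega),
          MState.setReg_reg, if_pos rfl]
      · rw [MState.setReg_reg, if_neg (by omega), MState.setReg_reg, if_pos rfl]
      · rw [hreg₄ y (by omega) hne (by omega), hreg₃ y (by omega), hreg₂ y (by omega)]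
      · rw [MState.setReg_reg, if_pos rfl]
      · rw [hreg₄ 8 (by omega) (by omega) (by omega)]
        exact hseg₃
      · rintro s₅ ⟨h8, h0⟩
        refine ⟨h8, ?_⟩
        rw [h0, hreg₄ 0 (by omega) (by omega) (by omega), hreg₃ 0 (by omega), hreg₂ 0 (by omega),
          hreg₁ 0 (by omega)]
    · have h2 := Nat.le_mul_of_pos_right (orientCost d k + 5) hlen
      have h3 := add_mul (listCost d k + sweepCost d (k + 1)) (orientCost d k + 5) ρ.length
      have h4 := add_mul (listCost d k) (sweepCost d (k + 1)) ρ.length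
      rw [listCost]
      omega

end Listing

/-! ### From the linked list to an array. -/

section Copying

theorem Runs.forLoop {r n : ℕ} {χ : (Fin r → Fin n) → SignType} {inp : ℕ → ℕ} {p : Prog r}
    {b : Test} {I : ℕ → MState → Prop} {m c : ℕ} (hb : ∀ i s, I i s → (b.Holds s ↔ i < m))
    (hp : ∀ i < m, ∀ s, I i s → Runs χ inp p s c (I (i + 1))) {s : MState} (h0 : I 0 s) :
    Runs χ inp (.loop b p) s ((c + 1) * m + 1) (I m) := by
  have key : ∀ u i, i + u = m → ∀ s, I i s → Runs χ inp (.loop b p) s ((c + 1) * u + 1) (I m) := by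
    intro u
    induction u with
    | zero =>
      rintro i rfl s hs
      exact Runs.loop_end (fun h => absurd ((hb _ s hs).1 h) (lt_irrefl _)) hs
    | succ u ih =>
      intro i hi s hs
      refine (Runs.loop_step ((hb i s hs).2 (by omega)) (hp i (by omega) s hs)
        fun s' hs' => ih (i + 1) (by omega) s' hs').mono ?_ fun _ h => h
      have := Nat.mul_succ (c + 1) u
      rw [this]
      omega
  exact key m 0 (Nat.zero_add m) s h0

/-- Write the linked list with head in register 8 to the cells from `n` on. -/
def Prog.unlink (r : ℕ) : Prog r :=
  .seq (.instr (.copy 2 0)) (.seq (.instr (.const 4 0)) (.loop (.lt 4 0)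
    (.seq (.instr (.store 2 8)) (.seq (.instr (.load 8 8))
      (.seq (.instr (.succ 2 2)) (.instr (.succ 4 4)))))))

/-- Copy the cells from `n` on to the beginning of the memory. -/
def Prog.copyBack (r : ℕ) : Prog r :=
  .seq (.instr (.copy 2 0)) (.seq (.instr (.const 3 0)) (.loop (.lt 3 0)
    (.seq (.instr (.load 4 2)) (.seq (.instr (.store 3 4))
      (.seq (.instr (.succ 2 2)) (.instr (.succ 3 3)))))))

variable {r n : ℕ} {χ : (Fin r → Fin n) → SignType} {inp : ℕ → ℕ} {s : MState}

/-- The links occupy the cells below `n`, so the list is first written above them. -/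
theorem Runs.unlink {q : ℕ → ℕ} (h0 : s.reg 0 = n) (h8 : s.reg 8 = q 0) (hq : ∀ i < n, q i < n)
    (hm : ∀ i, i + 1 < n → s.mem (q i) = q (i + 1)) :
    Runs χ inp (Prog.unlink r) s (5 * n + 3) fun s' =>
      s'.reg 0 = n ∧ ∀ i < n, s'.mem (n + i) = q i := by
  refine ((Runs.instr (Q := fun s' => s' = s.setReg 2 n) (by simp [Instr.apply, h0])).seq
    (t₂ := 1 + ((4 + 1) * n + 1)) ?_).mono (by omega) fun _ h => h
  rintro _ rfl
  refine (Runs.instr (Q := fun s' => s' = (s.setReg 2 n).setReg 4 0) rfl).seq ?_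
  rintro _ rfl
  -- Register 8 is described only for `i < n`, because the link of the last element is arbitrary.
  refine (Runs.forLoop (I := fun i s' => s'.reg 0 = n ∧ s'.reg 2 = n + i ∧ s'.reg 4 = i ∧
    (i < n → s'.reg 8 = q i) ∧ (∀ x < n, s'.mem x = s.mem x) ∧ ∀ j < i, s'.mem (n + j) = q j)
    (fun i s' h => by simp [Test.Holds, h.1, h.2.2.1]) ?_ ?_).mono le_rfl
    fun s' h => ⟨h.1, h.2.2.2.2.2⟩
  · rintro i hi s' ⟨c0, c2, c4, c8, cm, cq⟩
    refine ((Runs.instr (Q := fun t => t = ⟨s'.reg, Function.update s'.mem (n + i) (q i)⟩)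
      (by simp [Instr.apply, c2, c8 hi])).seq (t₂ := 3) ?_).mono (by omega) fun _ h => h
    rintro _ rfl
    refine (Runs.instr (Q := fun t => t = MState.setReg ⟨s'.reg, Function.update s'.mem (n + i)
      (q i)⟩ 8 (s'.mem (q i))) ?_).seq (t₂ := 2) ?_
    · simp only [Instr.apply, c8 hi]
      rw [Function.update_of_ne (by have := hq i hi; omega)]
    rintro _ rfl
    refine (Runs.instr (Q := fun t => t = (MState.setReg ⟨s'.reg, Function.update s'.mem (n + i)
      (q i)⟩ 8 (s'.mem (q i))).setReg 2 (n + i + 1)) ?_).seq (t₂ := 1) ?_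
    · simp [Instr.apply, MState.setReg_reg, c2]
    rintro _ rfl
    refine Runs.instr ?_
    simp only [Instr.apply, MState.setReg_reg, MState.setReg_mem]
    refine ⟨by simp [c0], by simp [Nat.add_assoc], by simp [c4], fun hi' => ?_, fun x hx => ?_,
      fun j hj => ?_⟩
    · simp [cm _ (hq i hi), hm i hi']
    · rw [Function.update_of_ne (by omega), cm x hx]
    · by_cases hji : j = i
      · rw [hji, Function.update_self]
      · rw [Function.update_of_ne (by omega), cq j (by omega)]
  · simp [MState.setReg_reg, h0, h8]

theorem Runs.copyBack {q : ℕ → ℕ} (h0 : s.reg 0 = n) (hm : ∀ i < n, s.mem (n + i) = q i) :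
    Runs χ inp (Prog.copyBack r) s (5 * n + 3) fun s' => ∀ i < n, s'.mem i = q i := by
  refine ((Runs.instr (Q := fun s' => s' = s.setReg 2 n) (by simp [Instr.apply, h0])).seq
    (t₂ := 1 + ((4 + 1) * n + 1)) ?_).mono (by omega) fun _ h => h
  rintro _ rfl
  refine (Runs.instr (Q := fun s' => s' = (s.setReg 2 n).setReg 3 0) rfl).seq ?_
  rintro _ rfl
  refine (Runs.forLoop (I := fun i s' => s'.reg 0 = n ∧ s'.reg 2 = n + i ∧ s'.reg 3 = i ∧
    (∀ j < n, s'.mem (n + j) = q j) ∧ ∀ j < i, s'.mem j = q j)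
    (fun i s' h => by simp [Test.Holds, h.1, h.2.2.1]) ?_ ?_).mono le_rfl
    fun s' h => h.2.2.2.2
  · rintro i hi s' ⟨c0, c2, c3, cm, cq⟩
    refine ((Runs.instr (Q := fun t => t = s'.setReg 4 (q i))
      (by simp [Instr.apply, c2, cm i hi])).seq (t₂ := 3) ?_).mono (by omega) fun _ h => h
    rintro _ rfl
    refine (Runs.instr (Q := fun t => t = ⟨(s'.setReg 4 (q i)).reg, Function.update s'.mem i
      (q i)⟩) (by simp [Instr.apply, MState.setReg_reg, c3])).seq (t₂ := 2) ?_
    rintro _ rfl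
    refine (Runs.instr (Q := fun t => t = MState.setReg ⟨(s'.setReg 4 (q i)).reg,
      Function.update s'.mem i (q i)⟩ 2 (n + i + 1)) ?_).seq (t₂ := 1) ?_
    · simp [Instr.apply, MState.setReg_reg, c2]
    rintro _ rfl
    refine Runs.instr ?_
    simp only [Instr.apply, MState.setReg_reg, MState.setReg_mem]
    refine ⟨by simp [c0], by simp [Nat.add_assoc], by simp [c3], fun j hj => ?_, fun j hj => ?_⟩
    · rw [Function.update_of_ne (by omega), cm j hj]
    · by_cases hji : j = i
      · rw [hji, Function.update_self]
      · rw [Function.update_of_ne hji, cq j (by omega)]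
  · simpa [MState.setReg_reg, h0] using hm

end Copying

/-! ### The complete program. -/

section FlagProgram

/-- Find elements of the first steps of the chain with address in register 1. -/
def Prog.initElements (d : ℕ) : ℕ → Prog (d + 1)
  | 0 => .instr (.const 6 1)
  | j + 1 => .seq (Prog.initElements d j) (.seq (.instr (.copy (10 + 4 * (j + 1)) 1))
      (.label d (10 + 4 * (j + 1)) j))

def initCost (d : ℕ) : ℕ → ℕ
  | 0 => 1
  | j + 1 => initCost d j + (1 + labelCost d j)

/-- The program that lists all elements in the order of the flag. -/
def Prog.flagOrder (d : ℕ) : Prog (d + 1) :=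
  .seq (.initElements d d) (.seq (.instr (.const (13 + 4 * d) 1)) (.seq (.instr (.copy 8 0))
    (.seq (.list d d) (.seq (.unlink (d + 1)) (.copyBack (d + 1))))))

variable {n d : ℕ} {L : Set (SV (Fin n))} {X : ℕ → SV (Fin n)}
  {χ : (Fin (d + 1) → Fin n) → SignType} {inp : ℕ → ℕ}
  {addr : (Fin (d + 2) → SV (Fin n)) → ℕ} {τ : Fin (d + 2) → SV (Fin n)} {ρ : List (Fin n)}

theorem Runs.initElements (hf : IsStoredFlag L X inp addr) (hτ : IsMaxCovChain L τ) (e : Fin n)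
    {s : MState} (hs : s.reg 1 = addr τ) {j : ℕ} (hj : j ≤ d) :
    Runs χ inp (Prog.initElements d j) s (initCost d j) fun s' => s'.reg 0 = s.reg 0 ∧
      s'.reg 1 = addr τ ∧ s'.reg 5 = s.reg 5 ∧ s'.reg 6 = 1 ∧ ∃ r : ℕ → Fin n, ∀ i, 1 ≤ i → i ≤ j →
        s'.reg (10 + 4 * i) = r i ∧ chainAt τ i (r i) = 0 ∧ chainAt τ (i - 1) (r i) ≠ 0 := by
  induction j with
  | zero =>
    refine Runs.instr ?_
    simp only [Instr.apply, MState.setReg_reg]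
    exact ⟨by simp, by simpa using hs, by simp, by simp, fun _ => e, fun i h1 h2 => by omega⟩
  | succ j ih =>
    refine (ih (by omega)).seq ?_
    rintro s₁ ⟨h0, h1, h5, h6, r, hr⟩
    refine (Runs.instr (Q := fun s' => s' = s₁.setReg (10 + 4 * (j + 1)) (addr τ))
      (by simp [Instr.apply, h1])).seq ?_
    rintro _ rfl
    refine (Runs.label hf (10 + 4 * (j + 1)) j (by omega) hτ
      (by rw [MState.setReg_reg, if_pos rfl])).mono le_rfl ?_
    rintro _ ⟨g, rfl, hg, hg'⟩
    rw [MState.setReg_setReg]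
    have hreg : ∀ y, y ≠ 10 + 4 * (j + 1) →
        (s₁.setReg (10 + 4 * (j + 1)) g).reg y = s₁.reg y := fun y hy => by
      rw [MState.setReg_reg, if_neg hy]
    refine ⟨(hreg 0 (by omega)).trans h0, (hreg 1 (by omega)).trans h1,
      (hreg 5 (by omega)).trans h5, (hreg 6 (by omega)).trans h6, Function.update r (j + 1) g,
      fun i h1 h2 => ?_⟩
    by_cases hi : i = j + 1
    · subst hi
      rw [Function.update_self, MState.setReg_reg, if_pos rfl]
      exact ⟨rfl, hg, hg'⟩
    · rw [Function.update_of_ne hi, hreg _ (by omega)]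
      exact hr i h1 (by omega)

theorem IsSegment.head_eq {mem : ℕ → ℕ} {h t : ℕ} (hl : IsSegment mem ρ h t) (h0 : 0 < ρ.length) :
    h = ρ[0] := by
  rcases hl with hl | ⟨a, b, h1, h2, rfl, rfl, h5⟩
  · rw [hl.1] at h0
    exact absurd h0 (by simp)
  · rw [List.head?_eq_getElem?, List.getElem?_eq_getElem h0] at h1
    rw [Option.some.inj h1]

theorem IsSegment.mem_eq {mem : ℕ → ℕ} {h t : ℕ} (hl : IsSegment mem ρ h t) {i : ℕ}
    (hi : i + 1 < ρ.length) : mem ρ[i] = ρ[i + 1] := by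
  rcases hl with hl | ⟨a, b, h1, h2, rfl, rfl, h5⟩
  · rw [hl.1] at hi
    exact absurd hi (by simp)
  · exact List.isChain_iff_getElem.1 h5 i hi

/-- The program lists all elements in linear time. -/
theorem Runs.flagOrder (hf : IsStoredFlag L X inp addr) (hτ : IsMaxCovChain L τ)
    (hX : ∀ j < d, chainAt τ j = X j) (hlevel : IsLevel L X d Finset.univ χ)
    (hρ : IsLevelOrder L X d Finset.univ χ ρ) (hlen : ρ.length = n) :
    Runs χ inp (Prog.flagOrder d) (initState n (addr τ))
      ((initCost d d + listCost d d + 18) * n) fun s => ∀ (i : ℕ) (hi : i < ρ.length),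
        s.mem i = ρ[i] := by
  obtain ⟨e, -⟩ := hlevel.nonempty
  have hn : 1 ≤ n := by have := e.2; omega
  have hnd := ((isLevelOrder_existsUnique hf.om hf.noDuplicates hf.one_le hf.flag d le_rfl _ _
    hlevel).2.2 ρ hρ).1
  refine ((Runs.initElements hf hτ e (s := initState n (addr τ)) rfl le_rfl).seq
    (t₂ := 1 + (1 + (listCost d d * n + ((5 * n + 3) + (5 * n + 3))))) ?_).mono ?_ fun _ h => h
  · rintro s₁ ⟨h0, h1, h5, h6, r, hr⟩
    have h0 : s₁.reg 0 = n := h0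
    have h5 : s₁.reg 5 = 0 := h5
    refine (Runs.instr (Q := fun s' => s' = s₁.setReg (13 + 4 * d) 1) rfl).seq ?_
    rintro _ rfl
    -- The output list is empty at first, which is coded by the head `n`.
    refine (Runs.instr (Q := fun s' => s' = (s₁.setReg (13 + 4 * d) 1).setReg 8 n) ?_).seq ?_
    · simp only [Instr.apply]
      rw [MState.setReg_reg, if_neg (by omega), h0]
    rintro _ rfl
    have hreg : ∀ y, y ≠ 8 → y ≠ 13 + 4 * d →
        ((s₁.setReg (13 + 4 * d) 1).setReg 8 n).reg y = s₁.reg y := fun y c1 c2 => by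
      rw [MState.setReg_reg, if_neg c1, MState.setReg_reg, if_neg c2]
    have hχ : signedInduced χ 1 r d = χ := by
      funext x
      rw [signedInduced, one_mul]
      congr 1
      funext i
      exact dif_pos i.2
    have hz : (chainAt τ (d + 1)).zeros Finset.univ = Finset.univ := by
      rw [hτ.chainAt_last]
      ext e
      simp [SV.mem_zeros]
    have hst : IsListingStart L X χ d τ r ρ := by
      refine ⟨hτ, hX, fun i hi => ?_, fun i hi => ?_, by rwa [hz, hχ], by rwa [hz, hχ]⟩
      · have h := hr (i + 1) (by omega) (by omega)
        rw [← hX _ hi, ← hX i (by omega)]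
        exact h.2
      · have h := hr d (by omega) le_rfl
        rw [← hX i (by omega)]
        rw [show d - 1 = i by omega] at h
        exact h.2
    have hlist := Runs.list hf le_rfl hst (s := (s₁.setReg (13 + 4 * d) 1).setReg 8 n)
      (by rw [hreg 1 (by omega) (by omega), h1])
      ⟨by rw [hreg 0 (by omega) (by omega), h0], by rw [hreg 5 (by omega) (by omega), h5],
        by rw [hreg 6 (by omega) (by omega), h6], fun j h1 h2 => by
          rw [hreg _ (by omega) (by omega), (hr j h1 h2).1]⟩
      (by rw [MState.setReg_reg, if_neg (by omega), MState.setReg_reg, if_pos rfl])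
      (G := []) (t := 0) (.inl ⟨rfl, by rw [MState.setReg_reg, if_pos rfl]⟩) (by simpa using hnd)
    rw [List.append_nil, hlen] at hlist
    refine hlist.seq ?_
    rintro s₂ ⟨⟨t, hseg⟩, h0'⟩
    rw [hreg 0 (by omega) (by omega), h0] at h0'
    have hq : ∀ i (hi : i < n), (fun i => if h : i < ρ.length then (ρ[i] : ℕ) else 0) i =
        ρ[i]'(by omega) := fun i hi => dif_pos (by omega)
    generalize (fun i => if h : i < ρ.length then (ρ[i] : ℕ) else 0) = q at hq
    refine (Runs.unlink (q := q) h0' ?_ (fun i hi => ?_) fun i hi => ?_).seq ?_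
    · rw [hq 0 (by omega)]
      exact hseg.head_eq (by omega)
    · rw [hq i hi]
      exact (ρ[i]).2
    · rw [hq i (by omega), hq (i + 1) hi]
      exact hseg.mem_eq (by omega)
    · rintro s₃ ⟨h0₃, hm₃⟩
      refine (Runs.copyBack h0₃ hm₃).mono le_rfl fun s₄ h₄ i hi => ?_
      rw [h₄ i (by omega), hq i (by omega)]
  -- Copying takes `10 * n + 6` steps and initialization two more besides `initCost`; the additive
  -- constants are absorbed by `1 ≤ n`.
  · have h1 := Nat.le_mul_of_pos_right (initCost d d) hn
    have h2 := add_mul (initCost d d + listCost d d) 18 n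
    have h3 := add_mul (initCost d d) (listCost d d) n
    omega

end FlagProgram

/-! ### From face-flags to the data of the recursion. -/

section FaceFlags

variable {E : Type*} {d : ℕ} {L : Set (SV E)} {φ : Fin (d - 1) → SV E} {τ : Fin (d + 2) → SV E}

theorem ChainExtends.chainAt_eq (h : ChainExtends τ φ) {j : ℕ} (hj : j < d) :
    chainAt τ j = flagSeq φ j := by
  rw [chainAt_of_lt τ (show j < d + 2 by omega)]
  exact h ⟨j, by omega⟩ hj

theorem ChainExtends.isPosFlag [Finite E] (hL : IsOrientedMatroid L) (hτ : IsMaxCovChain L τ)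
    (h : ChainExtends τ φ) : IsPosFlag L d (flagSeq φ) := by
  have hnn : ∀ j < d, ∀ e, flagSeq φ j e ≠ 0 → flagSeq φ j e = 1 := by
    intro j hj e he
    rw [← h.chainAt_eq hj] at he ⊢
    rw [hτ.chainAt_le (Nat.zero_le j) (by omega) e he, h.chainAt_eq (by omega)]
    rfl
  refine ⟨rfl, fun j hj => ?_, hnn, fun j hj e he => ?_, fun j hj => ?_,
    fun j hj W hW h0 e f he he' hf hf' => ?_⟩
  · rw [← h.chainAt_eq hj]
    exact hτ.chainAt_mem hL j
  · rw [← h.chainAt_eq (by omega)] at he ⊢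
    exact (hτ.chainAt_le (Nat.le_succ j) (by omega)).eq_zero he
  · rw [← h.chainAt_eq hj, ← h.chainAt_eq (show j < d by omega)]
    exact (hτ.chainAt_lt (Nat.lt_succ_self j) (by omega)).exists_ne_zero
  · have h1 := hnn j (by omega) e he'
    have h2 := hnn j (by omega) f hf'
    rw [← h.chainAt_eq hj] at he hf
    rw [← h.chainAt_eq (show j < d by omega)] at h0 h1 h2
    rcases hτ.chainAt_constant hL (by omega) hW h0 with h3 | h3 | h3
    · rw [h3 e he, h3 f hf]
    · rw [h3 e he, h3 f hf, h1, h2]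
    · rw [h3 e he, h3 f hf, h1, h2]

/-- At the top level the last nonzero covector of an extending chain provides the vertex of the
circle. -/
theorem IsChirotopeOf.isLevel [Fintype E] (hd : 1 ≤ d) (hL : IsOrientedMatroid L)
    {χ : (Fin (d + 1) → E) → SignType} (hχ : IsChirotopeOf χ L) (hτ : IsMaxCovChain L τ)
    (h : ChainExtends τ φ) : IsLevel L (flagSeq φ) d Finset.univ χ := by
  refine ⟨?_, ?_, fun _ _ e _ => Finset.mem_univ e, fun j hj => ⟨chainAt τ d, hτ.chainAt_mem hL d,
    ?_, ?_, ?_⟩⟩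
  · rw [Finset.coe_univ]
    exact hχ.isLocalChirotope hd hL
  · obtain ⟨x, -⟩ := hχ.ne_zero
    exact ⟨x 0, Finset.mem_univ _⟩
  · intro e he
    rw [← h.chainAt_eq (by omega)] at he
    exact (hτ.chainAt_le (show j ≤ d by omega) (by omega)).eq_zero he
  · obtain ⟨e, -, he⟩ := (hτ.chainAt_lt (Nat.lt_succ_self d) le_rfl).exists_ne_zero
    exact ⟨e, Finset.mem_univ e, he⟩
  · obtain ⟨e, he, he'⟩ := (hτ.chainAt_lt (show j < d by omega) (by omega)).exists_ne_zero
    rw [h.chainAt_eq (by omega)] at he'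
    exact ⟨e, Finset.mem_univ e, he, he'⟩

theorem isLevelOrder_univ_iff [Fintype E] [DecidableEq E] {X : ℕ → SV E}
    {χ : (Fin (d + 1) → E) → SignType} {ρ : List E} :
    IsLevelOrder L X d Finset.univ χ ρ ↔ IsFlagOrder d Finset.univ L χ X ρ := by
  have h1 : ∀ Y : SV E, Y.restrict Finset.univ = Y := fun Y =>
    funext fun e => SV.restrict_apply_of_mem Y (Finset.mem_univ e)
  have h2 : deletionTo L Finset.univ = L := by
    ext Y
    simp [deletionTo, h1]
  rw [IsLevelOrder, h2]
  simp only [h1]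

end FaceFlags

/-! ### The main theorem. -/

theorem exists_equiv_ofFn {n : ℕ} {ρ : List (Fin n)} (h : ρ.Nodup) (h' : ∀ e, e ∈ ρ) :
    ∃ π : Fin n ≃ Fin n, ρ = List.ofFn π := by
  have hlen : ρ.length = n := by
    have := List.toFinset_card_of_nodup h
    rw [← this, Finset.eq_univ_iff_forall.2 fun e => List.mem_toFinset.2 (h' e), Finset.card_univ,
      Fintype.card_fin]
  let f : Fin n → Fin n := fun i => ρ[(i : ℕ)]'(by omega)
  have hf : Function.Injective f := fun i j hij =>
    Fin.ext ((h.getElem_inj_iff).1 hij)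
  refine ⟨Equiv.ofBijective f (Finite.injective_iff_bijective.1 hf), ?_⟩
  apply List.ext_getElem
  · simp [hlen]
  · intro i h1 h2
    simp [f]

theorem mainTheorem4 (d : ℕ) (hd : 1 ≤ d) :
    ∃ (P : Prog (d + 1)) (C : ℕ),
      ∀ (n : ℕ) (L : Set (SV (Fin n))) (χ : (Fin (d + 1) → Fin n) → SignType)
        (φ : Fin (d - 1) → SV (Fin n)),
        IsOrientedMatroid L → HasRank L (d + 1) → IsAcyclicOM L → NoDuplicates L →
        IsChirotopeOf χ L → IsFaceFlag L φ →
        ∃ π : Fin n ≃ Fin n,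
          (∀ ρ : List (Fin n),
            IsFlagOrder d Finset.univ L χ (flagSeq φ) ρ ↔ ρ = List.ofFn π) ∧
          ∀ (inp : ℕ → ℕ) (addr : (Fin (d + 2) → SV (Fin n)) → ℕ),
            StoresArrangement d L inp addr →
            ∀ τ : Fin (d + 2) → SV (Fin n), IsMaxCovChain L τ → ChainExtends τ φ →
              ∃ (t : ℕ) (s : MState), t ≤ C * n ∧
                Exec χ inp P (initState n (addr τ)) t s ∧
                ∀ i : Fin n, s.mem i = π i := by
  refine ⟨Prog.flagOrder d, initCost d d + listCost d d + 18,
    fun n L χ φ hL _ hA hnd hχ ⟨τ₀, hτ₀, hφ₀⟩ => ?_⟩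
  have hX := hφ₀.isPosFlag hL hτ₀
  have hlevel := hχ.isLevel hd hL hτ₀ hφ₀
  obtain ⟨⟨ρ, hρ⟩, huniq, hmem⟩ := isLevelOrder_existsUnique hL hnd hd hX d le_rfl _ _ hlevel
  obtain ⟨π, hπ⟩ := exists_equiv_ofFn (hmem ρ hρ).1
    fun e => ((hmem ρ hρ).2 e).2 (Finset.mem_univ e)
  refine ⟨π, fun ρ' => ?_, fun inp addr hs τ hτ hφ => ?_⟩
  · rw [← isLevelOrder_univ_iff, ← hπ]
    exact ⟨fun h => huniq χ hlevel (fun _ _ _ => rfl) ρ' ρ h hρ, fun h => h ▸ hρ⟩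
  · have hlen : ρ.length = n := by rw [hπ, List.length_ofFn]
    -- The order was found with `τ₀`, but the facts used about it involve only the flag, so any
    -- extending chain `τ` may be the starting record.
    obtain ⟨t, s, ht, he, hs⟩ := Runs.flagOrder ⟨hL, hA, hnd, hd, hX, hs⟩ hτ
      (fun _ => hφ.chainAt_eq) hlevel hρ hlen
    refine ⟨t, s, ht, he, fun i => ?_⟩
    rw [hs i (by omega)]
    simp [hπ]
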